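/- Let $d\ge 1$, let $\sigma:\mathbb R^d\to\mathbb R^{d\times d}$ be such that $a=\sigma\sigma^{\mathrm T}$ is smooth, uniformly positive definite and bounded, that is, $\lambda|\xi|^2\le\langle\xi,a(x)\xi\rangle\le\Lambda|\xi|^2$ for all $x,\xi\in\mathbb R^d$ and some $\Lambda>\lambda>0$, and let $b:\mathbb R^d\to\mathbb R^d$ be smooth. Suppose that the stochastic differential equation $$dX_t=b(X_t)\,dt+\sqrt2\,\sigma(X_t)\,dW_t$$ has, for every starting point, a solution for all times $t\ge 0$, defining a Markov process with generator $Lu=\operatorname{tr}(a\nabla^2u)+b\cdot\nabla u$, and that this process has an invariant probability distribution with a density $\rho>0$ of class $C^2$ that satisfies $$L^*\rho=\sum_{i,j}\partial_i\partial_j(a_{ij}\rho)-\nabla\cdot(b\rho)=0 .$$ Let $A,B\subset\mathbb R^d$ be bounded open sets with smooth boundary and with $\overline A\cap\overline B=\emptyset$, and let $\Theta=\mathbb R^d\setminus\overline{A\cup B}$. Let $\tau_A,\tau_B$ be the first hitting times of $\overline A$ and $\overline B$ by $X_t$, and let $$q(x)=\mathbb P(\tau_A>\tau_B\mid X_0=x)$$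 be the forward committor function, which is taken to be of class $C^2$ in $\Theta$ and $C^1$ up to the boundary, on $\overline\Theta$. Let $\hat n$ be the unit normal on $\partial\Theta=\partial A\cup\partial B$ exterior to $\Theta$, let $\sigma_A,\sigma_B,\sigma_\Theta$ be the surface measures on $\partial A,\partial B,\partial\Theta$, and define, with $\nabla q$ taken from the side of $\Theta$, $$\eta_A(dx)=-\rho(x)\,\hat n(x)\cdot a(x)\nabla q(x)\,d\sigma_A(x),\qquad \eta_B(dx)=\rho(x)\,\hat n(x)\cdot a(x)\nabla q(x)\,d\sigma_B(x).$$ Then $\rho\,\hat n\cdot a\nabla q$ is integrable on $\partial A$ and on $\partial B$, and $\eta_A(\partial A)=\eta_B(\partial B)$. That is, $$\int_{\partial A}\rho\,\hat n\cdot a\nabla q\,d\sigma_A+\int_{\partial B}\rho\,\hat n\cdot a\nabla q\,d\sigma_B=\int_{\partial\Theta}\rho\,\hat n\cdot a\nabla q\,d\sigma_\Theta=0 .$$ -/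

import Mathlib

open MeasureTheory ProbabilityTheory
open scoped NNReal ENNReal ContDiff

noncomputable section

namespace TransitionPath

/-- The Euclidean space `ℝ^d`. -/
abbrev Space (d : ℕ) := EuclideanSpace ℝ (Fin d)

/-! ### The differential operators -/

/-- The partial derivative `∂u/∂x_i`. -/
def pderiv {d : ℕ} (i : Fin d) (u : Space d → ℝ) (x : Space d) : ℝ :=
  fderiv ℝ u x (EuclideanSpace.single i 1)

/-- The generator `L u = tr (a ∇²u) + b · ∇u`. -/
def generator {d : ℕ} (a : Space d → Matrix (Fin d) (Fin d) ℝ) (b : Space d → Space d)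
    (u : Space d → ℝ) (x : Space d) : ℝ :=
  (∑ i, ∑ j, a x i j * pderiv i (pderiv j u) x) + ∑ i, b x i * pderiv i u x

/-- The formal adjoint `L* ρ = ∑ ∂_i ∂_j (a_ij ρ) - ∑ ∂_i (b_i ρ)` with respect to
Lebesgue measure. -/
def adjointGenerator {d : ℕ} (a : Space d → Matrix (Fin d) (Fin d) ℝ) (b : Space d → Space d)
    (ρ : Space d → ℝ) (x : Space d) : ℝ :=
  (∑ i, ∑ j, pderiv i (pderiv j (fun y => a y i j * ρ y)) x) -
    ∑ i, pderiv i (fun y => b y i * ρ y) x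

/-- `a` is uniformly positive definite and bounded. -/
def UniformlyElliptic {d : ℕ} (a : Space d → Matrix (Fin d) (Fin d) ℝ) : Prop :=
  ∃ lam Lam : ℝ, 0 < lam ∧ lam < Lam ∧ ∀ x ξ : Space d,
    lam * ‖ξ‖ ^ 2 ≤ inner ℝ ξ (Matrix.toEuclideanLin (a x) ξ) ∧
      inner ℝ ξ (Matrix.toEuclideanLin (a x) ξ) ≤ Lam * ‖ξ‖ ^ 2

/-! ### The diffusion process, through its laws on path space -/

/-- The space of continuous paths `[0, ∞) → ℝ^d`. Its σ-algebra (inherited from the product) is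
the one generated by the coordinate maps, that is, the Borel σ-algebra of locally uniform
convergence. -/
abbrev Path (d : ℕ) := {w : ℝ≥0 → Space d // Continuous w}

/-- The canonical process: the position of the path `w` at time `t`. -/
def coord {d : ℕ} (t : ℝ≥0) (w : Path d) : Space d := w.1 t

theorem measurable_coord {d : ℕ} (t : ℝ≥0) : Measurable (coord (d := d) t) :=
  (measurable_pi_apply t).comp measurable_subtype_coe

/-- The filtration generated by the canonical process. -/
def canonicalFiltration (d : ℕ) : Filtration ℝ≥0 (inferInstance : MeasurableSpace (Path d)) :=
  Filtration.natural (fun t => coord (d := d) t) (fun t => (measurable_coord t).stronglyMeasurable)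

/-- The time shift `(θ_s w)(t) = w(s + t)`. -/
def shift {d : ℕ} (s : ℝ≥0) (w : Path d) : Path d :=
  ⟨fun t => w.1 (s + t), w.2.comp (continuous_const.add continuous_id)⟩

/-- `P x` is, for every `x`, the law of the solution of
`dX_t = b(X_t) dt + √2 σ(X_t) dW_t`, `X_0 = x`, where `a = σ σᵀ`. That is, `P` is a Markov family
of (global in time) solutions of the martingale problem for the generator
`L u = tr (a ∇²u) + b · ∇u`. -/
structure IsDiffusion {d : ℕ} (a : Space d → Matrix (Fin d) (Fin d) ℝ) (b : Space d → Space d)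
    (P : Kernel (Space d) (Path d)) : Prop where
  isMarkovKernel : IsMarkovKernel P
  /-- the process starts at `x` -/
  start : ∀ x, ∀ᵐ w ∂(P x), coord 0 w = x
  /-- `u(X_t) - u(X_0) - ∫_0^t L u (X_s) ds` is a martingale for all `u ∈ C²_c(ℝ^d)` -/
  martingale : ∀ x, ∀ u : Space d → ℝ, ContDiff ℝ 2 u → HasCompactSupport u →
    Martingale (fun (t : ℝ≥0) (w : Path d) =>
        u (coord t w) - u (coord 0 w) -
          ∫ s in (0 : ℝ)..t, generator a b u (coord s.toNNReal w))
      (canonicalFiltration d) (P x)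
  /-- the Markov property: given the past up to time `s`, the future after `s` has the
  law `P X_s` -/
  markov : ∀ x, ∀ s : ℝ≥0, ∀ F : Set (Path d), MeasurableSet[canonicalFiltration d s] F →
    ∀ S : Set (Path d), MeasurableSet S →
      P x (F ∩ shift s ⁻¹' S) = ∫⁻ w in F, P (coord s w) S ∂(P x)

/-- The measure `ρ(x) dx`. -/
def densityMeasure {d : ℕ} (ρ : Space d → ℝ) : Measure (Space d) :=
  (volume : Measure (Space d)).withDensity fun x => ENNReal.ofReal (ρ x)

/-- `ρ(x) dx` is an invariant probability distribution of the Markov process with path laws `P`: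
if `X_0` has this distribution, then so has `X_t`, for every `t ≥ 0`. -/
def IsInvariantDensity {d : ℕ} (P : Kernel (Space d) (Path d)) (ρ : Space d → ℝ) : Prop :=
  IsProbabilityMeasure (densityMeasure ρ) ∧
    ∀ t : ℝ≥0, Kernel.Invariant (P.map (coord t)) (densityMeasure ρ)

/-- The hitting time `inf {t ≥ 0 | X_t ∈ closure D}`, equal to `∞` if the set is never hit. -/
def hittingTime {d : ℕ} (D : Set (Space d)) (w : Path d) : ℝ≥0∞ :=
  ⨅ (t : ℝ≥0) (_ : coord t w ∈ closure D), (t : ℝ≥0∞)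

/-- The forward committor function `q(x) = ℙ(τ_A > τ_B | X_0 = x)`. -/
def committor {d : ℕ} (P : Kernel (Space d) (Path d)) (A B : Set (Space d)) (x : Space d) : ℝ :=
  (P x).real {w | hittingTime B w < hittingTime A w}

/-! ### Smooth boundaries, unit normals and fluxes -/

/-- `φ` is a smooth local defining function of the open set `D` near its boundary point `x`. -/
def IsDefiningFunction {d : ℕ} (D : Set (Space d)) (x : Space d) (φ : Space d → ℝ) : Prop :=
  ContDiff ℝ ∞ φ ∧ gradient φ x ≠ 0 ∧
    ∃ U : Set (Space d), IsOpen U ∧ x ∈ U ∧ D ∩ U = {y | φ y < 0} ∩ U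

/-- The set `D` (to be used for open sets) has a smooth boundary: near each boundary point it lies
on one side of a smooth hypersurface. -/
def HasSmoothBoundary {d : ℕ} (D : Set (Space d)) : Prop :=
  ∀ x ∈ frontier D, ∃ φ, IsDefiningFunction D x φ

open Classical in
/-- The unit normal exterior to `D` at the boundary point `x`: the normalized gradient of a
defining function (which one does not matter). -/
def unitNormal {d : ℕ} (D : Set (Space d)) (x : Space d) : Space d :=
  if h : ∃ φ, IsDefiningFunction D x φ then
    ‖gradient h.choose x‖⁻¹ • gradient h.choose x
  else 0

/-- The region `Θ`, the complement of the closure of `A ∪ B`. -/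
def region {d : ℕ} (A B : Set (Space d)) : Set (Space d) := (closure (A ∪ B))ᶜ

/-- The surface measure on the boundary of `D`: the `(d-1)`-dimensional Hausdorff measure,
normalized as Lebesgue measure. -/
def surfaceMeasure {d : ℕ} (D : Set (Space d)) : Measure (Space d) :=
  (μHE[d - 1] : Measure (Space d)).restrict (frontier D)

/-- The flux density `ρ n̂ · a ∇q` on the boundary of `Θ`, where `n̂` is the unit normal exterior to
`Θ` and the gradient is taken from the side of `Θ`. -/
def flux {d : ℕ} (a : Space d → Matrix (Fin d) (Fin d) ℝ) (ρ q : Space d → ℝ) (Θ : Set (Space d))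
    (x : Space d) : ℝ :=
  ρ x * inner ℝ (unitNormal Θ x) (Matrix.toEuclideanLin (a x) (gradientWithin q (closure Θ) x))

/-- The measure `η_A = - ρ n̂ · a ∇q dσ_A`. -/
def etaA {d : ℕ} (a : Space d → Matrix (Fin d) (Fin d) ℝ) (ρ q : Space d → ℝ)
    (A B : Set (Space d)) : SignedMeasure (Space d) :=
  (surfaceMeasure A).withDensityᵥ fun x => -flux a ρ q (region A B) x

/-- The measure `η_B = ρ n̂ · a ∇q dσ_B`. -/
def etaB {d : ℕ} (a : Space d → Matrix (Fin d) (Fin d) ℝ) (ρ q : Space d → ℝ)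
    (A B : Set (Space d)) : SignedMeasure (Space d) :=
  (surfaceMeasure B).withDensityᵥ fun x => flux a ρ q (region A B) x

end TransitionPath

end

/-!
The flux `ρ a ∇q` is part of a vector field that is divergence free up to terms with `q`, so that its
total flux through `∂Θ` is a statement about what happens at infinity. No growth condition on `b`
is available, and the flux at infinity is controlled through the process and not through estimates.

*Reduction to a compactly supported function.* By compactness there is a bounded `C²` function `u`
on the whole space that is locally constant near the closures of `A` and `B`, with the boundary
values `0` and `1` of `q`, and that equals `q` outside a ball
(`exists_decomposition_committor`). Then `w = q - u` has compact support and vanishes on `∂Θ`, and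
its flux through `∂Θ` is that of `q`. For `w` Green's formula holds
(`integral_generator_eq_integral_flux`): the field `ρ a ∇w - w K`, where `K` is the current with
`div K = L* ρ = 0`, has divergence `ρ L w`, and its normal component on `∂Θ` is the flux density.
Hence the total flux is `∫_Θ ρ L w`. As `L q = 0` in `Θ` and `L u = 0` outside `Θ`, this integral is
`-∫ ρ L u` over the whole space, and it remains to see that `∫ ρ L u = 0`.

*The process.* Doob's maximal inequality for the martingales of the martingale problem shows that
the probability to leave a fixed neighbourhood within time `t` is `o(t)`
(`IsDiffusion.tendsto_inv_mul_measure_exit`). Therefore `(E_x u(X_t) - u(x)) / t → L u(x)` for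
bounded measurable `u` that are `C²` near `x` (`IsDiffusion.tendsto_generator`). By the Markov
property `E_x q(X_t) - q(x)` is also `o(t)` for `x ∈ Θ`, because it is at most the probability to
hit `A` or `B` before time `t`; so `L q = 0` in `Θ`
(`IsDiffusion.generator_committor_eq_zero`). Finally `∫ ρ (E_x u(X_t) - u(x)) dx = 0` for every `t`
by invariance, and dividing by `t` gives `∫ ρ L u = 0`
(`IsDiffusion.integral_generator_eq_zero`). The difference quotient converges boundedly because,
outside a ball, it can be compared with the difference quotient of `q`.

*The divergence theorem* (`integral_divergence_eq`) is needed for regions with smooth boundary and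
for fields that are only continuous up to the boundary. Near a boundary point the region lies below
the graph of a Lipschitz function of arbitrarily small slope `ε` over the tangent plane
(`IsDefiningFunction.exists_isHeight`). On such a graph the Hausdorff measure agrees with Lebesgue
measure on the base up to a factor `1 + O(ε)` (`IsHeight.baseMeasure_le`). Integrating by parts
against the cutoff function of a thin layer below the graph gives the divergence theorem with an
error of order `ε` (`IsHeight.abs_integral_divergence_sub_le`). A fine partition of unity makes
the total error arbitrarily small.
-/

namespace TransitionPath

open Set Filter Topology Metric

/-! ### Height functions of Lipschitz graphs -/

/-- `m` is the height function below a Lipschitz graph with slope at most `ε` over the hyperplane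
orthogonal to `v`: `m x` is the signed distance, in the direction `v`, from `x` to the graph.
The region below the graph is `{0 < m}`, and the graph itself is `{m = 0}`. -/
structure IsHeight {d : ℕ} (m : Space d → ℝ) (v : Space d) (ε : ℝ≥0) : Prop where
  norm_eq : ‖v‖ = 1
  shift : ∀ x t, m (x + t • v) = m x - t
  tilt : ∀ x w, inner ℝ v w = 0 → |m (x + w) - m x| ≤ ε * ‖w‖

/-- A height function is affine up to an error of size `ε`. -/
theorem IsHeight.abs_sub_add_inner_le {d : ℕ} {m : Space d → ℝ} {v : Space d} {ε : ℝ≥0}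
    (hm : IsHeight m v ε) (x y : Space d) :
    |m y - m x + inner ℝ v (y - x)| ≤ ε * ‖y - x‖ := by
  obtain ⟨t, ht⟩ : ∃ t : ℝ, t = inner ℝ v (y - x) := ⟨_, rfl⟩
  obtain ⟨w, hw⟩ : ∃ w, w = (y - x) - t • v := ⟨_, rfl⟩
  have hvw : inner ℝ v w = 0 := by
    rw [hw, inner_sub_right, inner_smul_right, real_inner_self_eq_norm_sq, hm.norm_eq, ← ht]
    ring
  have hy : y = (x + w) + t • v := by rw [hw]; abel
  have h1 : m y = m (x + w) - t := by
    conv_lhs => rw [hy]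
    exact hm.shift _ _
  have hw' : ‖w‖ ≤ ‖y - x‖ := by
    have h3 : ‖y - x‖ ^ 2 = ‖w‖ ^ 2 + t ^ 2 := by
      have : y - x = w + t • v := by rw [hw]; abel
      rw [this, norm_add_sq_real, inner_smul_right, real_inner_comm, hvw, norm_smul, hm.norm_eq]
      simp
    nlinarith [norm_nonneg w, norm_nonneg (y - x), sq_nonneg t]
  calc |m y - m x + inner ℝ v (y - x)| = |m (x + w) - m x| := by rw [h1, ← ht]; ring_nf
    _ ≤ ε * ‖w‖ := hm.tilt x w hvw
    _ ≤ ε * ‖y - x‖ := by gcongr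

theorem IsHeight.abs_sub_le {d : ℕ} {m : Space d → ℝ} {v : Space d} {ε : ℝ≥0}
    (hm : IsHeight m v ε) (x y : Space d) : |m y - m x| ≤ (1 + ε) * ‖y - x‖ := by
  have h1 := abs_le.mp (hm.abs_sub_add_inner_le x y)
  have h2 := abs_real_inner_le_norm v (y - x)
  rw [hm.norm_eq, one_mul] at h2
  have h3 := abs_le.mp h2
  rw [abs_le]
  constructor <;> linarith [h1.1, h1.2, h3.1, h3.2]

theorem IsHeight.lipschitz {d : ℕ} {m : Space d → ℝ} {v : Space d} {ε : ℝ≥0}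
    (hm : IsHeight m v ε) : LipschitzWith (1 + ε) m := by
  refine LipschitzWith.of_dist_le_mul fun x y => ?_
  rw [Real.dist_eq, dist_eq_norm]
  simpa using hm.abs_sub_le y x

/-- Near a point where the gradient does not vanish, a sublevel set is the region below a Lipschitz
graph over the tangent hyperplane, of arbitrarily small slope. -/
theorem exists_isHeight {d : ℕ} {φ : Space d → ℝ} {x₀ : Space d}
    (hφ : HasStrictFDerivAt φ (innerSL ℝ (gradient φ x₀)) x₀) (hg : gradient φ x₀ ≠ 0)
    {ε : ℝ≥0} (hε : 0 < ε) :
    ∃ m : Space d → ℝ, IsHeight m (‖gradient φ x₀‖⁻¹ • gradient φ x₀) ε ∧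
      ∀ᶠ x in 𝓝 x₀, φ x < 0 ↔ 0 < m x := by
  set g := gradient φ x₀ with hgdef
  have hgn : 0 < ‖g‖ := norm_pos_iff.mpr hg
  set v := ‖g‖⁻¹ • g with hv
  have hvn : ‖v‖ = 1 := by rw [hv, norm_smul, norm_inv, norm_norm, inv_mul_cancel₀ hgn.ne']
  set c : ℝ≥0 := min (1 / 2) (ε / 2) with hc
  have hc0 : 0 < c := by rw [hc]; exact lt_min (by norm_num) (by positivity)
  have hc1 : (c : ℝ) ≤ 1 / 2 := by
    have : c ≤ 1 / 2 := min_le_left _ _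
    exact_mod_cast this
  have hc2 : 2 * (c : ℝ) ≤ ε := by
    have : c ≤ ε / 2 := min_le_right _ _
    have h : (c : ℝ) ≤ ε / 2 := by exact_mod_cast this
    linarith
  obtain ⟨s, hs, hlin⟩ := hφ.approximates_deriv_on_nhds (c := c * ‖g‖₊)
    (Or.inr (mul_pos hc0 (by exact_mod_cast hgn)))
  have hlip : LipschitzOnWith c (fun x => ‖g‖⁻¹ * (φ x - inner ℝ g x)) s := by
    refine LipschitzOnWith.of_dist_le_mul fun x hx y hy => ?_
    have h := hlin x hx y hy
    rw [Real.dist_eq, dist_eq_norm]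
    have e : ‖g‖⁻¹ * (φ x - inner ℝ g x) - ‖g‖⁻¹ * (φ y - inner ℝ g y)
        = ‖g‖⁻¹ * (φ x - φ y - innerSL ℝ g (x - y)) := by
      rw [innerSL_apply_apply, inner_sub_right]; ring
    rw [e, abs_mul, abs_of_pos (inv_pos.mpr hgn), inv_mul_le_iff₀ hgn]
    calc |φ x - φ y - innerSL ℝ g (x - y)| ≤ (c * ‖g‖₊ : ℝ≥0) * ‖x - y‖ := h
      _ = ‖g‖ * (c * ‖x - y‖) := by push_cast; ring
  -- a Lipschitz extension of `‖g‖⁻¹ φ` minus its linear part makes the construction global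
  obtain ⟨p, hp, hpeq⟩ := hlip.extend_real
  have hpabs : ∀ x y, |p x - p y| ≤ c * ‖x - y‖ := fun x y => by
    have := hp.dist_le_mul x y
    rwa [Real.dist_eq, dist_eq_norm] at this
  -- the rescaled function, extended to the whole space with almost constant gradient
  set Φ : Space d → ℝ := fun x => inner ℝ v x + p x with hΦ
  have hΦs : ∀ x ∈ s, Φ x = ‖g‖⁻¹ * φ x := fun x hx => by
    simp only [hΦ]
    rw [← hpeq hx, hv, real_inner_smul_left]; ring
  have hmono : ∀ x t, 0 ≤ t → Φ x + t / 2 ≤ Φ (x + t • v) := fun x t ht => by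
    have h := abs_le.mp (hpabs (x + t • v) x)
    rw [add_sub_cancel_left, norm_smul, hvn, Real.norm_eq_abs, abs_of_nonneg ht] at h
    simp only [hΦ, inner_add_right, inner_smul_right, real_inner_self_eq_norm_sq, hvn]
    nlinarith [h.1]
  have hadd : ∀ (x : Space d) (s t : ℝ), x + s • v + t • v = x + (s + t) • v := fun x s t => by
    rw [add_smul, add_assoc]
  have hcont : Continuous Φ := by
    have := hp.continuous
    fun_prop
  have hex : ∀ x, ∃ t : ℝ, Φ (x + t • v) = 0 := fun x => by
    have h1 := hmono x (2 * |Φ x|) (by positivity)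
    have h2 := hmono (x + (-(2 * |Φ x|)) • v) (2 * |Φ x|) (by positivity)
    rw [hadd, neg_add_cancel, zero_smul, add_zero] at h2
    have hc' : Continuous fun t : ℝ => Φ (x + t • v) := by fun_prop
    exact mem_range_of_exists_le_of_exists_ge hc'
      ⟨-(2 * |Φ x|), by linarith [le_abs_self (Φ x)]⟩ ⟨2 * |Φ x|, by linarith [neg_abs_le (Φ x)]⟩
  -- `m x` is the unique zero of `Φ` on the line through `x` in the direction `v`
  choose m hm using hex
  have huniq : ∀ x t, Φ (x + t • v) = 0 → t = m x := fun x t ht => by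
    rcases le_total t (m x) with h | h
    · have := hmono (x + t • v) (m x - t) (by linarith)
      rw [hadd, add_sub_cancel, hm, ht] at this
      linarith
    · have := hmono (x + m x • v) (t - m x) (by linarith)
      rw [hadd, add_sub_cancel, hm, ht] at this
      linarith
  refine ⟨m, ⟨hvn, fun x t => ?_, fun x w hw => ?_⟩, ?_⟩
  · refine (huniq _ _ ?_).symm
    rw [hadd, add_sub_cancel, hm]
  · have h1 := hm x
    have h2 := hm (x + w)
    have h3 := hpabs (x + w + m (x + w) • v) (x + m x • v)
    have e : x + w + m (x + w) • v - (x + m x • v) = w + (m (x + w) - m x) • v := by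
      rw [sub_smul]; abel
    rw [e] at h3
    have h4 : ‖w + (m (x + w) - m x) • v‖ ≤ ‖w‖ + |m (x + w) - m x| := by
      refine (norm_add_le _ _).trans ?_
      rw [norm_smul, hvn, mul_one, Real.norm_eq_abs]
    simp only [hΦ, inner_add_right, inner_smul_right, real_inner_self_eq_norm_sq, hvn, hw] at h1 h2
    have h5 : |m (x + w) - m x| ≤ c * (‖w‖ + |m (x + w) - m x|) := by
      have : m (x + w) - m x = -(p (x + w + m (x + w) • v) - p (x + m x • v)) := by linarith
      calc |m (x + w) - m x| = |p (x + w + m (x + w) • v) - p (x + m x • v)| := by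
            rw [this, abs_neg]
        _ ≤ _ := h3.trans (by gcongr)
    nlinarith [abs_nonneg (m (x + w) - m x), norm_nonneg w]
  · filter_upwards [hs] with x hx
    have h1 : φ x < 0 ↔ Φ x < 0 := by
      rw [hΦs x hx]
      constructor
      · intro h; exact mul_neg_of_pos_of_neg (inv_pos.mpr hgn) h
      · intro h; by_contra h'; push Not at h'
        exact absurd h (not_lt.mpr (mul_nonneg (inv_pos.mpr hgn).le h'))
    rw [h1]
    constructor
    · intro h
      by_contra h'
      push Not at h'
      have := hmono (x + m x • v) (-m x) (by linarith)
      rw [hadd, add_neg_cancel, zero_smul, add_zero, hm] at this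
      linarith
    · intro h
      have := hmono x (m x) h.le
      rw [hm] at this
      linarith

theorem hasStrictFDerivAt_gradient {d : ℕ} {φ : Space d → ℝ} (hφ : ContDiff ℝ ∞ φ)
    (x : Space d) : HasStrictFDerivAt φ (innerSL ℝ (gradient φ x)) x := by
  have h := (hφ.contDiffAt (x := x)).hasStrictFDerivAt (by simp)
  have : innerSL ℝ (gradient φ x) = fderiv ℝ φ x := by
    ext y
    simp [gradient]
  rwa [this]

section LocalGraph

variable {d : ℕ} {m : Space d → ℝ} {v : Space d} {ε : ℝ≥0} {D U : Set (Space d)}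

theorem IsHeight.mem_closure_iff (hm : IsHeight m v ε) (hU : IsOpen U)
    (hD : ∀ x ∈ U, x ∈ D ↔ 0 < m x) {x : Space d} (hx : x ∈ U) : x ∈ closure D ↔ 0 ≤ m x := by
  constructor
  · intro h
    by_contra! hneg
    have hO : IsOpen (U ∩ {y | m y < 0}) :=
      hU.inter (isOpen_lt hm.lipschitz.continuous continuous_const)
    obtain ⟨y, hy, hyD⟩ := _root_.mem_closure_iff.mp h _ hO ⟨hx, hneg⟩
    have := (hD y hy.1).mp hyD
    exact absurd this (not_lt.mpr (le_of_lt hy.2))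
  · intro h
    have hlim : Tendsto (fun t : ℝ => x + (-t) • v) (𝓝[>] 0) (𝓝 x) := by
      have : Continuous fun t : ℝ => x + (-t) • v := by fun_prop
      have h2 := this.tendsto 0
      simp only [neg_zero, zero_smul, add_zero] at h2
      exact h2.mono_left nhdsWithin_le_nhds
    refine mem_closure_of_tendsto hlim ?_
    filter_upwards [hlim.eventually (hU.mem_nhds hx), self_mem_nhdsWithin] with t htU ht
    rw [hD _ htU, hm.shift]
    have : 0 < t := ht
    linarith

theorem IsHeight.mem_frontier_iff (hm : IsHeight m v ε) (hU : IsOpen U) (hDo : IsOpen D)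
    (hD : ∀ x ∈ U, x ∈ D ↔ 0 < m x) {x : Space d} (hx : x ∈ U) : x ∈ frontier D ↔ m x = 0 := by
  rw [frontier, hDo.interior_eq, Set.mem_sdiff, hm.mem_closure_iff hU hD hx, hD x hx]
  constructor
  · intro h; exact le_antisymm (not_lt.mp h.2) h.1
  · intro h; simp [h]

end LocalGraph

/-- Around each boundary point, a region with smooth boundary lies below a graph over the tangent
hyperplane, of arbitrarily small slope. -/
theorem IsDefiningFunction.exists_isHeight {d : ℕ} {D : Set (Space d)} {x₀ : Space d}
    {φ : Space d → ℝ} (h : IsDefiningFunction D x₀ φ) {ε : ℝ≥0} (hε : 0 < ε) :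
    ∃ (m : Space d → ℝ) (U : Set (Space d)), IsOpen U ∧ x₀ ∈ U ∧
      IsHeight m (‖gradient φ x₀‖⁻¹ • gradient φ x₀) ε ∧ (∀ x ∈ U, x ∈ D ↔ 0 < m x) ∧
      ∀ x ∈ U, φ x < 0 ↔ 0 < m x := by
  obtain ⟨hφ, hg, U, hU, hxU, hDU⟩ := h
  obtain ⟨m, hm, hev⟩ := TransitionPath.exists_isHeight (hasStrictFDerivAt_gradient hφ x₀) hg hε
  obtain ⟨V, hV, hVo, hxV⟩ := _root_.eventually_nhds_iff.mp hev
  refine ⟨m, U ∩ V, hU.inter hVo, ⟨hxU, hxV⟩, hm, fun x hx => ?_, fun x hx => hV x hx.2⟩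
  rw [← hV x hx.2]
  constructor
  · intro h; exact (hDU.subset ⟨h, hx.1⟩).1
  · intro h; exact (hDU.superset ⟨h, hx.1⟩).1

/-- The unit normal does not depend on the defining function that `unitNormal` chooses. -/
theorem IsDefiningFunction.normal_unique {d : ℕ} {D : Set (Space d)} {x : Space d}
    {φ ψ : Space d → ℝ} (hφ : IsDefiningFunction D x φ) (hψ : IsDefiningFunction D x ψ)
    (hx : x ∈ frontier D) (hDo : IsOpen D) :
    ‖gradient φ x‖⁻¹ • gradient φ x = ‖gradient ψ x‖⁻¹ • gradient ψ x := by
  set n₁ := ‖gradient φ x‖⁻¹ • gradient φ x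
  set n₂ := ‖gradient ψ x‖⁻¹ • gradient ψ x
  by_contra hne
  have hd : 0 < ‖n₁ - n₂‖ := norm_pos_iff.mpr (sub_ne_zero.mpr hne)
  -- moving in the direction `n₂ - n₁` leads into `D` for `φ`, but out of `D` for `ψ`
  set ε : ℝ≥0 := ⟨‖n₁ - n₂‖ ^ 2 / 8, by positivity⟩ with hε
  have hε0 : 0 < ε := by
    rw [← NNReal.coe_pos]; change 0 < ‖n₁ - n₂‖ ^ 2 / 8; positivity
  obtain ⟨m₁, U₁, hU₁, hx₁, hm₁, hD₁, -⟩ := hφ.exists_isHeight hε0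
  obtain ⟨m₂, U₂, hU₂, hx₂, hm₂, hD₂, -⟩ := hψ.exists_isHeight hε0
  have key : ∀ {m : Space d → ℝ} {n : Space d}, IsHeight m n ε → m x = 0 → ∀ t : ℝ, 0 < t →
      |m (x + t • (n₂ - n₁)) + t * inner ℝ n (n₂ - n₁)| ≤ t * (ε * ‖n₂ - n₁‖) := by
    intro m n hm h0 t ht
    have h := hm.abs_sub_add_inner_le x (x + t • (n₂ - n₁))
    rw [add_sub_cancel_left, h0, sub_zero, inner_smul_right, norm_smul,
      Real.norm_of_nonneg ht.le] at h
    linarith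
  have hn : ‖n₁ - n₂‖ ≤ 2 := by
    refine (norm_sub_le _ _).trans ?_
    rw [hm₁.norm_eq, hm₂.norm_eq]; norm_num
  have hsq : ‖n₁ - n₂‖ ^ 2 = 2 - 2 * inner ℝ n₁ n₂ := by
    rw [norm_sub_sq_real, hm₁.norm_eq, hm₂.norm_eq]; ring
  have hlim : Tendsto (fun t : ℝ => x + t • (n₂ - n₁)) (𝓝[>] 0) (𝓝 x) := by
    have : Continuous fun t : ℝ => x + t • (n₂ - n₁) := by fun_prop
    have h2 := this.tendsto 0
    simp only [zero_smul, add_zero] at h2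
    exact h2.mono_left nhdsWithin_le_nhds
  obtain ⟨t, ⟨ht₁, ht₂⟩, ht⟩ := ((hlim.eventually ((hU₁.inter hU₂).mem_nhds ⟨hx₁, hx₂⟩)).and
    self_mem_nhdsWithin).exists
  have ht : 0 < t := ht
  have a₁ := key hm₁ ((hm₁.mem_frontier_iff hU₁ hDo hD₁ hx₁).mp hx) t ht
  have a₂ := key hm₂ ((hm₂.mem_frontier_iff hU₂ hDo hD₂ hx₂).mp hx) t ht
  rw [inner_sub_right, real_inner_self_eq_norm_sq, hm₁.norm_eq] at a₁
  rw [inner_sub_right, real_inner_self_eq_norm_sq, hm₂.norm_eq, real_inner_comm] at a₂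
  rw [norm_sub_rev] at a₁ a₂
  have hεv : (ε : ℝ) = ‖n₁ - n₂‖ ^ 2 / 8 := rfl
  have b : (ε : ℝ) * ‖n₁ - n₂‖ ≤ ‖n₁ - n₂‖ ^ 2 / 4 := by
    rw [hεv]; nlinarith [sq_nonneg ‖n₁ - n₂‖]
  set c : ℝ := inner ℝ n₁ n₂
  have hc : 0 < 1 - c := by nlinarith
  have hb : (ε : ℝ) * ‖n₁ - n₂‖ ≤ (1 - c) / 2 := by rw [hsq] at b; linarith
  have htb : t * ((ε : ℝ) * ‖n₁ - n₂‖) ≤ t * ((1 - c) / 2) :=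
    mul_le_mul_of_nonneg_left hb ht.le
  have ht1c : 0 < t * (1 - c) := mul_pos ht hc
  have p₁ : 0 < m₁ (x + t • (n₂ - n₁)) := by
    have := (abs_le.mp a₁).1
    nlinarith
  have p₂ : m₂ (x + t • (n₂ - n₁)) < 0 := by
    have := (abs_le.mp a₂).2
    nlinarith
  have := (hD₂ _ ht₂).mp ((hD₁ _ ht₁).mpr p₁)
  linarith

theorem IsDefiningFunction.unitNormal_eq {d : ℕ} {D : Set (Space d)} {x : Space d}
    {φ : Space d → ℝ} (hφ : IsDefiningFunction D x φ) (hx : x ∈ frontier D) (hDo : IsOpen D) :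
    unitNormal D x = ‖gradient φ x‖⁻¹ • gradient φ x := by
  have hex : ∃ φ, IsDefiningFunction D x φ := ⟨φ, hφ⟩
  rw [unitNormal, dif_pos hex]
  exact hex.choose_spec.normal_unique hφ hx hDo

/-- A single defining function gives the normal at all boundary points near a given one. -/
theorem continuousOn_unitNormal {d : ℕ} {D : Set (Space d)} (hDo : IsOpen D)
    (hD : HasSmoothBoundary D) : ContinuousOn (unitNormal D) (frontier D) := by
  intro x hx
  obtain ⟨φ, hφ⟩ := hD x hx
  have hgc : Continuous (gradient φ) := by
    have h1 : Continuous (fderiv ℝ φ) := hφ.1.continuous_fderiv (by simp)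
    exact (InnerProductSpace.toDual ℝ (Space d)).symm.continuous.comp h1
  have hne : ∀ᶠ y in 𝓝[frontier D] x, gradient φ y ≠ 0 :=
    (hgc.continuousAt.eventually_ne hφ.2.1).filter_mono nhdsWithin_le_nhds
  obtain ⟨U, hU, hxU, hDU⟩ := hφ.2.2
  have heq : unitNormal D =ᶠ[𝓝[frontier D] x]
      fun y => ‖gradient φ y‖⁻¹ • gradient φ y := by
    filter_upwards [hne, self_mem_nhdsWithin, mem_nhdsWithin_of_mem_nhds (hU.mem_nhds hxU)]
      with y h1 h2 h3
    exact IsDefiningFunction.unitNormal_eq ⟨hφ.1, h1, U, hU, h3, hDU⟩ h2 hDo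
  have hc : ContinuousAt (fun y => ‖gradient φ y‖⁻¹ • gradient φ y) x :=
    (hgc.norm.continuousAt.inv₀ (norm_ne_zero_iff.mpr hφ.2.1)).smul hgc.continuousAt
  exact (hc.continuousWithinAt).congr_of_eventuallyEq heq (hφ.unitNormal_eq hx hDo)

/-- The closure of a region with smooth boundary is a set of unique differentiability: at each
boundary point the region contains a cone. -/
theorem uniqueDiffOn_closure {d : ℕ} {D : Set (Space d)} (hDo : IsOpen D)
    (hD : HasSmoothBoundary D) : UniqueDiffOn ℝ (closure D) := by
  intro x hx
  by_cases hxD : x ∈ D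
  · exact (uniqueDiffWithinAt_of_mem_nhds (hDo.mem_nhds hxD)).mono subset_closure
  have hxf : x ∈ frontier D := by rw [frontier, hDo.interior_eq]; exact ⟨hx, hxD⟩
  obtain ⟨φ, hφ⟩ := hD x hxf
  obtain ⟨m, U, hU, hxU, hm, hDU, -⟩ := hφ.exists_isHeight (ε := 1 / 2) (by norm_num)
  set v := ‖gradient φ x‖⁻¹ • gradient φ x
  have hm0 : m x = 0 := (hm.mem_frontier_iff hU hDo hDU hxU).mp hxf
  obtain ⟨r, hr, hball⟩ := Metric.isOpen_iff.mp hU x hxU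
  set C : Set (Space d) := ball x r ∩ {y | inner ℝ v (y - x) + 1 / 2 * ‖y - x‖ < 0} with hC
  have hCo : IsOpen C := isOpen_ball.inter (isOpen_lt (by fun_prop) continuous_const)
  have hconv : Convex ℝ C := by
    refine (convex_ball x r).inter ?_
    intro y hy z hz a b ha hb hab
    simp only [mem_ofPred_eq] at hy hz ⊢
    have e : a • y + b • z - x = a • (y - x) + b • (z - x) := by
      rw [smul_sub, smul_sub]
      have : x = (a + b) • x := by rw [hab, one_smul]
      conv_lhs => rw [this, add_smul]
      abel
    rw [e, inner_add_right, inner_smul_right, inner_smul_right]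
    have h1 : ‖a • (y - x) + b • (z - x)‖ ≤ a * ‖y - x‖ + b * ‖z - x‖ := by
      refine (norm_add_le _ _).trans ?_
      rw [norm_smul, norm_smul, Real.norm_of_nonneg ha, Real.norm_of_nonneg hb]
    rcases ha.lt_or_eq with ha' | ha'
    · nlinarith
    · have hb' : b = 1 := by linarith
      subst hb'
      rw [← ha'] at h1 ⊢
      linarith
  have hCD : C ⊆ D := by
    rintro y ⟨hyb, hy⟩
    rw [hDU y (hball hyb)]
    simp only [mem_ofPred_eq] at hy
    have h5 := (abs_le.mp (hm.abs_sub_add_inner_le x y)).1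
    have h6 : ((1 / 2 : ℝ≥0) : ℝ) = 1 / 2 := by norm_num
    rw [h6, hm0] at h5
    linarith
  have hlim : Tendsto (fun t : ℝ => x + (-t) • v) (𝓝[>] 0) (𝓝 x) := by
    have : Continuous fun t : ℝ => x + (-t) • v := by fun_prop
    have h2 := this.tendsto 0
    simp only [neg_zero, zero_smul, add_zero] at h2
    exact h2.mono_left nhdsWithin_le_nhds
  have hev : ∀ᶠ t : ℝ in 𝓝[>] 0, x + (-t) • v ∈ C := by
    filter_upwards [hlim.eventually (ball_mem_nhds x hr), self_mem_nhdsWithin] with t h1 h2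
    have ht : 0 < t := h2
    refine ⟨h1, ?_⟩
    simp only [mem_ofPred_eq, add_sub_cancel_left, inner_smul_right, real_inner_self_eq_norm_sq,
      hm.norm_eq, norm_smul, norm_neg, Real.norm_of_nonneg ht.le]
    linarith
  have hxC : x ∈ closure C := mem_closure_of_tendsto hlim hev
  obtain ⟨t, ht⟩ := hev.exists
  exact (uniqueDiffWithinAt_convex hconv ⟨_, by rwa [hCo.interior_eq]⟩ hxC).mono
    (hCD.trans subset_closure)

/-! ### Smooth cutoff functions -/

theorem exists_cutoff {d : ℕ} {K U : Set (Space d)} (hK : IsCompact K) (hU : IsOpen U)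
    (hKU : K ⊆ U) : ∃ κ : Space d → ℝ, ContDiff ℝ ∞ κ ∧ HasCompactSupport κ ∧ tsupport κ ⊆ U ∧
      (∀ᶠ x in 𝓝ˢ K, κ x = 1) ∧ ∀ x, κ x ∈ Icc (0 : ℝ) 1 := by
  obtain ⟨L, hL, hKL, hLU⟩ := exists_compact_between hK hU hKU
  obtain ⟨f, hf1, hf0, hf⟩ := exists_contMDiffMap_one_nhds_of_subset_interior
    (modelWithCornersSelf ℝ (Space d)) (n := ⊤) hK.isClosed hKL
  have hsupp : Function.support f ⊆ L := fun x hx => by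
    by_contra h
    exact hx (hf0 x h)
  have hts : tsupport f ⊆ L := closure_minimal hsupp hL.isClosed
  exact ⟨f, f.contMDiff.contDiff, hL.of_isClosed_subset (isClosed_tsupport _) hts,
    hts.trans hLU, hf1, hf⟩

/-! ### Graph coordinates -/

/-- Orthonormal coordinates adapted to a unit vector `v`: an isometric parametrization of the
hyperplane orthogonal to `v`. -/
theorem exists_frame {n : ℕ} {v : Space (n + 1)} (hv : ‖v‖ = 1) :
    ∃ ι : Space n →ₗᵢ[ℝ] Space (n + 1), (∀ y, inner ℝ v (ι y) = 0) ∧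
      MeasurePreserving (fun p : Space n × ℝ => ι p.1 + p.2 • v) (volume.prod volume) volume ∧
      ∀ x, ∃ p : Space n × ℝ, ι p.1 + p.2 • v = x := by
  obtain ⟨b, hb⟩ := Orthonormal.exists_orthonormalBasis_extension_of_card_eq (𝕜 := ℝ)
    (E := Space (n + 1)) (ι := Fin (n + 1)) (by simp) (v := fun _ => v) (s := {0}) (by
      rw [orthonormal_iff_ite]
      rintro ⟨i, rfl⟩ ⟨j, rfl⟩
      simp [Set.domRestrict, hv])
  have hb0 : b 0 = v := hb 0 rfl
  -- insertion of a zero coordinate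
  let J : Space n →ₗ[ℝ] Space (n + 1) :=
    { toFun := fun y => WithLp.toLp 2 (Fin.cons 0 y.ofLp)
      map_add' := fun x y => by
        ext i; refine Fin.cases ?_ (fun j => ?_) i <;> simp
      map_smul' := fun c y => by
        ext i; refine Fin.cases ?_ (fun j => ?_) i <;> simp }
  have hJ : ∀ y, ‖J y‖ = ‖y‖ := fun y => by
    rw [EuclideanSpace.norm_eq, EuclideanSpace.norm_eq, Fin.sum_univ_succ]
    simp [J]
  let ι : Space n →ₗᵢ[ℝ] Space (n + 1) :=
    { toLinearMap := b.repr.symm.toLinearEquiv.toLinearMap ∘ₗ J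
      norm_map' := fun y => by
        simp only [LinearMap.coe_comp, Function.comp_apply]
        exact (b.repr.symm.norm_map _).trans (hJ y) }
  have hιdef : ∀ y, ι y = b.repr.symm (WithLp.toLp 2 (Fin.cons 0 y.ofLp)) := fun y => rfl
  have hsum : ∀ p : Space n × ℝ,
      ι p.1 + p.2 • v = b.repr.symm (WithLp.toLp 2 (Fin.cons p.2 p.1.ofLp)) := fun p => by
    have h1 : v = b.repr.symm (EuclideanSpace.single 0 1) := by
      rw [b.repr_symm_single, hb0]
    rw [hιdef, h1, ← map_smul, ← map_add]
    congr 1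
    ext i
    refine Fin.cases ?_ (fun j => ?_) i <;> simp
  refine ⟨ι, fun y => ?_, ?_, fun x => ?_⟩
  · rw [← hb0, ← b.repr_apply_apply, hιdef]
    simp
  · have h1 : MeasurePreserving (fun p : Space n × ℝ => (p.2, p.1.ofLp))
        (volume.prod volume) (volume.prod volume) :=
      (((PiLp.volume_preserving_ofLp (Fin n)).prod (MeasurePreserving.id volume))).comp
        (MeasurePreserving.id _) |> fun h => Measure.measurePreserving_swap.comp h
    have h2 := (volume_preserving_piFinSuccAbove (fun _ : Fin (n + 1) => ℝ) 0).symm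
    have h3 := (b.measurePreserving_repr_symm.comp
      (PiLp.volume_preserving_toLp (Fin (n + 1)))).comp (h2.comp h1)
    have e : (fun p : Space n × ℝ => ι p.1 + p.2 • v) =
        ((b.repr.symm ∘ WithLp.toLp 2) ∘
          ((MeasurableEquiv.piFinSuccAbove (fun _ : Fin (n + 1) => ℝ) 0).symm ∘
            fun p : Space n × ℝ => (p.2, p.1.ofLp))) := by
      funext p
      rw [hsum]
      simp [MeasurableEquiv.piFinSuccAbove, Fin.insertNthEquiv]
    rw [e]
    exact h3
  · refine ⟨(WithLp.toLp 2 (Fin.tail (b.repr x).ofLp), b.repr x 0), ?_⟩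
    rw [hsum]
    apply b.repr.injective
    simp

/-- Coordinates `(y, r)` adapted to the region `{0 < m}` below a graph: `y` is the position in the
hyperplane orthogonal to `v`, and `r` is the height below the graph. -/
noncomputable def graphMap {n : ℕ} (m : Space (n + 1) → ℝ) (v : Space (n + 1))
    (ι : Space n →ₗᵢ[ℝ] Space (n + 1)) (p : Space n × ℝ) : Space (n + 1) :=
  ι p.1 + (m (ι p.1) - p.2) • v

section GraphMap

variable {n : ℕ} {m : Space (n + 1) → ℝ} {v : Space (n + 1)} {ε : ℝ≥0}
  {ι : Space n →ₗᵢ[ℝ] Space (n + 1)}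

theorem IsHeight.apply_graphMap (hm : IsHeight m v ε) (p : Space n × ℝ) :
    m (graphMap m v ι p) = p.2 := by
  rw [graphMap, hm.shift]; ring

theorem IsHeight.continuous_graphMap (hm : IsHeight m v ε) :
    Continuous (graphMap m v ι) := by
  have := hm.lipschitz.continuous
  have h2 := ι.continuous
  unfold graphMap
  fun_prop

theorem norm_le_norm_graphMap (hι : ∀ y, inner ℝ v (ι y) = 0) (p : Space n × ℝ) :
    ‖p.1‖ ≤ ‖graphMap m v ι p‖ := by
  have h : ‖graphMap m v ι p‖ ^ 2 = ‖p.1‖ ^ 2 + ‖(m (ι p.1) - p.2) • v‖ ^ 2 := by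
    rw [graphMap, norm_add_sq_real, inner_smul_right, real_inner_comm, hι, ι.norm_map]
    ring
  nlinarith [norm_nonneg (graphMap m v ι p), norm_nonneg p.1,
    sq_nonneg ‖(m (ι p.1) - p.2) • v‖]

theorem IsHeight.measurePreserving_graphMap (hm : IsHeight m v ε)
    (hι : MeasurePreserving (fun p : Space n × ℝ => ι p.1 + p.2 • v)
      (volume.prod volume) volume) :
    MeasurePreserving (graphMap m v ι) (volume.prod volume) volume := by
  have hc := hm.lipschitz.continuous
  have h1 : MeasurePreserving (fun p : Space n × ℝ => (p.1, m (ι p.1) - p.2))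
      (volume.prod volume) (volume.prod volume) := by
    refine (MeasurePreserving.id volume).skew_product (g := fun y r => m (ι y) - r) ?_ ?_
    · have h2 := ι.continuous
      exact Continuous.measurable (by fun_prop)
    · exact Eventually.of_forall fun y => Measure.map_sub_left_eq_self volume _
  exact hι.comp h1

/-- Rescaling the height coordinate rescales the measure. -/
theorem IsHeight.map_graphMap_scaled (hm : IsHeight m v ε)
    (hι : MeasurePreserving (fun p : Space n × ℝ => ι p.1 + p.2 • v)
      (volume.prod volume) volume) {δ : ℝ} (hδ : 0 < δ) :
    Measure.map (fun p : Space n × ℝ => graphMap m v ι (p.1, δ * p.2)) (volume.prod volume) =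
      ENNReal.ofReal δ⁻¹ • volume := by
  have h1 : Measure.map (fun p : Space n × ℝ => (p.1, δ * p.2)) (volume.prod volume) =
      ENNReal.ofReal δ⁻¹ • (volume.prod volume) := by
    have := Measure.map_prod_map (volume : Measure (Space n)) (volume : Measure ℝ)
      measurable_id (measurable_const_mul δ)
    rw [Measure.map_id, Real.map_volume_mul_left hδ.ne', Measure.prod_smul_right,
      abs_of_pos (inv_pos.mpr hδ)] at this
    exact this.symm
  have h2 : (fun p : Space n × ℝ => graphMap m v ι (p.1, δ * p.2)) =
      graphMap m v ι ∘ fun p : Space n × ℝ => (p.1, δ * p.2) := rfl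
  rw [h2, ← Measure.map_map hm.continuous_graphMap.measurable (by fun_prop), h1,
    Measure.map_smul, (hm.measurePreserving_graphMap hι).map_eq]

theorem IsHeight.volume_level (hm : IsHeight m v ε) (c : ℝ) :
    volume {x | m x = c} = 0 := by
  obtain ⟨ι, -, hι, -⟩ := exists_frame hm.norm_eq
  have hmp := hm.measurePreserving_graphMap hι
  have hms : MeasurableSet {x | m x = c} :=
    (isClosed_eq hm.lipschitz.continuous continuous_const).measurableSet
  rw [← hmp.measure_preimage hms.nullMeasurableSet]
  have : graphMap m v ι ⁻¹' {x | m x = c} = (univ : Set (Space n)) ×ˢ ({c} : Set ℝ) := by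
    ext p
    simp [hm.apply_graphMap]
  rw [this, Measure.prod_prod]
  simp

/-- Averages over thin layers below a graph converge to the integral over the graph, with respect
to the Lebesgue measure of the base. -/
theorem IsHeight.tendsto_layer (hm : IsHeight m v ε) (hι0 : ∀ y, inner ℝ v (ι y) = 0)
    (hι : MeasurePreserving (fun p : Space n × ℝ => ι p.1 + p.2 • v)
      (volume.prod volume) volume)
    {h : Space (n + 1) → ℝ} (hc : ContinuousOn h {x | 0 ≤ m x}) {M R : ℝ}
    (hM : ∀ x, 0 ≤ m x → |h x| ≤ M) (hR : ∀ x, R < ‖x‖ → h x = 0) :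
    Tendsto (fun δ : ℝ => δ⁻¹ * ∫ x in {x | δ < m x ∧ m x < 2 * δ}, h x) (𝓝[>] 0)
      (𝓝 (∫ y, h (graphMap m v ι (y, 0)))) := by
  have hmc := hm.lipschitz.continuous
  have hgc := hm.continuous_graphMap (ι := ι)
  have hlay : ∀ δ : ℝ, MeasurableSet {x | δ < m x ∧ m x < 2 * δ} := fun δ =>
    ((isOpen_lt continuous_const hmc).inter (isOpen_lt hmc continuous_const)).measurableSet
  -- the layer integral in rescaled graph coordinates
  have key : ∀ δ : ℝ, 0 < δ → δ⁻¹ * ∫ x in {x | δ < m x ∧ m x < 2 * δ}, h x =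
      ∫ p : Space n × ℝ, (Ioo (1 : ℝ) 2).indicator
        (fun s => h (graphMap m v ι (p.1, δ * s))) p.2 ∂(volume.prod volume) := by
    intro δ hδ
    rw [← integral_indicator (hlay δ)]
    have hmeas : AEStronglyMeasurable ({x | δ < m x ∧ m x < 2 * δ}.indicator h)
        (volume : Measure (Space (n + 1))) := by
      rw [aestronglyMeasurable_indicator_iff (hlay δ)]
      refine (hc.mono ?_).aestronglyMeasurable (hlay δ)
      intro x hx
      exact (hδ.trans hx.1).le
    have h2 := integral_map (μ := (volume : Measure (Space n)).prod (volume : Measure ℝ))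
      (φ := fun p : Space n × ℝ => graphMap m v ι (p.1, δ * p.2))
      (f := {x | δ < m x ∧ m x < 2 * δ}.indicator h)
      (Continuous.measurable (by fun_prop)).aemeasurable
      (by rw [hm.map_graphMap_scaled hι hδ]; exact hmeas.smul_measure _)
    rw [hm.map_graphMap_scaled hι hδ, integral_smul_measure,
      ENNReal.toReal_ofReal (inv_pos.mpr hδ).le, smul_eq_mul] at h2
    rw [h2]
    refine integral_congr_ae (Eventually.of_forall fun p => ?_)
    simp only [indicator, mem_ofPred_eq, hm.apply_graphMap, mem_Ioo]
    have : (δ < δ * p.2 ∧ δ * p.2 < 2 * δ) ↔ (1 < p.2 ∧ p.2 < 2) := by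
      constructor
      · rintro ⟨h1, h2⟩; constructor <;> nlinarith
      · rintro ⟨h1, h2⟩; constructor <;> nlinarith
    simp only [this]
  -- the interval `(1, 2)` has length one
  have hlim : ∫ y, h (graphMap m v ι (y, 0)) = ∫ p : Space n × ℝ, (Ioo (1 : ℝ) 2).indicator
      (fun _ => h (graphMap m v ι (p.1, 0))) p.2 ∂(volume.prod volume) := by
    have e : ∀ p : Space n × ℝ, (Ioo (1 : ℝ) 2).indicator
        (fun _ => h (graphMap m v ι (p.1, 0))) p.2 =
        h (graphMap m v ι (p.1, 0)) * (Ioo (1 : ℝ) 2).indicator (fun _ => (1 : ℝ)) p.2 := by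
      intro p
      by_cases hp : p.2 ∈ Ioo (1 : ℝ) 2 <;> simp [hp]
    simp_rw [e]
    rw [integral_prod_mul (fun y => h (graphMap m v ι (y, 0)))
      (fun s => (Ioo (1 : ℝ) 2).indicator (fun _ => (1 : ℝ)) s),
      integral_indicator measurableSet_Ioo]
    simp
    norm_num
  rw [hlim]
  have hev : (fun δ : ℝ => δ⁻¹ * ∫ x in {x | δ < m x ∧ m x < 2 * δ}, h x) =ᶠ[𝓝[>] 0]
      fun δ => ∫ p : Space n × ℝ, (Ioo (1 : ℝ) 2).indicator
        (fun s => h (graphMap m v ι (p.1, δ * s))) p.2 ∂(volume.prod volume) := by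
    filter_upwards [self_mem_nhdsWithin] with δ hδ using key δ hδ
  refine Tendsto.congr' hev.symm ?_
  have hM0 : 0 ≤ M := by
    have := hM (graphMap m v ι (0, 0)) (by rw [hm.apply_graphMap])
    exact (abs_nonneg _).trans this
  refine tendsto_integral_filter_of_dominated_convergence
    ((closedBall (0 : Space n) R ×ˢ Ioo (1 : ℝ) 2).indicator fun _ => M) ?_ ?_ ?_ ?_
  · filter_upwards [self_mem_nhdsWithin] with δ hδ
    have hδ : 0 < δ := hδ
    have hset : MeasurableSet ((univ : Set (Space n)) ×ˢ Ioo (1 : ℝ) 2) :=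
      MeasurableSet.univ.prod measurableSet_Ioo
    have e : (fun p : Space n × ℝ => (Ioo (1 : ℝ) 2).indicator
        (fun s => h (graphMap m v ι (p.1, δ * s))) p.2) =
        ((univ : Set (Space n)) ×ˢ Ioo (1 : ℝ) 2).indicator
          fun p => h (graphMap m v ι (p.1, δ * p.2)) := by
      funext p
      by_cases hp : p.2 ∈ Ioo (1 : ℝ) 2 <;> simp [indicator, hp, mem_prod]
    rw [e, aestronglyMeasurable_indicator_iff hset]
    refine ContinuousOn.aestronglyMeasurable ?_ hset
    refine hc.comp (Continuous.continuousOn (by fun_prop)) ?_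
    rintro p ⟨-, hp⟩
    simp only [mem_ofPred_eq, hm.apply_graphMap]
    exact mul_nonneg hδ.le (by linarith [hp.1])
  · filter_upwards [self_mem_nhdsWithin] with δ hδ
    have hδ : 0 < δ := hδ
    refine Eventually.of_forall fun p => ?_
    by_cases hp : p.2 ∈ Ioo (1 : ℝ) 2
    · by_cases hp1 : ‖p.1‖ ≤ R
      · have : p ∈ closedBall (0 : Space n) R ×ˢ Ioo (1 : ℝ) 2 :=
          ⟨mem_closedBall_zero_iff.mpr hp1, hp⟩
        rw [indicator_of_mem this, indicator_of_mem hp]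
        refine hM _ ?_
        rw [hm.apply_graphMap]
        exact mul_nonneg hδ.le (by linarith [hp.1])
      · rw [indicator_of_mem hp, hR]
        · rw [norm_zero]
          exact indicator_nonneg (fun _ _ => hM0) _
        · exact (not_le.mp hp1).trans_le
            (norm_le_norm_graphMap (m := m) hι0 (p.1, δ * p.2))
    · rw [indicator_of_notMem hp, norm_zero]
      exact indicator_nonneg (fun _ _ => hM0) _
  · rw [integrable_indicator_iff (measurableSet_closedBall.prod measurableSet_Ioo)]
    refine integrableOn_const ?_
    rw [Measure.prod_prod]
    refine ENNReal.mul_ne_top measure_closedBall_lt_top.ne ?_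
    simp
  · refine Eventually.of_forall fun p => ?_
    by_cases hp : p.2 ∈ Ioo (1 : ℝ) 2
    · simp only [indicator_of_mem hp]
      have h0 : graphMap m v ι (p.1, 0) ∈ {x | 0 ≤ m x} := by
        simp [hm.apply_graphMap]
      refine (hc _ h0).tendsto.comp ?_
      refine tendsto_nhdsWithin_iff.mpr ⟨?_, ?_⟩
      · have hcont : Continuous fun δ : ℝ => graphMap m v ι (p.1, δ * p.2) := by fun_prop
        have := hcont.tendsto 0
        rw [zero_mul] at this
        exact this.mono_left nhdsWithin_le_nhds
      · filter_upwards [self_mem_nhdsWithin] with δ hδ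
        have hδ : 0 < δ := hδ
        rw [hm.apply_graphMap]
        exact mul_nonneg hδ.le (by linarith [hp.1])
    · simp only [indicator_of_notMem hp]
      exact tendsto_const_nhds

end GraphMap

/-! ### Hausdorff measure on a Lipschitz graph -/

section GraphMeasure

variable {n : ℕ} {m : Space (n + 1) → ℝ} {v : Space (n + 1)} {ε : ℝ≥0}
  {ι : Space n →ₗᵢ[ℝ] Space (n + 1)}

/-- The Lebesgue measure of the base of a graph, carried over to the graph. -/
noncomputable def baseMeasure (m : Space (n + 1) → ℝ) (v : Space (n + 1))
    (ι : Space n →ₗᵢ[ℝ] Space (n + 1)) : Measure (Space (n + 1)) :=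
  (volume : Measure (Space n)).map fun y => graphMap m v ι (y, 0)

theorem dist_le_dist_graphMap (hι0 : ∀ y, inner ℝ v (ι y) = 0) (y z : Space n) :
    ‖y - z‖ ≤ ‖graphMap m v ι (y, 0) - graphMap m v ι (z, 0)‖ := by
  have e : graphMap m v ι (y, 0) - graphMap m v ι (z, 0) =
      ι (y - z) + (m (ι y) - m (ι z)) • v := by
    simp only [graphMap, sub_zero, map_sub, sub_smul]; abel
  have h : ‖graphMap m v ι (y, 0) - graphMap m v ι (z, 0)‖ ^ 2 =
      ‖y - z‖ ^ 2 + ‖(m (ι y) - m (ι z)) • v‖ ^ 2 := by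
    rw [e, norm_add_sq_real, inner_smul_right, real_inner_comm, hι0, ι.norm_map]
    ring
  nlinarith [norm_nonneg (graphMap m v ι (y, 0) - graphMap m v ι (z, 0)), norm_nonneg (y - z),
    sq_nonneg ‖(m (ι y) - m (ι z)) • v‖]

theorem IsHeight.lipschitz_graphMap (hm : IsHeight m v ε) (hι0 : ∀ y, inner ℝ v (ι y) = 0) :
    LipschitzWith (1 + ε) fun y => graphMap m v ι (y, 0) := by
  refine LipschitzWith.of_dist_le_mul fun y z => ?_
  rw [dist_eq_norm, dist_eq_norm]
  have e : graphMap m v ι (y, 0) - graphMap m v ι (z, 0) =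
      ι (y - z) + (m (ι y) - m (ι z)) • v := by
    simp only [graphMap, sub_zero, map_sub, sub_smul]; abel
  have h := hm.tilt (ι z) (ι (y - z)) (hι0 _)
  rw [← map_add, add_sub_cancel, ι.norm_map] at h
  rw [e]
  refine (norm_add_le _ _).trans ?_
  rw [ι.norm_map, norm_smul, hm.norm_eq, mul_one, Real.norm_eq_abs]
  push_cast
  linarith

theorem IsHeight.continuous_graph (hm : IsHeight m v ε) :
    Continuous fun y => graphMap m v ι (y, 0) := by
  have := hm.continuous_graphMap (ι := ι)
  fun_prop

theorem IsHeight.range_graph (hm : IsHeight m v ε)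
    (hsurj : ∀ x, ∃ p : Space n × ℝ, ι p.1 + p.2 • v = x) {x : Space (n + 1)} (hx : m x = 0) :
    ∃ y, graphMap m v ι (y, 0) = x := by
  obtain ⟨⟨y, r⟩, hp⟩ := hsurj x
  refine ⟨y, ?_⟩
  have h := hm.shift (ι y) r
  simp only at hp
  rw [hp, hx] at h
  rw [← hp, graphMap]
  congr 2
  simp only
  linarith

/-- Up to a factor close to `1`, the surface measure of a graph of small slope is the Lebesgue
measure of the base: the parametrization of the graph over the base is Lipschitz with constant
`1 + ε`, and its inverse is a contraction. -/
theorem IsHeight.baseMeasure_le (hm : IsHeight m v ε) (hι0 : ∀ y, inner ℝ v (ι y) = 0) :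
    baseMeasure m v ι ≤ (μHE[n] : Measure (Space (n + 1))).restrict {x | m x = 0} ∧
      ((∀ x, ∃ p : Space n × ℝ, ι p.1 + p.2 • v = x) →
      (μHE[n] : Measure (Space (n + 1))).restrict {x | m x = 0} ≤
        ((1 + ε) ^ n : ℝ≥0) • baseMeasure m v ι) := by
  have hmeas : Measurable fun y => graphMap m v ι (y, 0) := (hm.continuous_graph (ι := ι)).measurable
  have hanti : AntilipschitzWith 1 fun y => graphMap m v ι (y, 0) := by
    refine AntilipschitzWith.of_le_mul_dist fun y z => ?_
    rw [dist_eq_norm, dist_eq_norm]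
    simpa using dist_le_dist_graphMap (m := m) hι0 y z
  have hvol := EuclideanSpace.euclideanHausdorffMeasure_eq_volume n
  have hS : MeasurableSet {x | m x = 0} :=
    (isClosed_eq hm.lipschitz.continuous continuous_const).measurableSet
  constructor
  · refine Measure.le_intro fun s hs _ => ?_
    rw [baseMeasure, Measure.map_apply hmeas hs, ← hvol, Measure.restrict_apply hs]
    have h1 : (fun y => graphMap m v ι (y, 0)) ⁻¹' s =
        (fun y => graphMap m v ι (y, 0)) ⁻¹' (s ∩ {x | m x = 0}) := by
      ext y
      simp [hm.apply_graphMap]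
    rw [h1, Measure.euclideanHausdorffMeasure_def, Measure.euclideanHausdorffMeasure_def,
      Measure.smul_apply, Measure.smul_apply]
    have h2 := hanti.hausdorffMeasure_preimage_le (d := (n : ℝ)) (by positivity)
      (s ∩ {x | m x = 0})
    simp only [ENNReal.coe_one, ENNReal.one_rpow, one_mul] at h2
    gcongr
  · intro hsurj
    refine Measure.le_intro fun s hs _ => ?_
    rw [Measure.smul_apply, baseMeasure, Measure.map_apply hmeas hs, ← hvol,
      Measure.restrict_apply hs]
    have h1 : s ∩ {x | m x = 0} = (fun y => graphMap m v ι (y, 0)) ''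
        ((fun y => graphMap m v ι (y, 0)) ⁻¹' s) := by
      ext x
      constructor
      · rintro ⟨hx, hx0⟩
        obtain ⟨y, hy⟩ := hm.range_graph hsurj hx0
        exact ⟨y, by simpa [hy] using hx, hy⟩
      · rintro ⟨y, hy, rfl⟩
        exact ⟨hy, by simp [hm.apply_graphMap]⟩
    rw [h1, Measure.euclideanHausdorffMeasure_def, Measure.euclideanHausdorffMeasure_def,
      Measure.smul_apply, Measure.smul_apply, smul_comm]
    have h2 := (hm.lipschitz_graphMap hι0).hausdorffMeasure_image_le (d := (n : ℝ))
      (by positivity) ((fun y => graphMap m v ι (y, 0)) ⁻¹' s)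
    rw [ENNReal.rpow_natCast] at h2
    gcongr
    refine h2.trans (le_of_eq ?_)
    rw [ENNReal.smul_def, smul_eq_mul]
    push_cast
    rfl

theorem IsHeight.baseMeasure_lt_top (hm : IsHeight m v ε) (hι0 : ∀ y, inner ℝ v (ι y) = 0)
    {s : Set (Space (n + 1))} (hs : Bornology.IsBounded s) : baseMeasure m v ι s < ⊤ := by
  obtain ⟨R, hR⟩ := hs.subset_closedBall 0
  refine (measure_mono hR).trans_lt ?_
  rw [baseMeasure, Measure.map_apply (hm.continuous_graph (ι := ι)).measurable
    isClosed_closedBall.measurableSet]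
  refine (measure_mono (t := closedBall (0 : Space n) R) ?_).trans_lt measure_closedBall_lt_top
  intro y hy
  rw [mem_preimage, mem_closedBall_zero_iff] at hy
  exact mem_closedBall_zero_iff.mpr
    ((norm_le_norm_graphMap (m := m) hι0 (y, 0)).trans hy)

end GraphMeasure

theorem abs_integral_sub_integral_le {α : Type*} [MeasurableSpace α] {μ ν : Measure α} {c : ℝ≥0}
    (hμν : μ ≤ ν) (hνμ : ν ≤ c • μ) {h : α → ℝ} (hi : Integrable h ν) :
    |∫ x, h x ∂ν - ∫ x, h x ∂μ| ≤ (c - 1) * ∫ x, |h x| ∂μ := by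
  have hiμ : Integrable h μ := hi.mono_measure hμν
  have key : ∀ g : α → ℝ, Integrable g ν → (∀ x, 0 ≤ g x) →
      0 ≤ ∫ x, g x ∂ν - ∫ x, g x ∂μ ∧ ∫ x, g x ∂ν - ∫ x, g x ∂μ ≤ (c - 1) * ∫ x, g x ∂μ := by
    intro g hg h0
    have h1 := integral_mono_measure hμν (Eventually.of_forall h0) hg
    have h2 := integral_mono_measure hνμ (Eventually.of_forall h0)
      ((hg.mono_measure hμν).smul_measure_nnreal)
    rw [integral_smul_nnreal_measure, NNReal.smul_def, smul_eq_mul] at h2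
    constructor <;> linarith
  have hp := key (fun x => max (h x) 0) hi.pos_part fun x => le_max_right _ _
  have hn := key (fun x => max (-h x) 0) hi.neg_part fun x => le_max_right _ _
  have e : ∀ ξ : Measure α, Integrable h ξ → ∫ x, h x ∂ξ =
      ∫ x, max (h x) 0 ∂ξ - ∫ x, max (-h x) 0 ∂ξ := fun ξ hξ => by
    rw [← integral_sub hξ.pos_part hξ.neg_part]
    refine integral_congr_ae (Eventually.of_forall fun x => ?_)
    simp only
    rcases le_total (h x) 0 with h1 | h1
    · rw [max_eq_right h1, max_eq_left (by linarith)]; ring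
    · rw [max_eq_left h1, max_eq_right (by linarith)]; ring
  have e' : ∫ x, |h x| ∂μ = ∫ x, max (h x) 0 ∂μ + ∫ x, max (-h x) 0 ∂μ := by
    rw [← integral_add hiμ.pos_part hiμ.neg_part]
    refine integral_congr_ae (Eventually.of_forall fun x => ?_)
    simp only
    rcases le_total (h x) 0 with h1 | h1
    · rw [max_eq_right h1, max_eq_left (by linarith), abs_of_nonpos h1]; ring
    · rw [max_eq_left h1, max_eq_right (by linarith), abs_of_nonneg h1]; ring
  rw [e ν hi, e μ hiμ, e', abs_le]
  constructor <;> linarith [hp.1, hp.2, hn.1, hn.2]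

/-! ### The divergence theorem near a graph -/

/-- The divergence of a vector field. -/
noncomputable def divergence {d : ℕ} (F : Space d → Space d) (x : Space d) : ℝ :=
  ∑ i, pderiv i (fun y => F y i) x

/-- A cutoff function below a graph: it vanishes on `{m ≤ δ}`, equals `1` on `{2 δ ≤ m}`, and is
affine in the height in the layer between. -/
noncomputable def layerCutoff {d : ℕ} (m : Space d → ℝ) (δ : ℝ) (x : Space d) : ℝ :=
  max 0 (min 1 (δ⁻¹ * m x - 1))

section LayerCutoff

variable {d : ℕ} {m : Space d → ℝ} {v : Space d} {ε : ℝ≥0} {δ : ℝ}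

theorem layerCutoff_mem_Icc (x : Space d) : layerCutoff m δ x ∈ Icc (0 : ℝ) 1 :=
  ⟨le_max_left _ _, max_le zero_le_one (min_le_left _ _)⟩

theorem layerCutoff_eq_zero (hδ : 0 < δ) {x : Space d} (hx : m x ≤ δ) : layerCutoff m δ x = 0 := by
  have : δ⁻¹ * m x - 1 ≤ 0 := by
    rw [sub_nonpos, inv_mul_le_iff₀ hδ]; linarith
  rw [layerCutoff, max_eq_left ((min_le_right _ _).trans this)]

theorem layerCutoff_eq_one (hδ : 0 < δ) {x : Space d} (hx : 2 * δ ≤ m x) :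
    layerCutoff m δ x = 1 := by
  have : 1 ≤ δ⁻¹ * m x - 1 := by
    rw [le_sub_iff_add_le, le_inv_mul_iff₀ hδ]; linarith
  rw [layerCutoff, min_eq_left this, max_eq_right zero_le_one]

theorem layerCutoff_eq (hδ : 0 < δ) {x : Space d} (h1 : δ ≤ m x) (h2 : m x ≤ 2 * δ) :
    layerCutoff m δ x = δ⁻¹ * m x - 1 := by
  have h3 : δ⁻¹ * m x - 1 ≤ 1 := by
    rw [sub_le_iff_le_add, inv_mul_le_iff₀ hδ]; linarith
  have h4 : 0 ≤ δ⁻¹ * m x - 1 := by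
    rw [sub_nonneg, le_inv_mul_iff₀ hδ]; linarith
  rw [layerCutoff, min_eq_right h3, max_eq_right h4]

theorem IsHeight.lipschitz_layerCutoff (hm : IsHeight m v ε) (δ : ℝ) :
    ∃ C, LipschitzWith C (layerCutoff m δ) := by
  have h1 : LipschitzWith (‖δ⁻¹‖₊ * (1 + ε)) fun x => δ⁻¹ * m x :=
    (lipschitzWith_smul (β := ℝ) δ⁻¹).comp hm.lipschitz
  have h2 : LipschitzWith (‖δ⁻¹‖₊ * (1 + ε) + 0) fun x => δ⁻¹ * m x - 1 :=
    h1.sub (LipschitzWith.const 1)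
  exact ⟨_, (h2.const_min 1).const_max 0⟩

/-- The gradient of the layer cutoff is `-δ⁻¹ v` in the layer `{δ < m < 2 δ}`, up to a relative error
`ε`, and it vanishes elsewhere. -/
theorem IsHeight.fderiv_layerCutoff (hm : IsHeight m v ε) (hδ : 0 < δ) {x : Space d}
    (hx : DifferentiableAt ℝ (layerCutoff m δ) x) (h1 : m x ≠ δ) (h2 : m x ≠ 2 * δ) (z : Space d) :
    |fderiv ℝ (layerCutoff m δ) x z +
        δ⁻¹ * {x | δ < m x ∧ m x < 2 * δ}.indicator (fun _ => (inner ℝ v z : ℝ)) x| ≤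
      ε * (δ⁻¹ * {x | δ < m x ∧ m x < 2 * δ}.indicator (fun _ => ‖z‖) x) := by
  have hmc := hm.lipschitz.continuous
  by_cases hin : δ < m x ∧ m x < 2 * δ
  · rw [indicator_of_mem (by exact hin), indicator_of_mem (by exact hin)]
    have hd : HasFDerivAt (fun y => layerCutoff m δ y + δ⁻¹ * inner ℝ v y)
        (fderiv ℝ (layerCutoff m δ) x + δ⁻¹ • innerSL ℝ v) x :=
      hx.hasFDerivAt.add (((innerSL ℝ v).hasFDerivAt).const_mul δ⁻¹)
    have hle := hd.le_of_lip' (C := δ⁻¹ * ε) (by positivity) (by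
      have ho : IsOpen {y | δ < m y ∧ m y < 2 * δ} :=
        (isOpen_lt continuous_const hmc).inter (isOpen_lt hmc continuous_const)
      filter_upwards [ho.mem_nhds hin] with y hy
      rw [layerCutoff_eq hδ hy.1.le hy.2.le, layerCutoff_eq hδ hin.1.le hin.2.le, Real.norm_eq_abs]
      have e : δ⁻¹ * m y - 1 + δ⁻¹ * inner ℝ v y - (δ⁻¹ * m x - 1 + δ⁻¹ * inner ℝ v x) =
          δ⁻¹ * (m y - m x + inner ℝ v (y - x)) := by rw [inner_sub_right]; ring
      rw [e, abs_mul, abs_of_pos (inv_pos.mpr hδ), mul_assoc]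
      gcongr
      exact hm.abs_sub_add_inner_le x y)
    have := ContinuousLinearMap.le_of_opNorm_le _ hle z
    rw [add_apply, smul_apply, innerSL_apply_apply,
      smul_eq_mul, Real.norm_eq_abs] at this
    calc _ ≤ _ := this
      _ = _ := by ring
  · rw [indicator_of_notMem (by exact hin), indicator_of_notMem (by exact hin)]
    have hz : fderiv ℝ (layerCutoff m δ) x = 0 := by
      by_cases hlt : m x < δ
      · have : layerCutoff m δ =ᶠ[𝓝 x] fun _ => 0 := by
          filter_upwards [(isOpen_lt hmc continuous_const).mem_nhds hlt] with y hy
          exact layerCutoff_eq_zero hδ (le_of_lt hy)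
        rw [this.fderiv_eq, fderiv_const_apply]
      · have hgt : 2 * δ < m x := by
          have h3 : δ < m x := lt_of_le_of_ne (not_lt.mp hlt) (Ne.symm h1)
          by_contra h4
          exact hin ⟨h3, lt_of_le_of_ne (not_lt.mp h4) h2⟩
        have : layerCutoff m δ =ᶠ[𝓝 x] fun _ => 1 := by
          filter_upwards [(isOpen_lt continuous_const hmc).mem_nhds hgt] with y hy
          exact layerCutoff_eq_one hδ (le_of_lt hy)
        rw [this.fderiv_eq, fderiv_const_apply]
    simp [hz]

end LayerCutoff

theorem eq_sum_single {d : ℕ} (z : Space d) : z = ∑ i, z i • EuclideanSpace.single i (1 : ℝ) := by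
  have := (EuclideanSpace.basisFun (Fin d) ℝ).sum_repr z
  simpa using this.symm

/-- Integration by parts against a Lipschitz function `k`. As the field `F` is regular in `D` only,
it is first cut off away from the supports of `k` and `F`. -/
theorem integral_fderiv_apply_eq {d : ℕ} {D : Set (Space d)} {F : Space d → Space d}
    {k : Space d → ℝ} {C : ℝ≥0} (hD : IsOpen D) (hF : ContDiffOn ℝ 1 F D)
    (hFc : HasCompactSupport F) (hk : LipschitzWith C k) (hsub : tsupport k ∩ tsupport F ⊆ D) :
    Integrable (fun x => fderiv ℝ k x (F x)) ∧
      ∫ x, fderiv ℝ k x (F x) = -∫ x, k x * divergence F x := by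
  have hKc : IsCompact (tsupport k ∩ tsupport F) :=
    hFc.isCompact.inter_left (isClosed_tsupport k)
  obtain ⟨κ, hκ, hκc, hκD, hκ1, -⟩ := exists_cutoff hKc hD hsub
  have hFi : ∀ i, ContDiffOn ℝ 1 (fun x => F x i) D := fun i =>
    (contDiffOn_euclidean.mp hF) i
  set G : Fin d → Space d → ℝ := fun i x => κ x * F x i with hG
  have hGc : ∀ i, HasCompactSupport (G i) := fun i => hκc.mul_right
  have hGd : ∀ i, ContDiff ℝ 1 (G i) := fun i => by
    rw [contDiff_iff_contDiffAt]
    intro x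
    by_cases hx : x ∈ D
    · exact ((hκ.of_le (by exact_mod_cast le_top)).contDiffAt).mul
        ((hFi i).contDiffAt (hD.mem_nhds hx))
    · have : G i =ᶠ[𝓝 x] fun _ => 0 := by
        filter_upwards [(isClosed_tsupport κ).isOpen_compl.mem_nhds (fun h => hx (hκD h))] with y hy
        simp [hG, image_eq_zero_of_notMem_tsupport hy]
      exact contDiffAt_const.congr_of_eventuallyEq this
  have hGF : ∀ x ∈ tsupport k, ∀ i, G i =ᶠ[𝓝 x] fun y => F y i := fun x hx i => by
    by_cases hxF : x ∈ tsupport F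
    · have : ∀ᶠ y in 𝓝 x, κ y = 1 := hκ1.filter_mono (nhds_le_nhdsSet (mem_inter hx hxF))
      filter_upwards [this] with y hy
      simp [hG, hy]
    · filter_upwards [(isClosed_tsupport F).isOpen_compl.mem_nhds hxF] with y hy
      simp [hG, image_eq_zero_of_notMem_tsupport hy]
  have hint1 : ∀ i, Integrable fun x => lineDeriv ℝ k x (EuclideanSpace.single i 1) * G i x :=
    fun i => (((hGd i).continuous.integrable_of_hasCompactSupport (hGc i)).bdd_mul
      (hk.memLp_lineDeriv _).1 (c := C * ‖(EuclideanSpace.single i (1 : ℝ) : Space d)‖)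
      (Eventually.of_forall fun x => norm_lineDeriv_le_of_lipschitz ℝ hk))
  have hae : ∀ᵐ x, fderiv ℝ k x (F x) =
      ∑ i, lineDeriv ℝ k x (EuclideanSpace.single i 1) * G i x := by
    filter_upwards [hk.ae_differentiableAt (μ := volume)] with x hx
    by_cases hxk : x ∈ tsupport k
    · conv_lhs => rw [eq_sum_single (F x)]
      rw [map_sum]
      refine Finset.sum_congr rfl fun i _ => ?_
      rw [map_smul, hx.lineDeriv_eq_fderiv, (hGF x hxk i).self_of_nhds, smul_eq_mul, mul_comm]
    · rw [fderiv_of_notMem_tsupport ℝ hxk]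
      simp [hx.lineDeriv_eq_fderiv, fderiv_of_notMem_tsupport ℝ hxk]
  refine ⟨(integrable_finsetSum _ fun i _ => hint1 i).congr (hae.mono fun x hx => hx.symm), ?_⟩
  have hpt : ∀ x, ∑ i, lineDeriv ℝ (G i) x (-EuclideanSpace.single i 1) * k x =
      -(k x * divergence F x) := fun x => by
    by_cases hxk : x ∈ tsupport k
    · rw [divergence, Finset.mul_sum, ← Finset.sum_neg_distrib]
      refine Finset.sum_congr rfl fun i _ => ?_
      rw [((hGd i).differentiable (by simp)).differentiableAt.lineDeriv_eq_fderiv,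
        (hGF x hxk i).fderiv_eq, map_neg, pderiv]
      ring
    · simp [image_eq_zero_of_notMem_tsupport hxk]
  have hint2 : ∀ i, Integrable
      fun x => lineDeriv ℝ (G i) x (-EuclideanSpace.single i 1) * k x := fun i => by
    have e : (fun x => lineDeriv ℝ (G i) x (-EuclideanSpace.single i 1) * k x) =
        fun x => fderiv ℝ (G i) x (-EuclideanSpace.single i 1) * k x := by
      funext x
      rw [((hGd i).differentiable (by simp)).differentiableAt.lineDeriv_eq_fderiv]
    rw [e]
    have hc : Continuous fun x => fderiv ℝ (G i) x (-EuclideanSpace.single i 1) :=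
      ((hGd i).continuous_fderiv (by simp)).clm_apply continuous_const
    refine (hc.mul hk.continuous).integrable_of_hasCompactSupport ?_
    refine HasCompactSupport.mul_right ?_
    exact (hGc i).fderiv_apply (𝕜 := ℝ) _
  rw [integral_congr_ae hae, integral_finsetSum _ fun i _ => hint1 i, ← integral_neg]
  simp_rw [← hpt]
  rw [integral_finsetSum _ fun i _ => hint2 i]
  exact Finset.sum_congr rfl fun i _ =>
    hk.integral_lineDeriv_mul_eq (((hGd i).lipschitzWith_of_hasCompactSupport (hGc i)
      (by simp)).choose_spec) (hGc i) _

theorem divergence_eq_zero_of_notMem_tsupport {d : ℕ} {F : Space d → Space d} {x : Space d}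
    (hx : x ∉ tsupport F) : divergence F x = 0 := by
  refine Finset.sum_eq_zero fun i _ => ?_
  have : (fun y => F y i) =ᶠ[𝓝 x] fun _ => 0 := by
    filter_upwards [(isClosed_tsupport F).isOpen_compl.mem_nhds hx] with y hy
    simp [image_eq_zero_of_notMem_tsupport hy]
  rw [pderiv, this.fderiv_eq, fderiv_const_apply]
  rfl

section NearGraph

variable {n : ℕ} {m : Space (n + 1) → ℝ} {v : Space (n + 1)} {ε : ℝ≥0}
  {ι : Space n →ₗᵢ[ℝ] Space (n + 1)} {D U : Set (Space (n + 1))}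
  {F : Space (n + 1) → Space (n + 1)}

theorem IsHeight.continuousOn_field (hm : IsHeight m v ε) (hU : IsOpen U)
    (hDU : ∀ x ∈ U, x ∈ D ↔ 0 < m x) (hFU : tsupport F ⊆ U)
    (hFcont : ContinuousOn F (closure D)) : ContinuousOn F {x | 0 ≤ m x} := by
  intro x hx
  by_cases hxU : x ∈ U
  · have hxD : x ∈ closure D := (hm.mem_closure_iff hU hDU hxU).mpr hx
    refine (hFcont x hxD).mono_of_mem_nhdsWithin ?_
    filter_upwards [self_mem_nhdsWithin, mem_nhdsWithin_of_mem_nhds (hU.mem_nhds hxU)] with y h1 h2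
    exact (hm.mem_closure_iff hU hDU h2).mpr h1
  · have : F =ᶠ[𝓝 x] fun _ => 0 := by
      filter_upwards [(isClosed_tsupport F).isOpen_compl.mem_nhds fun h => hxU (hFU h)] with y hy
      exact image_eq_zero_of_notMem_tsupport hy
    exact (continuousAt_const.congr this.symm).continuousWithinAt

/-- The divergence theorem below a graph of slope at most `ε`, up to an error of order `ε`, for
fields which are only continuous up to the boundary: integrate by parts against the layer cutoff,
and let the thickness of the layer tend to zero. -/
theorem IsHeight.abs_integral_divergence_sub_le (hm : IsHeight m v ε)
    (hι0 : ∀ y, inner ℝ v (ι y) = 0)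
    (hι : MeasurePreserving (fun p : Space n × ℝ => ι p.1 + p.2 • v)
      (volume.prod volume) volume)
    (hD : IsOpen D) (hU : IsOpen U) (hDU : ∀ x ∈ U, x ∈ D ↔ 0 < m x)
    (hFc : HasCompactSupport F) (hFU : tsupport F ⊆ U)
    (hFcont : ContinuousOn F (closure D)) (hFd : ContDiffOn ℝ 1 F D)
    (hdiv : IntegrableOn (divergence F) D) :
    |(∫ x in D, divergence F x) - ∫ x, inner ℝ v (F x) ∂(baseMeasure m v ι)| ≤
      ε * ∫ x, ‖F x‖ ∂(baseMeasure m v ι) := by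
  have hmc := hm.lipschitz.continuous
  have hFm : ContinuousOn F {x | 0 ≤ m x} := hm.continuousOn_field hU hDU hFU hFcont
  obtain ⟨R, hR⟩ := hFc.isCompact.isBounded.subset_closedBall 0
  have hF0 : ∀ x, R < ‖x‖ → F x = 0 := fun x hx => by
    refine image_eq_zero_of_notMem_tsupport fun h => ?_
    have := mem_closedBall_zero_iff.mp (hR h)
    linarith
  obtain ⟨M, hM⟩ : ∃ M, ∀ x, 0 ≤ m x → ‖F x‖ ≤ M := by
    have hK : IsCompact ({x | 0 ≤ m x} ∩ tsupport F) :=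
      hFc.isCompact.inter_left (isClosed_le continuous_const hmc)
    obtain ⟨M, hM⟩ := hK.exists_bound_of_continuousOn (hFm.mono inter_subset_left)
    refine ⟨max M 0, fun x hx => ?_⟩
    by_cases h : x ∈ tsupport F
    · exact (hM x ⟨hx, h⟩).trans (le_max_left _ _)
    · rw [image_eq_zero_of_notMem_tsupport h, norm_zero]; exact le_max_right _ _
  -- the Lebesgue integrals over the base
  have hbase : ∀ h : Space (n + 1) → ℝ, ContinuousOn h {x | 0 ≤ m x} →
      ∫ x, h x ∂(baseMeasure m v ι) = ∫ y, h (graphMap m v ι (y, 0)) := by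
    intro h hh
    have hg := hm.continuous_graph (ι := ι)
    rw [baseMeasure, integral_map hg.measurable.aemeasurable]
    have hae : ∀ᵐ x ∂(Measure.map (fun y => graphMap m v ι (y, 0)) volume), x ∈ {x | 0 ≤ m x} := by
      have hms : MeasurableSet {x | 0 ≤ m x} := (isClosed_le continuous_const hmc).measurableSet
      exact (ae_map_iff hg.measurable.aemeasurable hms).mpr
        (Eventually.of_forall fun y => by simp [hm.apply_graphMap])
    rw [← Measure.restrict_eq_self_of_ae_mem hae]
    exact hh.aestronglyMeasurable (isClosed_le continuous_const hmc).measurableSet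
  have hcv : ContinuousOn (fun x => (inner ℝ v (F x) : ℝ)) {x | 0 ≤ m x} :=
    continuousOn_const.inner hFm
  have hcn : ContinuousOn (fun x => ‖F x‖) {x | 0 ≤ m x} := hFm.norm
  rw [hbase _ hcv, hbase _ hcn]
  have hB := hm.tendsto_layer hι0 hι hcv (M := M) (R := R) (fun x hx => by
      refine (abs_real_inner_le_norm _ _).trans ?_
      rw [hm.norm_eq, one_mul]
      exact hM x hx) (fun x hx => by simp [hF0 x hx])
  have hC := hm.tendsto_layer hι0 hι hcn (M := M) (R := R)
    (fun x hx => by rw [abs_norm]; exact hM x hx) (fun x hx => by simp [hF0 x hx])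
  -- as the layer gets thinner, the cutoff function tends to `1` in `D`
  have hA : Tendsto (fun δ : ℝ => ∫ x in D, layerCutoff m δ x * divergence F x) (𝓝[>] 0)
      (𝓝 (∫ x in D, divergence F x)) := by
    refine tendsto_integral_filter_of_dominated_convergence (fun x => ‖divergence F x‖) ?_ ?_
      hdiv.norm ?_
    · refine Eventually.of_forall fun δ => ?_
      obtain ⟨C, hC⟩ := hm.lipschitz_layerCutoff δ
      exact hC.continuous.aestronglyMeasurable.mul hdiv.aestronglyMeasurable
    · refine Eventually.of_forall fun δ => Eventually.of_forall fun x => ?_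
      have := layerCutoff_mem_Icc (m := m) (δ := δ) x
      rw [norm_mul, Real.norm_of_nonneg this.1]
      exact mul_le_of_le_one_left (norm_nonneg _) this.2
    · refine (ae_restrict_iff' hD.measurableSet).mpr (Eventually.of_forall fun x hx => ?_)
      refine tendsto_const_nhds.congr' ?_
      by_cases hxF : x ∈ tsupport F
      · have hmx : 0 < m x := (hDU x (hFU hxF)).mp hx
        filter_upwards [self_mem_nhdsWithin,
          mem_nhdsWithin_of_mem_nhds (Iio_mem_nhds (half_pos hmx))] with δ h1 h2
        have h1 : 0 < δ := h1
        have h2 : δ < m x / 2 := h2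
        rw [layerCutoff_eq_one h1 (by linarith), one_mul]
      · simp [divergence_eq_zero_of_notMem_tsupport hxF]
  refine le_of_tendsto_of_tendsto (hA.sub hB).abs (hC.const_mul (ε : ℝ)) ?_
  filter_upwards [self_mem_nhdsWithin] with δ hδ
  have hδ : 0 < δ := hδ
  obtain ⟨C, hkC⟩ := hm.lipschitz_layerCutoff δ
  have hts : tsupport (layerCutoff m δ) ⊆ {x | δ ≤ m x} := by
    refine closure_minimal (fun x hx => ?_) (isClosed_le continuous_const hmc)
    by_contra h
    exact hx (layerCutoff_eq_zero hδ (not_le.mp h).le)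
  have hsub : tsupport (layerCutoff m δ) ∩ tsupport F ⊆ D := fun x hx =>
    (hDU x (hFU hx.2)).mpr (hδ.trans_le (hts hx.1))
  obtain ⟨hint, hibp⟩ := integral_fderiv_apply_eq hD hFd hFc hkC hsub
  have hset : ∫ x in D, layerCutoff m δ x * divergence F x =
      ∫ x, layerCutoff m δ x * divergence F x := by
    refine setIntegral_eq_integral_of_forall_compl_eq_zero fun x hx => ?_
    by_cases h1 : x ∈ tsupport (layerCutoff m δ)
    · by_cases h2 : x ∈ tsupport F
      · exact absurd (hsub ⟨h1, h2⟩) hx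
      · rw [divergence_eq_zero_of_notMem_tsupport h2, mul_zero]
    · rw [image_eq_zero_of_notMem_tsupport h1, zero_mul]
  set S : Set (Space (n + 1)) := {x | δ < m x ∧ m x < 2 * δ} with hS
  have hSm : MeasurableSet S :=
    ((isOpen_lt continuous_const hmc).inter (isOpen_lt hmc continuous_const)).measurableSet
  have hS0 : S ⊆ {x | 0 ≤ m x} := fun x hx => (hδ.trans hx.1).le
  have hSint : ∀ h : Space (n + 1) → ℝ, ContinuousOn h {x | 0 ≤ m x} →
      (∀ x, 0 ≤ m x → |h x| ≤ M) → (∀ x, R < ‖x‖ → h x = 0) → IntegrableOn h S := by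
    intro h hh hhM hhR
    have h1 : IntegrableOn h (S ∩ closedBall 0 R) := by
      refine IntegrableOn.of_bound ?_ ?_ M ?_
      · exact (measure_mono inter_subset_right).trans_lt measure_closedBall_lt_top
      · exact (hh.mono (inter_subset_left.trans hS0)).aestronglyMeasurable
          (hSm.inter measurableSet_closedBall)
      · refine (ae_restrict_iff' (hSm.inter measurableSet_closedBall)).mpr
          (Eventually.of_forall fun x hx => hhM x (hS0 hx.1))
    refine h1.of_forall_sdiff_eq_zero hSm fun x hx => hhR x ?_
    by_contra h2
    exact hx.2 ⟨hx.1, mem_closedBall_zero_iff.mpr (not_lt.mp h2)⟩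
  have hi1 := hSint _ hcv (fun x hx => by
      refine (abs_real_inner_le_norm _ _).trans ?_
      rw [hm.norm_eq, one_mul]
      exact hM x hx) (fun x hx => by simp [hF0 x hx])
  have hi2 := hSint _ hcn (fun x hx => by rw [abs_norm]; exact hM x hx)
    (fun x hx => by simp [hF0 x hx])
  rw [hset, ← neg_eq_iff_eq_neg.mpr hibp, ← integral_indicator hSm, ← integral_indicator hSm]
  have hi1' := (integrable_indicator_iff hSm).mpr hi1
  have hi2' := (integrable_indicator_iff hSm).mpr hi2
  have e : -(∫ x, fderiv ℝ (layerCutoff m δ) x (F x)) -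
      δ⁻¹ * ∫ x, S.indicator (fun x => (inner ℝ v (F x) : ℝ)) x =
      -∫ x, (fderiv ℝ (layerCutoff m δ) x (F x) +
        δ⁻¹ * S.indicator (fun x => (inner ℝ v (F x) : ℝ)) x) := by
    rw [integral_add hint (hi1'.const_mul _), integral_const_mul]
    ring
  rw [e, abs_neg, ← integral_const_mul, ← integral_const_mul]
  refine (abs_integral_le_integral_abs).trans ?_
  refine integral_mono_ae (hint.add (hi1'.const_mul _)).abs ((hi2'.const_mul _).const_mul _) ?_
  -- the level sets where the cutoff function has a corner are null sets
  have hn1 : ∀ᵐ x, m x ≠ δ := by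
    rw [ae_iff]; simpa using hm.volume_level δ
  have hn2 : ∀ᵐ x, m x ≠ 2 * δ := by
    rw [ae_iff]; simpa using hm.volume_level (2 * δ)
  filter_upwards [hkC.ae_differentiableAt (μ := volume), hn1, hn2] with x hx h1 h2
  have := hm.fderiv_layerCutoff hδ hx h1 h2 (F x)
  simpa only [indicator] using this

end NearGraph

/-! ### The divergence theorem -/

theorem integrableOn_of_hasCompactSupport {d : ℕ} {μ : Measure (Space d)} {C : Set (Space d)}
    {h : Space d → ℝ} (hC : IsClosed C) (hh : ContinuousOn h C) (hc : HasCompactSupport h)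
    (hμ : μ (C ∩ tsupport h) < ⊤) : IntegrableOn h C μ := by
  have hK : IsCompact (C ∩ tsupport h) := hc.isCompact.inter_left hC
  obtain ⟨M, hM⟩ := hK.exists_bound_of_continuousOn (hh.mono inter_subset_left)
  have h1 : IntegrableOn h (C ∩ tsupport h) μ :=
    IntegrableOn.of_bound hμ ((hh.mono inter_subset_left).aestronglyMeasurable hK.measurableSet) M
      ((ae_restrict_iff' hK.measurableSet).mpr (Eventually.of_forall hM))
  refine h1.of_forall_sdiff_eq_zero hC.measurableSet fun x hx => ?_
  exact image_eq_zero_of_notMem_tsupport fun h2 => hx.2 ⟨hx.1, h2⟩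

theorem exists_small_slope (n : ℕ) {η : ℝ} (hη : 0 < η) :
    ∃ ε : ℝ≥0, 0 < ε ∧ 2 * (ε : ℝ) + (((1 + ε) ^ n : ℝ≥0) - 1 : ℝ) ≤ η := by
  have hc : Continuous fun ε : ℝ => 2 * ε + ((1 + ε) ^ n - 1) := by fun_prop
  have h0 := hc.tendsto 0
  simp only [mul_zero, add_zero, one_pow, sub_self] at h0
  have h1 := (h0.eventually (Iic_mem_nhds hη)).filter_mono
    (nhdsWithin_le_nhds (s := Ioi 0))
  obtain ⟨ε, h2, h3⟩ := (h1.and self_mem_nhdsWithin).exists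
  have h3 : 0 < ε := h3
  exact ⟨⟨ε, h3.le⟩, h3, by push_cast; exact h2⟩

theorem setIntegral_eq_of_inter_eq {d : ℕ} {μ : Measure (Space d)} {S T U : Set (Space d)}
    {g : Space d → ℝ} (hS : MeasurableSet S) (hT : MeasurableSet T) (hST : ∀ x ∈ U, x ∈ S ↔ x ∈ T)
    (hg : ∀ x ∉ U, g x = 0) : ∫ x in S, g x ∂μ = ∫ x in T, g x ∂μ := by
  rw [← integral_indicator hS, ← integral_indicator hT]
  congr 1
  funext x
  by_cases hx : x ∈ U
  · by_cases h : x ∈ S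
    · rw [indicator_of_mem h, indicator_of_mem ((hST x hx).mp h)]
    · rw [indicator_of_notMem h, indicator_of_notMem fun h' => h ((hST x hx).mpr h')]
  · simp [indicator, hg x hx]

/-- Near a boundary point, the divergence theorem holds up to an arbitrarily small error relative to
the `L¹` norm of the field on the boundary. In the small neighbourhood, both the surface measure and
the normal are close to those of the tangent plane. -/
theorem exists_nhds_frontier_divergence {n : ℕ} {D : Set (Space (n + 1))} (hD : IsOpen D)
    (hDs : HasSmoothBoundary D) {x₀ : Space (n + 1)} (hx₀ : x₀ ∈ frontier D) {η : ℝ}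
    (hη : 0 < η) :
    ∃ U : Set (Space (n + 1)), IsOpen U ∧ x₀ ∈ U ∧
      (∀ K ⊆ U, IsCompact K → (μHE[n] : Measure (Space (n + 1))) (frontier D ∩ K) < ⊤) ∧
      ∀ F : Space (n + 1) → Space (n + 1), HasCompactSupport F → tsupport F ⊆ U →
        ContinuousOn F (closure D) → ContDiffOn ℝ 1 F D → IntegrableOn (divergence F) D →
        |(∫ x in D, divergence F x) - ∫ x in frontier D, inner ℝ (unitNormal D x) (F x) ∂μHE[n]| ≤
          η * ∫ x in frontier D, ‖F x‖ ∂μHE[n] := by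
  obtain ⟨ε, hε, hεη⟩ := exists_small_slope n hη
  obtain ⟨φ, hφ⟩ := hDs x₀ hx₀
  obtain ⟨m, U₁, hU₁, hxU₁, hm, hDU₁, -⟩ := hφ.exists_isHeight hε
  set v := ‖gradient φ x₀‖⁻¹ • gradient φ x₀ with hv
  obtain ⟨ι, hι0, hι, hsurj⟩ := exists_frame hm.norm_eq
  obtain ⟨hle, hge⟩ := hm.baseMeasure_le hι0
  have hge := hge hsurj
  have hnc := continuousOn_unitNormal hD hDs x₀ hx₀
  have hn0 : unitNormal D x₀ = v := hφ.unitNormal_eq hx₀ hD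
  have hnear : ∀ᶠ x in 𝓝[frontier D] x₀, ‖unitNormal D x - v‖ < ε := by
    have := hnc.eventually (ball_mem_nhds _ (NNReal.coe_pos.mpr hε))
    filter_upwards [this] with x hx
    rwa [hn0, dist_eq_norm] at hx
  obtain ⟨U₂, hU₂, hxU₂, hnU₂⟩ := mem_nhdsWithin.mp hnear
  have hSm : MeasurableSet {x | m x = 0} :=
    (isClosed_eq hm.lipschitz.continuous continuous_const).measurableSet
  have hfm : MeasurableSet (frontier D) := isClosed_frontier.measurableSet
  have hfr : ∀ x ∈ U₁ ∩ U₂, x ∈ frontier D ↔ x ∈ {x | m x = 0} := fun x hx =>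
    hm.mem_frontier_iff hU₁ hD hDU₁ hx.1
  have hfin0 : ∀ K : Set (Space (n + 1)), IsCompact K →
      ((μHE[n] : Measure (Space (n + 1))).restrict {x | m x = 0}) K < ⊤ := by
    intro K hK
    refine (hge K).trans_lt ?_
    rw [Measure.smul_apply, ENNReal.smul_def, smul_eq_mul]
    exact ENNReal.mul_lt_top ENNReal.coe_lt_top (hm.baseMeasure_lt_top hι0 hK.isBounded)
  have hfin : ∀ K ⊆ U₁ ∩ U₂, IsCompact K →
      (μHE[n] : Measure (Space (n + 1))) (frontier D ∩ K) < ⊤ := by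
    intro K hKU hK
    have h1 := hfin0 K hK
    rw [Measure.restrict_apply hK.measurableSet] at h1
    refine (measure_mono ?_).trans_lt h1
    exact fun x hx => ⟨hx.2, (hfr x (hKU hx.2)).mp hx.1⟩
  refine ⟨U₁ ∩ U₂, hU₁.inter hU₂, ⟨hxU₁, hxU₂⟩, hfin, ?_⟩
  intro F hFc hFU hFcont hFd hdiv
  have hFU₁ : tsupport F ⊆ U₁ := hFU.trans inter_subset_left
  have hFm : ContinuousOn F {x | 0 ≤ m x} := hm.continuousOn_field hU₁ hDU₁ hFU₁ hFcont
  have hF0 : ∀ x ∉ U₁ ∩ U₂, F x = 0 := fun x hx =>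
    image_eq_zero_of_notMem_tsupport fun h => hx (hFU h)
  have hest := hm.abs_integral_divergence_sub_le hι0 hι hD hU₁ hDU₁ hFc hFU₁ hFcont hFd hdiv
  have hF0m : ContinuousOn F {x | m x = 0} := hFm.mono fun x hx => le_of_eq (Eq.symm hx)
  have hFfr : ContinuousOn F (frontier D) := hFcont.mono frontier_subset_closure
  have hcl : IsClosed {x | m x = 0} := isClosed_eq hm.lipschitz.continuous continuous_const
  -- integrability over the graph
  have hfin1 : ∀ h : Space (n + 1) → ℝ, tsupport h ⊆ tsupport F → HasCompactSupport h →
      (μHE[n] : Measure (Space (n + 1))) ({x | m x = 0} ∩ tsupport h) < ⊤ := by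
    intro h _ hc
    have h1 := hfin0 _ hc.isCompact
    rwa [Measure.restrict_apply (isClosed_tsupport h).measurableSet, inter_comm] at h1
  have hsv : ∀ w : Space (n + 1) → Space (n + 1),
      tsupport (fun x => (inner ℝ (w x) (F x) : ℝ)) ⊆ tsupport F := fun w => by
    refine closure_mono fun x hx => ?_
    contrapose! hx
    simp [Function.notMem_support.mp hx]
  have hcs : ∀ w : Space (n + 1) → Space (n + 1),
      HasCompactSupport (fun x => (inner ℝ (w x) (F x) : ℝ)) := fun w =>
    hFc.isCompact.of_isClosed_subset (isClosed_tsupport _) (hsv w)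
  have hiv : IntegrableOn (fun x => (inner ℝ v (F x) : ℝ)) {x | m x = 0} μHE[n] :=
    integrableOn_of_hasCompactSupport hcl (continuousOn_const.inner hF0m) (hcs fun _ => v)
      (hfin1 _ (hsv fun _ => v) (hcs fun _ => v))
  have hin : IntegrableOn (fun x => ‖F x‖) {x | m x = 0} μHE[n] := by
    refine integrableOn_of_hasCompactSupport hcl hF0m.norm hFc.norm
      (hfin1 _ (closure_mono fun x hx => ?_) hFc.norm)
    simpa using hx
  have hfinF : (μHE[n] : Measure (Space (n + 1))) (frontier D ∩ tsupport F) < ⊤ :=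
    hfin _ hFU hFc.isCompact
  have hifv : IntegrableOn (fun x => (inner ℝ v (F x) : ℝ)) (frontier D) μHE[n] :=
    integrableOn_of_hasCompactSupport isClosed_frontier (continuousOn_const.inner hFfr)
      (hcs fun _ => v) ((measure_mono (inter_subset_inter_right _ (hsv _))).trans_lt hfinF)
  have hifn : IntegrableOn (fun x => (inner ℝ (unitNormal D x) (F x) : ℝ)) (frontier D) μHE[n] :=
    integrableOn_of_hasCompactSupport isClosed_frontier
      ((continuousOn_unitNormal hD hDs).inner hFfr)
      (hcs _) ((measure_mono (inter_subset_inter_right _ (hsv _))).trans_lt hfinF)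
  have hifF : IntegrableOn (fun x => ‖F x‖) (frontier D) μHE[n] := by
    refine integrableOn_of_hasCompactSupport isClosed_frontier hFfr.norm hFc.norm
      ((measure_mono (inter_subset_inter_right _ (closure_mono fun x hx => ?_))).trans_lt hfinF)
    simpa using hx
  -- comparison of the three integrals
  have e1 := abs_integral_sub_integral_le hle hge hiv
  have hc0 : (0 : ℝ) ≤ ((1 + ε) ^ n : ℝ≥0) - 1 := by
    have : (1 : ℝ≥0) ≤ (1 + ε) ^ n := one_le_pow₀ (by simp)
    have : (1 : ℝ) ≤ ((1 + ε) ^ n : ℝ≥0) := by exact_mod_cast this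
    linarith
  have e2 : ∫ x, |(inner ℝ v (F x) : ℝ)| ∂(baseMeasure m v ι) ≤
      ∫ x, ‖F x‖ ∂(baseMeasure m v ι) := by
    refine integral_mono_ae (Integrable.mono_measure hiv hle).abs (Integrable.mono_measure hin hle)
      (Eventually.of_forall fun x => ?_)
    refine (abs_real_inner_le_norm _ _).trans ?_
    rw [hm.norm_eq, one_mul]
  have e3 : ∫ x, ‖F x‖ ∂(baseMeasure m v ι) ≤ ∫ x in {x | m x = 0}, ‖F x‖ ∂μHE[n] :=
    integral_mono_measure hle (Eventually.of_forall fun x => norm_nonneg _) hin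
  have e4 : ∫ x in {x | m x = 0}, ‖F x‖ ∂μHE[n] = ∫ x in frontier D, ‖F x‖ ∂μHE[n] :=
    setIntegral_eq_of_inter_eq hSm hfm (fun x hx => (hfr x hx).symm) fun x hx => by
      rw [hF0 x hx, norm_zero]
  have e5 : ∫ x in {x | m x = 0}, (inner ℝ v (F x) : ℝ) ∂μHE[n] =
      ∫ x in frontier D, (inner ℝ v (F x) : ℝ) ∂μHE[n] :=
    setIntegral_eq_of_inter_eq hSm hfm (fun x hx => (hfr x hx).symm) fun x hx => by
      rw [hF0 x hx, inner_zero_right]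
  have e6 : |∫ x in frontier D, (inner ℝ v (F x) : ℝ) ∂μHE[n] -
      ∫ x in frontier D, (inner ℝ (unitNormal D x) (F x) : ℝ) ∂μHE[n]| ≤
      ε * ∫ x in frontier D, ‖F x‖ ∂μHE[n] := by
    rw [← integral_sub hifv hifn, ← integral_const_mul]
    refine abs_integral_le_integral_abs.trans (setIntegral_mono_on (hifv.sub hifn).abs
      (hifF.const_mul _) hfm fun x hx => ?_)
    rw [← inner_sub_left]
    by_cases hxU : x ∈ U₁ ∩ U₂
    · refine (abs_real_inner_le_norm _ _).trans ?_
      rw [norm_sub_rev]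
      gcongr
      have h := hnU₂ ⟨hxU.2, hx⟩
      exact le_of_lt h
    · rw [hF0 x hxU]; simp
  rw [e5] at e1
  rw [e4] at e3
  set I := ∫ x in frontier D, ‖F x‖ ∂μHE[n]
  set J := ∫ x, ‖F x‖ ∂(baseMeasure m v ι)
  have hI : 0 ≤ I := integral_nonneg fun x => norm_nonneg _
  have f1 : (ε : ℝ) * J ≤ ε * I := mul_le_mul_of_nonneg_left e3 ε.2
  have f2 := mul_le_mul_of_nonneg_left (e2.trans e3) hc0
  have f3 := mul_le_mul_of_nonneg_right hεη hI
  have a1 := abs_le.mp hest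
  have a2 := abs_le.mp e1
  have a3 := abs_le.mp e6
  rw [abs_le]
  constructor <;> linarith [a1.1, a1.2, a2.1, a2.2, a3.1, a3.2]

theorem measure_frontier_inter_lt_top {n : ℕ} {D : Set (Space (n + 1))} (hD : IsOpen D)
    (hDs : HasSmoothBoundary D) {K : Set (Space (n + 1))} (hK : IsCompact K) :
    (μHE[n] : Measure (Space (n + 1))) (frontier D ∩ K) < ⊤ := by
  refine (hK.inter_left isClosed_frontier).measure_lt_top_of_nhdsWithin fun x hx => ?_
  obtain ⟨U, hU, hxU, hfin, -⟩ := exists_nhds_frontier_divergence hD hDs hx.1 one_pos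
  obtain ⟨L, hL, hxL, hLU⟩ := exists_compact_subset hU hxU
  refine ⟨frontier D ∩ L, ?_, hfin L hLU hL⟩
  filter_upwards [self_mem_nhdsWithin, mem_nhdsWithin_of_mem_nhds (mem_interior_iff_mem_nhds.mp hxL)]
    with y h1 h2 using ⟨h1.1, h2⟩

theorem exists_nhds_divergence {n : ℕ} {D : Set (Space (n + 1))} (hD : IsOpen D)
    (hDs : HasSmoothBoundary D) (x₀ : Space (n + 1)) {η : ℝ} (hη : 0 < η) :
    ∃ U : Set (Space (n + 1)), IsOpen U ∧ x₀ ∈ U ∧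
      ∀ F : Space (n + 1) → Space (n + 1), HasCompactSupport F → tsupport F ⊆ U →
        ContinuousOn F (closure D) → ContDiffOn ℝ 1 F D → IntegrableOn (divergence F) D →
        |(∫ x in D, divergence F x) - ∫ x in frontier D, inner ℝ (unitNormal D x) (F x) ∂μHE[n]| ≤
          η * ∫ x in frontier D, ‖F x‖ ∂μHE[n] := by
  have hdisj : ∀ F : Space (n + 1) → Space (n + 1), (∀ x ∈ frontier D, F x = 0) →
      ∫ x in D, divergence F x = 0 →
      |(∫ x in D, divergence F x) - ∫ x in frontier D, inner ℝ (unitNormal D x) (F x) ∂μHE[n]| ≤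
          η * ∫ x in frontier D, ‖F x‖ ∂μHE[n] := by
    intro F h1 h2
    have h3 : ∫ x in frontier D, (inner ℝ (unitNormal D x) (F x) : ℝ) ∂μHE[n] = 0 :=
      setIntegral_eq_zero_of_forall_eq_zero fun x hx => by rw [h1 x hx, inner_zero_right]
    rw [h2, h3, sub_zero, abs_zero]
    exact mul_nonneg hη.le (integral_nonneg fun x => norm_nonneg _)
  by_cases hxc : x₀ ∈ closure D
  · by_cases hxD : x₀ ∈ D
    · refine ⟨D, hD, hxD, fun F hFc hFU hFcont hFd hdiv => hdisj F (fun x hx => ?_) ?_⟩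
      · refine image_eq_zero_of_notMem_tsupport fun h => ?_
        rw [frontier, hD.interior_eq] at hx
        exact hx.2 (hFU h)
      · have h := (integral_fderiv_apply_eq (k := fun _ => 1) hD hFd hFc (LipschitzWith.const 1)
          (inter_subset_right.trans hFU)).2
        rw [setIntegral_eq_integral_of_forall_compl_eq_zero fun x hx =>
          divergence_eq_zero_of_notMem_tsupport fun h => hx (hFU h)]
        simpa using h
    · obtain ⟨U, hU, hxU, -, h⟩ := exists_nhds_frontier_divergence hD hDs
        (show x₀ ∈ frontier D by rw [frontier, hD.interior_eq]; exact ⟨hxc, hxD⟩) hη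
      exact ⟨U, hU, hxU, h⟩
  · refine ⟨(closure D)ᶜ, isClosed_closure.isOpen_compl, hxc,
      fun F hFc hFU hFcont hFd hdiv => hdisj F (fun x hx => ?_) ?_⟩
    · exact image_eq_zero_of_notMem_tsupport fun h => hFU h (frontier_subset_closure hx)
    · exact setIntegral_eq_zero_of_forall_eq_zero fun x hx =>
        divergence_eq_zero_of_notMem_tsupport fun h => hFU h (subset_closure hx)

theorem divergence_smul {d : ℕ} {ψ : Space d → ℝ} {F : Space d → Space d} {x : Space d}
    (hψ : DifferentiableAt ℝ ψ x) (hF : DifferentiableAt ℝ F x) :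
    divergence (fun y => ψ y • F y) x = ψ x * divergence F x + fderiv ℝ ψ x (F x) := by
  have hFi : ∀ i, DifferentiableAt ℝ (fun y => F y i) x := fun i =>
    (differentiableAt_euclidean.mp hF) i
  have h : fderiv ℝ ψ x (F x) = ∑ i, F x i * fderiv ℝ ψ x (EuclideanSpace.single i 1) := by
    conv_lhs => rw [eq_sum_single (F x)]
    simp
  rw [h, divergence, divergence, Finset.mul_sum, ← Finset.sum_add_distrib]
  refine Finset.sum_congr rfl fun i _ => ?_
  simp only [pderiv, PiLp.smul_apply, smul_eq_mul]
  rw [fderiv_fun_mul hψ (hFi i)]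
  simp

/-- The divergence theorem on a region with smooth boundary. The field need not be differentiable up
to the boundary; the local estimates with relative error `η` are added up by a partition of
unity. -/
theorem integral_divergence_eq {n : ℕ} {D : Set (Space (n + 1))} (hD : IsOpen D)
    (hDs : HasSmoothBoundary D) {F : Space (n + 1) → Space (n + 1)} (hFc : HasCompactSupport F)
    (hFcont : ContinuousOn F (closure D)) (hFd : ContDiffOn ℝ 1 F D)
    (hdiv : IntegrableOn (divergence F) D) :
    ∫ x in D, divergence F x =
      ∫ x in frontier D, inner ℝ (unitNormal D x) (F x) ∂μHE[n] := by
  have hfin := measure_frontier_inter_lt_top hD hDs hFc.isCompact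
  have hFfr : ContinuousOn F (frontier D) := hFcont.mono frontier_subset_closure
  suffices h : ∀ η : ℝ, 0 < η →
      |(∫ x in D, divergence F x) - ∫ x in frontier D, inner ℝ (unitNormal D x) (F x) ∂μHE[n]| ≤
        η * ∫ x in frontier D, ‖F x‖ ∂μHE[n] by
    set I := ∫ x in frontier D, ‖F x‖ ∂μHE[n]
    have hI : 0 ≤ I := integral_nonneg fun x => norm_nonneg _
    rw [← sub_eq_zero, ← abs_nonpos_iff]
    refine le_of_forall_pos_le_add fun δ hδ => ?_
    refine (h (δ / (I + 1)) (by positivity)).trans ?_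
    rw [zero_add, div_mul_eq_mul_div, div_le_iff₀ (by positivity)]
    nlinarith
  intro η hη
  choose U hU hxU hUF using fun x₀ => exists_nhds_divergence hD hDs x₀ hη
  obtain ⟨t, -, ht⟩ := hFc.isCompact.elim_nhds_subcover U fun x _ => (hU x).mem_nhds (hxU x)
  obtain ⟨f, hf⟩ := SmoothPartitionOfUnity.exists_isSubordinate
    (modelWithCornersSelf ℝ (Space (n + 1))) (isClosed_tsupport F) (fun i : t => U i)
    (fun i => hU i) (by simpa [iUnion_subtype] using ht)
  have hψ : ∀ i, ContDiff ℝ 1 (f i) := fun i =>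
    (f i).contMDiff.contDiff.of_le (by exact_mod_cast le_top)
  have hsum1 : ∀ x ∈ tsupport F, ∑ i, f i x = 1 := fun x hx => by
    rw [← finsum_eq_sum_of_fintype]; exact f.sum_eq_one hx
  set G : t → Space (n + 1) → Space (n + 1) := fun i x => f i x • F x with hG
  have hGF : ∀ i, tsupport (G i) ⊆ tsupport F := fun i => closure_mono fun x hx => by
    contrapose! hx
    simp [hG, Function.notMem_support.mp hx]
  have hGU : ∀ i, tsupport (G i) ⊆ U i := fun i => by
    refine (closure_mono fun x hx => ?_).trans (hf i)
    contrapose! hx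
    simp [hG, Function.notMem_support.mp hx]
  have hGc : ∀ i, HasCompactSupport (G i) := fun i =>
    hFc.isCompact.of_isClosed_subset (isClosed_tsupport _) (hGF i)
  have hGcont : ∀ i, ContinuousOn (G i) (closure D) := fun i =>
    (hψ i).continuous.continuousOn.smul hFcont
  have hGd : ∀ i, ContDiffOn ℝ 1 (G i) D := fun i => (hψ i).contDiffOn.smul hFd
  have hFdiff : ∀ x ∈ D, DifferentiableAt ℝ F x := fun x hx =>
    (hFd.contDiffAt (hD.mem_nhds hx)).differentiableAt (by simp)
  have hdivG : ∀ i, ∀ x ∈ D, divergence (G i) x =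
      f i x * divergence F x + fderiv ℝ (f i) x (F x) := fun i x hx =>
    divergence_smul ((hψ i).differentiable (by simp)).differentiableAt (hFdiff x hx)
  have hidD : ∀ i, IntegrableOn (divergence (G i)) D := fun i => by
    have h1 : IntegrableOn (fun x => f i x * divergence F x) D :=
      Integrable.bdd_mul hdiv (hψ i).continuous.aestronglyMeasurable (c := 1)
        (Eventually.of_forall fun x => by
          rw [Real.norm_of_nonneg (f.nonneg i x)]; exact f.le_one i x)
    have h2 : IntegrableOn (fun x => fderiv ℝ (f i) x (F x)) (closure D) := by
      have hc : HasCompactSupport fun x => fderiv ℝ (f i) x (F x) := by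
        refine hFc.isCompact.of_isClosed_subset (isClosed_tsupport _) (closure_mono fun x hx => ?_)
        contrapose! hx
        simp [Function.notMem_support.mp hx]
      refine integrableOn_of_hasCompactSupport isClosed_closure ?_ hc
        ((measure_mono inter_subset_right).trans_lt hc.isCompact.measure_lt_top)
      exact ((hψ i).continuous_fderiv (by simp)).continuousOn.clm_apply hFcont
    exact (h1.add (h2.mono_set subset_closure)).congr_fun
      (fun x hx => (hdivG i x hx).symm) hD.measurableSet
  have hest := fun i : t => hUF i (G i) (hGc i) (hGU i) (hGcont i) (hGd i) (hidD i)
  -- reassemble the pieces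
  have hFG : ∀ x, ∑ i, G i x = F x := fun x => by
    by_cases hx : x ∈ tsupport F
    · simp only [hG, ← Finset.sum_smul, hsum1 x hx, one_smul]
    · simp [hG, image_eq_zero_of_notMem_tsupport hx]
  have hsumD : ∑ i, ∫ x in D, divergence (G i) x = ∫ x in D, divergence F x := by
    rw [← integral_finsetSum _ fun i _ => hidD i]
    refine setIntegral_congr_fun hD.measurableSet fun x hx => ?_
    have e1 : F = fun y => ∑ i, G i y := funext fun y => (hFG y).symm
    have hGi : ∀ i j, DifferentiableAt ℝ (fun y => G i y j) x := fun i j =>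
      (differentiableAt_euclidean.mp
        (((hGd i).contDiffAt (hD.mem_nhds hx)).differentiableAt (by simp))) j
    simp only [divergence]
    rw [Finset.sum_comm]
    refine Finset.sum_congr rfl fun j _ => ?_
    conv_rhs => rw [e1]
    simp only [pderiv, WithLp.ofLp_sum, Finset.sum_apply]
    rw [fderiv_fun_sum fun i _ => hGi i j]
    simp
  have hmf : MeasurableSet (frontier D) := isClosed_frontier.measurableSet
  have hts : ∀ w : Space (n + 1) → Space (n + 1), ∀ i,
      tsupport (fun x => (inner ℝ (w x) (G i x) : ℝ)) ⊆ tsupport F := fun w i => by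
    refine (closure_mono fun x hx => ?_).trans (hGF i)
    contrapose! hx
    simp [Function.notMem_support.mp hx]
  have hiS : ∀ i, IntegrableOn (fun x => (inner ℝ (unitNormal D x) (G i x) : ℝ))
      (frontier D) μHE[n] := fun i =>
    integrableOn_of_hasCompactSupport isClosed_frontier
      ((continuousOn_unitNormal hD hDs).inner ((hGcont i).mono frontier_subset_closure))
      (hFc.isCompact.of_isClosed_subset (isClosed_tsupport _) (hts _ i))
      ((measure_mono (inter_subset_inter_right _ (hts _ i))).trans_lt hfin)
  have hiN : ∀ i, IntegrableOn (fun x => ‖G i x‖) (frontier D) μHE[n] := fun i => by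
    have h1 : tsupport (fun x => ‖G i x‖) ⊆ tsupport F :=
      (closure_mono fun x hx => by simpa using hx).trans (hGF i)
    exact integrableOn_of_hasCompactSupport isClosed_frontier
      ((hGcont i).mono frontier_subset_closure).norm
      (hFc.isCompact.of_isClosed_subset (isClosed_tsupport _) h1)
      ((measure_mono (inter_subset_inter_right _ h1)).trans_lt hfin)
  have hsumS : ∑ i, ∫ x in frontier D, (inner ℝ (unitNormal D x) (G i x) : ℝ) ∂μHE[n] =
      ∫ x in frontier D, (inner ℝ (unitNormal D x) (F x) : ℝ) ∂μHE[n] := by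
    rw [← integral_finsetSum _ fun i _ => hiS i]
    refine integral_congr_ae (Eventually.of_forall fun x => ?_)
    simp only
    rw [← inner_sum, hFG]
  have hsumN : ∑ i, ∫ x in frontier D, ‖G i x‖ ∂μHE[n] = ∫ x in frontier D, ‖F x‖ ∂μHE[n] := by
    rw [← integral_finsetSum _ fun i _ => hiN i]
    refine integral_congr_ae (Eventually.of_forall fun x => ?_)
    by_cases hx : x ∈ tsupport F
    · simp only [hG, norm_smul, Real.norm_of_nonneg (f.nonneg _ x)]
      rw [← Finset.sum_mul, hsum1 x hx, one_mul]
    · simp [hG, image_eq_zero_of_notMem_tsupport hx]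
  rw [← hsumD, ← hsumS, ← hsumN, ← Finset.sum_sub_distrib, Finset.mul_sum]
  exact (Finset.abs_sum_le_sum_abs _ _).trans (Finset.sum_le_sum fun i _ => hest i)

/-! ### The maximal inequality for continuous martingales -/

/-- Doob's maximal inequality for a martingale with continuous paths, from the discrete inequality
on finer and finer grids. -/
theorem measure_exists_lt_abs_le {Ω : Type*} {m0 : MeasurableSpace Ω} {μ : Measure Ω}
    [IsFiniteMeasure μ] {ℱ : Filtration ℝ≥0 m0} {M : ℝ≥0 → Ω → ℝ} (hM : Martingale M ℱ μ)
    (hc : ∀ w, Continuous fun t => M t w) (t : ℝ≥0) {ε : ℝ≥0} (hε : 0 < ε) :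
    μ {w | ∃ s ≤ t, (ε : ℝ) < |M s w|} ≤ ENNReal.ofReal ((ε : ℝ)⁻¹ * ∫ w, |M t w| ∂μ) := by
  have habs : Submartingale (fun s w => |M s w|) ℱ μ := hM.submartingale.sup hM.neg.submartingale
  set τ : ℕ → ℕ → ℝ≥0 := fun N k => t * min ((k : ℝ≥0) / N) 1 with hτ
  have hτmono : ∀ N, Monotone (τ N) := fun N j k hjk => by
    simp only [hτ]
    gcongr
  have hτle : ∀ N k, τ N k ≤ t := fun N k => by
    simp only [hτ]
    exact mul_le_of_le_one_right zero_le (min_le_right _ _)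
  set A : ℕ → Set Ω := fun N => {w | ∃ k ≤ N, (ε : ℝ) ≤ |M (τ N k) w|} with hA
  have hAle : ∀ N, 0 < N → μ (A N) ≤ ENNReal.ofReal ((ε : ℝ)⁻¹ * ∫ w, |M t w| ∂μ) := by
    intro N hN
    let 𝒢 : Filtration ℕ m0 := ⟨fun k => ℱ (τ N k), fun j k hjk => ℱ.mono (hτmono N hjk),
      fun k => ℱ.le _⟩
    have hsub : Submartingale (fun k w => |M (τ N k) w|) 𝒢 μ :=
      ⟨fun k => habs.1 (τ N k), fun j k hjk => habs.2.1 _ _ (hτmono N hjk), fun k => habs.2.2 _⟩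
    have h := maximal_ineq (ε := ε) hsub (fun k w => abs_nonneg _) N
    have hset : {w | (ε : ℝ) ≤ (Finset.range (N + 1)).sup' Finset.nonempty_range_add_one
        fun k => |M (τ N k) w|} = A N := by
      ext w
      simp only [hA, mem_ofPred_eq, Finset.le_sup'_iff, Finset.mem_range, Nat.lt_succ_iff]
    rw [hset] at h
    have hτN : τ N N = t := by
      simp only [hτ]
      rw [div_self (by exact_mod_cast hN.ne'), min_self, mul_one]
    rw [hτN] at h
    have h2 : ∫ w in A N, |M t w| ∂μ ≤ ∫ w, |M t w| ∂μ :=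
      setIntegral_le_integral (habs.2.2 t) (Eventually.of_forall fun w => abs_nonneg _)
    have h3 := h.trans (ENNReal.ofReal_le_ofReal h2)
    rw [ENNReal.ofReal_mul (by positivity), ENNReal.ofReal_inv_of_pos (by exact_mod_cast hε),
      ENNReal.ofReal_coe_nnreal, mul_comm, ← div_eq_mul_inv]
    rw [ENNReal.le_div_iff_mul_le (Or.inl (by exact_mod_cast hε.ne')) (Or.inl ENNReal.coe_ne_top),
      mul_comm]
    exact h3
  set B : ℕ → Set Ω := fun j => ⋂ N ≥ j + 1, A N with hB
  have hBmono : Monotone B := fun i j hij => by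
    simp only [hB]
    exact biInter_mono (fun N (hN : N ≥ j + 1) => show N ≥ i + 1 by omega) fun N _ => le_rfl
  have hBle : ∀ j, μ (B j) ≤ ENNReal.ofReal ((ε : ℝ)⁻¹ * ∫ w, |M t w| ∂μ) := fun j =>
    (measure_mono (biInter_subset_of_mem (show j + 1 ≥ j + 1 from le_rfl))).trans
      (hAle (j + 1) (Nat.succ_pos j))
  refine (measure_mono (t := ⋃ j, B j) ?_).trans ?_
  · rintro w ⟨s, hst, hs⟩
    -- grid points below `s`, converging to `s`
    have hlim : Tendsto (fun N : ℕ => τ N ⌊((s / t : ℝ≥0) : ℝ) * N⌋₊) atTop (𝓝 s) := by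
      have h1 : Tendsto (fun N : ℕ => ((⌊((s / t : ℝ≥0) : ℝ) * N⌋₊ : ℝ≥0) / N)) atTop (𝓝 (s / t)) := by
        rw [← NNReal.tendsto_coe]
        refine ((tendsto_nat_floor_mul_div_atTop (R := ℝ) (s / t).2).comp
          tendsto_natCast_atTop_atTop).congr fun N => ?_
        simp
      have h2 := (h1.min (tendsto_const_nhds (x := (1 : ℝ≥0)))).const_mul t
      have h3 : t * min (s / t) 1 = s := by
        rcases eq_or_ne t 0 with rfl | ht
        · simpa using hst.antisymm zero_le |>.symm
        · rw [min_eq_left ((div_le_one₀ (pos_iff_ne_zero.mpr ht)).mpr hst), mul_div_cancel₀ _ ht]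
      rw [h3] at h2
      exact h2
    have hev : ∀ᶠ N : ℕ in atTop, (ε : ℝ) < |M (τ N ⌊((s / t : ℝ≥0) : ℝ) * N⌋₊) w| :=
      (((hc w).abs.tendsto s).comp hlim).eventually (lt_mem_nhds hs)
    obtain ⟨j, hj⟩ := eventually_atTop.mp hev
    refine mem_iUnion.mpr ⟨j, mem_iInter₂.mpr fun N hN => ⟨_, ?_, (hj N (by omega)).le⟩⟩
    refine Nat.floor_le_of_le ?_
    exact mul_le_of_le_one_left (Nat.cast_nonneg N)
      (NNReal.coe_le_one.mpr (div_le_one_of_le₀ hst zero_le))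
  · rw [hBmono.measure_iUnion]
    exact iSup_le hBle

/-! ### The generator -/

theorem contDiff_pderiv {d : ℕ} {n k : WithTop ℕ∞} {u : Space d → ℝ} (hu : ContDiff ℝ n u)
    (hk : k + 1 ≤ n) (i : Fin d) : ContDiff ℝ k (pderiv i u) :=
  (hu.fderiv_right hk).clm_apply contDiff_const

theorem pderiv_congr {d : ℕ} {u w : Space d → ℝ} {x : Space d} (h : u =ᶠ[𝓝 x] w) (i : Fin d) :
    pderiv i u =ᶠ[𝓝 x] pderiv i w := by
  filter_upwards [h.eventuallyEq_nhds] with y hy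
  rw [pderiv, pderiv, hy.fderiv_eq]

theorem generator_congr {d : ℕ} {a : Space d → Matrix (Fin d) (Fin d) ℝ} {b : Space d → Space d}
    {u w : Space d → ℝ} {x : Space d} (h : u =ᶠ[𝓝 x] w) : generator a b u x = generator a b w x := by
  unfold generator
  congr 1
  · refine Finset.sum_congr rfl fun i _ => Finset.sum_congr rfl fun j _ => ?_
    rw [(pderiv_congr (pderiv_congr h j) i).self_of_nhds]
  · refine Finset.sum_congr rfl fun i _ => ?_
    rw [(pderiv_congr h i).self_of_nhds]

theorem generator_const {d : ℕ} {a : Space d → Matrix (Fin d) (Fin d) ℝ} {b : Space d → Space d}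
    (c : ℝ) (x : Space d) : generator a b (fun _ => c) x = 0 := by
  have h : ∀ i : Fin d, ∀ c : ℝ, pderiv i (fun _ : Space d => c) = fun _ => 0 := fun i c => by
    funext y
    simp [pderiv]
  simp [generator, h]

theorem continuous_generator {d : ℕ} {a : Space d → Matrix (Fin d) (Fin d) ℝ}
    {b : Space d → Space d} (ha : ∀ i j, Continuous fun x => a x i j) (hb : Continuous b)
    {u : Space d → ℝ} (hu : ContDiff ℝ 2 u) : Continuous (generator a b u) := by
  unfold generator
  have h1 : ∀ i, ContDiff ℝ 1 (pderiv i u) := fun i => contDiff_pderiv hu (by norm_num) i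
  have h2 : ∀ i j, Continuous (pderiv i (pderiv j u)) := fun i j =>
    (contDiff_pderiv (k := 0) (h1 j) (by norm_num) i).continuous
  refine (continuous_finsetSum _ fun i _ => continuous_finsetSum _ fun j _ =>
    (ha i j).mul (h2 i j)).add (continuous_finsetSum _ fun i _ => ?_)
  have hbi : Continuous fun x => b x i := by fun_prop
  exact hbi.mul (h1 i).continuous

theorem hasCompactSupport_generator {d : ℕ} {a : Space d → Matrix (Fin d) (Fin d) ℝ}
    {b : Space d → Space d} {u : Space d → ℝ} (hu : HasCompactSupport u) :
    HasCompactSupport (generator a b u) := by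
  refine hu.isCompact.of_isClosed_subset (isClosed_tsupport _)
    (closure_minimal (fun x hx => ?_) (isClosed_tsupport u))
  by_contra h
  refine hx ?_
  have : u =ᶠ[𝓝 x] fun _ => 0 := by
    filter_upwards [(isClosed_tsupport u).isOpen_compl.mem_nhds h] with y hy
    exact image_eq_zero_of_notMem_tsupport hy
  rw [generator_congr this, generator_const]

theorem exists_abs_generator_le {d : ℕ} {a : Space d → Matrix (Fin d) (Fin d) ℝ}
    {b : Space d → Space d} (ha : ∀ i j, Continuous fun x => a x i j) (hb : Continuous b)
    {u : Space d → ℝ} (hu : ContDiff ℝ 2 u) (hc : HasCompactSupport u) :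
    ∃ C : ℝ, 0 ≤ C ∧ ∀ x, |generator a b u x| ≤ C := by
  obtain ⟨C, hC⟩ := (hasCompactSupport_generator (a := a) (b := b) hc).exists_bound_of_continuous
    (continuous_generator ha hb hu)
  exact ⟨C, (norm_nonneg _).trans (hC 0), hC⟩

/-! ### Time integrals along paths -/

theorem continuous_coord {d : ℕ} (w : Path d) : Continuous fun t => coord t w := w.2

theorem continuous_comp_coord {d : ℕ} {h : Space d → ℝ} (hh : Continuous h) (w : Path d) :
    Continuous fun s : ℝ => h (coord s.toNNReal w) :=
  hh.comp ((continuous_coord w).comp continuous_real_toNNReal)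

/-- The time integral `∫_0^t h(X_s) ds`. -/
noncomputable def timeIntegral {d : ℕ} (h : Space d → ℝ) (t : ℝ) (w : Path d) : ℝ :=
  ∫ s in (0 : ℝ)..t, h (coord s.toNNReal w)

theorem measurable_timeIntegral {d : ℕ} {h : Space d → ℝ} (hh : Continuous h) {t : ℝ}
    (ht : 0 ≤ t) : Measurable (timeIntegral (d := d) h t) := by
  have h1 : StronglyMeasurable (Function.uncurry fun (s : ℝ) (w : Path d) =>
      h (coord s.toNNReal w)) :=
    stronglyMeasurable_uncurry_of_continuous_of_stronglyMeasurable
      (fun w => continuous_comp_coord hh w)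
      fun s => (hh.measurable.comp (measurable_coord _)).stronglyMeasurable
  have h2 : StronglyMeasurable (Function.uncurry fun (w : Path d) (s : ℝ) =>
      h (coord s.toNNReal w)) := h1.comp_measurable measurable_swap
  have h3 := h2.integral_prod_right (ν := volume.restrict (Ioc 0 t))
  have e : timeIntegral (d := d) h t = fun w => ∫ s in Ioc 0 t, h (coord s.toNNReal w) := by
    funext w
    rw [timeIntegral, intervalIntegral.integral_of_le ht]
  rw [e]
  exact h3.measurable

theorem abs_timeIntegral_le {d : ℕ} {h : Space d → ℝ} {C : ℝ} (hC : ∀ x, |h x| ≤ C) {t : ℝ}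
    (ht : 0 ≤ t) (w : Path d) : |timeIntegral h t w| ≤ C * t := by
  have := intervalIntegral.norm_integral_le_of_norm_le_const (a := 0) (b := t)
    (f := fun s => h (coord s.toNNReal w)) (C := C) fun s _ => hC _
  rwa [sub_zero, abs_of_nonneg ht] at this

theorem abs_timeIntegral_le_timeIntegral_abs {d : ℕ} {h : Space d → ℝ} {t : ℝ}
    (ht : 0 ≤ t) (w : Path d) : |timeIntegral h t w| ≤ timeIntegral (fun x => |h x|) t w :=
  intervalIntegral.abs_integral_le_integral_abs ht

theorem integrable_timeIntegral {d : ℕ} {h : Space d → ℝ} (hh : Continuous h) {C : ℝ}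
    (hC : ∀ x, |h x| ≤ C) {t : ℝ} (ht : 0 ≤ t) (μ : Measure (Path d)) [IsFiniteMeasure μ] :
    Integrable (timeIntegral h t) μ :=
  Integrable.of_bound (measurable_timeIntegral hh ht).aestronglyMeasurable (C * t)
    (Eventually.of_forall fun w => abs_timeIntegral_le hC ht w)

theorem continuous_timeIntegral {d : ℕ} {h : Space d → ℝ} (hh : Continuous h) (w : Path d) :
    Continuous fun t => timeIntegral h t w :=
  intervalIntegral.continuous_primitive
    (fun _ _ => (continuous_comp_coord hh w).intervalIntegrable _ _) 0

theorem tendsto_inv_mul_timeIntegral {d : ℕ} {h : Space d → ℝ} (hh : Continuous h) (w : Path d) :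
    Tendsto (fun t : ℝ => t⁻¹ * timeIntegral h t w) (𝓝[>] 0) (𝓝 (h (coord 0 w))) := by
  have h1 := ((continuous_comp_coord hh w).integral_hasStrictDerivAt 0 0).hasDerivAt
  have h2 := (hasDerivAt_iff_tendsto_slope_zero.mp h1).mono_left
    (nhdsWithin_mono 0 (show Ioi (0 : ℝ) ⊆ {0}ᶜ from fun x hx => ne_of_gt hx))
  simpa [timeIntegral] using h2

/-! ### Short-time behaviour of the diffusion -/

section Diffusion

variable {d : ℕ} {a : Space d → Matrix (Fin d) (Fin d) ℝ} {b : Space d → Space d}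
  {P : Kernel (Space d) (Path d)}

theorem integrable_comp_coord {μ : Measure (Path d)} [IsFiniteMeasure μ] {h : Space d → ℝ}
    (hh : Measurable h) {C : ℝ} (hC : ∀ x, |h x| ≤ C) (t : ℝ≥0) :
    Integrable (fun w => h (coord t w)) μ :=
  Integrable.of_bound (hh.comp (measurable_coord t)).aestronglyMeasurable C
    (Eventually.of_forall fun _ => hC _)

/-- Dynkin's formula for compactly supported functions. -/
theorem IsDiffusion.integral_comp_coord_sub (hP : IsDiffusion a b P)
    (ha : ∀ i j, Continuous fun x => a x i j) (hb : Continuous b) {g : Space d → ℝ}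
    (hg : ContDiff ℝ 2 g) (hgc : HasCompactSupport g) (x : Space d) (t : ℝ≥0) :
    (∫ w, g (coord t w) ∂(P x)) - g x = ∫ w, timeIntegral (generator a b g) t w ∂(P x) := by
  have := hP.isMarkovKernel
  obtain ⟨C, -, hC⟩ := exists_abs_generator_le ha hb hg hgc
  obtain ⟨Cg, hCg⟩ := hgc.exists_bound_of_continuous hg.continuous
  have hM := hP.martingale x g hg hgc
  have h1 := hM.setIntegral_eq (zero_le (a := t)) (s := univ) MeasurableSet.univ
  simp only [Measure.restrict_univ, NNReal.coe_zero, intervalIntegral.integral_same, sub_self,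
    integral_zero] at h1
  have hi1 : Integrable (fun w => g (coord t w)) (P x) :=
    integrable_comp_coord hg.continuous.measurable hCg t
  have hi0 : Integrable (fun w => g (coord 0 w)) (P x) :=
    integrable_comp_coord hg.continuous.measurable hCg 0
  have hi2 : Integrable (timeIntegral (generator a b g) t) (P x) :=
    integrable_timeIntegral (continuous_generator ha hb hg) hC t.2 _
  have h2 : ∫ w, (g (coord t w) - g (coord 0 w) - timeIntegral (generator a b g) t w) ∂(P x) = 0 :=
    h1.symm
  have hi10 : Integrable (fun w => g (coord t w) - g (coord 0 w)) (P x) := hi1.sub hi0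
  rw [integral_sub hi10 hi2, integral_sub hi1 hi0] at h2
  have h3 : ∫ w, g (coord 0 w) ∂(P x) = g x := by
    have : ∀ᵐ w ∂(P x), g (coord 0 w) = g x := (hP.start x).mono fun w hw => by rw [hw]
    rw [integral_congr_ae this]
    simp
  rw [h3] at h2
  linarith

/-- A bound for the probability that `g` moves from an extremal value to the other one within
time `t`. It involves `|L g|` along the path, so that it is `o(t)` if `L g` vanishes at the starting
point. -/
theorem IsDiffusion.measure_exists_le (hP : IsDiffusion a b P)
    (ha : ∀ i j, Continuous fun x => a x i j) (hb : Continuous b) {g : Space d → ℝ}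
    (hg : ContDiff ℝ 2 g) (hgc : HasCompactSupport g) (hg01 : ∀ x, g x ∈ Icc (0 : ℝ) 1)
    {x : Space d} (hx : g x = 0 ∨ g x = 1) {C : ℝ} (hC : ∀ x, |generator a b g x| ≤ C)
    {t : ℝ≥0} (ht : C * t ≤ 1 / 2) :
    (P x).real {w | ∃ s ≤ t, |g (coord s w) - g x| = 1} ≤
      8 * ∫ w, timeIntegral (fun y => |generator a b g y|) t w ∂(P x) := by
  have := hP.isMarkovKernel
  have hgen := continuous_generator ha hb hg
  have hCg : ∀ x, |g x| ≤ 1 := fun x => by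
    rw [abs_of_nonneg (hg01 x).1]; exact (hg01 x).2
  have hC0 : 0 ≤ C := (abs_nonneg _).trans (hC 0)
  have hM := hP.martingale x g hg hgc
  set M : ℝ≥0 → Path d → ℝ := fun t w => g (coord t w) - g (coord 0 w) -
    ∫ s in (0 : ℝ)..t, generator a b g (coord s.toNNReal w) with hMdef
  have hMc : ∀ w, Continuous fun t => M t w := fun w => by
    have h1 := continuous_timeIntegral hgen w
    have h2 := hg.continuous.comp (continuous_coord w)
    exact (h2.sub continuous_const).sub (h1.comp NNReal.continuous_coe)
  -- as the time integral is at most `1 / 2`, a full move of `g` forces `|M| ≥ 1 / 2 > 1 / 4`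
  have hmax := measure_exists_lt_abs_le hM hMc t (ε := 1 / 4) (by norm_num)
  set J := ∫ w, timeIntegral (fun y => |generator a b g y|) t w ∂(P x) with hJ
  have hCa : ∀ y, |(|generator a b g y|)| ≤ C := fun y => by rw [abs_abs]; exact hC y
  have hiJ : Integrable (timeIntegral (fun y => |generator a b g y|) t) (P x) :=
    integrable_timeIntegral hgen.abs hCa t.2 _
  have hi2 : Integrable (timeIntegral (generator a b g) t) (P x) :=
    integrable_timeIntegral hgen hC t.2 _
  have hi1 : Integrable (fun w => g (coord t w)) (P x) :=
    integrable_comp_coord hg.continuous.measurable hCg t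
  have hdyn := hP.integral_comp_coord_sub ha hb hg hgc x t
  have hEJ : |∫ w, timeIntegral (generator a b g) t w ∂(P x)| ≤ J :=
    abs_integral_le_integral_abs.trans (integral_mono hi2.abs hiJ fun w =>
      abs_timeIntegral_le_timeIntegral_abs t.2 w)
  -- since `g x` is an extremal value, the increment of `g` has a sign
  have hinc : ∫ w, |g (coord t w) - g x| ∂(P x) ≤ J := by
    rcases hx with hx | hx
    · have : ∀ w, |g (coord t w) - g x| = g (coord t w) - g x := fun w => by
        rw [abs_of_nonneg]; rw [hx, sub_zero]; exact (hg01 _).1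
      simp_rw [this]
      rw [integral_sub hi1 (integrable_const _), integral_const, probReal_univ, one_smul, hdyn]
      exact (le_abs_self _).trans hEJ
    · have : ∀ w, |g (coord t w) - g x| = -(g (coord t w) - g x) := fun w => by
        rw [abs_of_nonpos]; rw [hx, sub_nonpos]; exact (hg01 _).2
      simp_rw [this]
      rw [integral_neg, integral_sub hi1 (integrable_const _), integral_const, probReal_univ,
        one_smul, hdyn]
      exact (neg_le_abs _).trans hEJ
  have hEM : ∫ w, |M t w| ∂(P x) ≤ 2 * J := by
    have h1 : ∫ w, |M t w| ∂(P x) ≤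
        ∫ w, (|g (coord t w) - g x| + timeIntegral (fun y => |generator a b g y|) t w) ∂(P x) := by
      refine integral_mono_ae (hM.integrable t).abs
        ((hi1.sub (integrable_const _)).abs.add hiJ) ?_
      filter_upwards [hP.start x] with w hw
      simp only [hMdef, hw]
      exact (abs_sub _ _).trans
        (add_le_add le_rfl (abs_timeIntegral_le_timeIntegral_abs t.2 w))
    have hiabs : Integrable (fun w => |g (coord t w) - g x|) (P x) :=
      (hi1.sub (integrable_const _)).abs
    rw [integral_add hiabs hiJ] at h1
    linarith
  have hJ0 : 0 ≤ J := (abs_nonneg _).trans hEJ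
  have hsub : P x {w | ∃ s ≤ t, |g (coord s w) - g x| = 1} ≤
      P x {w | ∃ s ≤ t, ((1 / 4 : ℝ≥0) : ℝ) < |M s w|} := by
    refine measure_mono_ae ?_
    filter_upwards [hP.start x] with w hw
    rintro ⟨s, hst, hs⟩
    refine ⟨s, hst, ?_⟩
    have h1 := abs_timeIntegral_le hC s.2 w
    have h2 : C * s ≤ C * t := mul_le_mul_of_nonneg_left (by exact_mod_cast hst) hC0
    have h3 : M s w = (g (coord s w) - g x) - timeIntegral (generator a b g) s w := by
      simp only [hMdef, hw]; rfl
    have h4 := abs_sub_abs_le_abs_sub (g (coord s w) - g x) (timeIntegral (generator a b g) s w)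
    rw [h3]
    have h5 : ((1 / 4 : ℝ≥0) : ℝ) = 1 / 4 := by norm_num
    rw [h5]
    have h6 : |timeIntegral (generator a b g) s w| ≤ C * s := h1
    linarith
  have hfin := (hsub.trans hmax)
  have h7 : (((1 / 4 : ℝ≥0) : ℝ)⁻¹ * ∫ w, |M t w| ∂(P x)) ≤ 8 * J := by
    have h5 : ((1 / 4 : ℝ≥0) : ℝ)⁻¹ = 4 := by norm_num
    rw [h5]; linarith
  exact ENNReal.toReal_le_of_le_ofReal (by positivity)
    (hfin.trans (ENNReal.ofReal_le_ofReal h7))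

theorem IsDiffusion.measure_exists_le_const (hP : IsDiffusion a b P)
    (ha : ∀ i j, Continuous fun x => a x i j) (hb : Continuous b) {g : Space d → ℝ}
    (hg : ContDiff ℝ 2 g) (hgc : HasCompactSupport g) (hg01 : ∀ x, g x ∈ Icc (0 : ℝ) 1)
    {x : Space d} (hx : g x = 0 ∨ g x = 1) {C : ℝ} (hC : ∀ x, |generator a b g x| ≤ C)
    (t : ℝ≥0) : (P x).real {w | ∃ s ≤ t, |g (coord s w) - g x| = 1} ≤ 8 * C * t := by
  have := hP.isMarkovKernel
  have hC0 : 0 ≤ C := (abs_nonneg _).trans (hC 0)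
  rcases le_total (C * t) (1 / 2) with ht | ht
  · refine (hP.measure_exists_le ha hb hg hgc hg01 hx hC ht).trans ?_
    have hCa : ∀ y, |(|generator a b g y|)| ≤ C := fun y => by rw [abs_abs]; exact hC y
    have h1 : ∫ w, timeIntegral (fun y => |generator a b g y|) t w ∂(P x) ≤ C * t := by
      have := integral_mono (μ := P x) (integrable_timeIntegral
        (continuous_generator ha hb hg).abs hCa t.2 _) (integrable_const (C * t))
        fun w => (le_abs_self _).trans (abs_timeIntegral_le hCa t.2 w)
      simpa using this
    linarith
  · exact measureReal_le_one.trans (by linarith)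

/-- The probability of leaving a compact set `K`, or of reaching it, through a neighbourhood `U`
within time `t` is `O(t)`, uniformly in the starting point. -/
theorem IsDiffusion.exists_measure_cross_le (hP : IsDiffusion a b P)
    (ha : ∀ i j, Continuous fun x => a x i j) (hb : Continuous b) {K U : Set (Space d)}
    (hK : IsCompact K) (hU : IsOpen U) (hKU : K ⊆ U) :
    ∃ C : ℝ, 0 ≤ C ∧ ∀ t : ℝ≥0,
      (∀ x ∈ K, (P x).real {w | ∃ s ≤ t, coord s w ∉ U} ≤ C * t) ∧
      ∀ x ∉ U, (P x).real {w | ∃ s ≤ t, coord s w ∈ K} ≤ C * t := by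
  have := hP.isMarkovKernel
  obtain ⟨κ, hκ, hκc, hκU, hκ1, hκ01⟩ := exists_cutoff hK hU hKU
  have hκ2 : ContDiff ℝ 2 κ := contDiff_infty.mp hκ 2
  obtain ⟨C, hC0, hC⟩ := exists_abs_generator_le ha hb hκ2 hκc
  have h1 : ∀ x ∈ K, κ x = 1 := fun x hx => hκ1.self_of_nhdsSet x hx
  have h0 : ∀ x ∉ U, κ x = 0 := fun x hx => image_eq_zero_of_notMem_tsupport fun h => hx (hκU h)
  refine ⟨8 * C, by positivity, fun t => ⟨fun x hx => ?_, fun x hx => ?_⟩⟩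
  · refine le_trans (measureReal_mono ?_)
      (hP.measure_exists_le_const ha hb hκ2 hκc hκ01 (Or.inr (h1 x hx)) hC t)
    rintro w ⟨s, hs, hw⟩
    exact ⟨s, hs, by rw [h0 _ hw, h1 x hx]; norm_num⟩
  · refine le_trans (measureReal_mono ?_)
      (hP.measure_exists_le_const ha hb hκ2 hκc hκ01 (Or.inl (h0 x hx)) hC t)
    rintro w ⟨s, hs, hw⟩
    exact ⟨s, hs, by rw [h0 _ hx, h1 _ hw]; norm_num⟩

theorem IsDiffusion.tendsto_inv_mul_integral_timeIntegral (hP : IsDiffusion a b P)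
    {h : Space d → ℝ} (hh : Continuous h) {C : ℝ} (hC : ∀ x, |h x| ≤ C) (x : Space d) :
    Tendsto (fun t : ℝ => t⁻¹ * ∫ w, timeIntegral h t w ∂(P x)) (𝓝[>] 0) (𝓝 (h x)) := by
  have := hP.isMarkovKernel
  have h1 : Tendsto (fun t : ℝ => ∫ w, t⁻¹ * timeIntegral h t w ∂(P x)) (𝓝[>] 0)
      (𝓝 (∫ _, h x ∂(P x))) := by
    refine tendsto_integral_filter_of_dominated_convergence (fun _ => C) ?_ ?_
      (integrable_const _) ?_
    · filter_upwards [self_mem_nhdsWithin] with t ht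
      exact ((measurable_timeIntegral hh (le_of_lt ht)).const_mul _).aestronglyMeasurable
    · filter_upwards [self_mem_nhdsWithin] with t ht
      have ht : 0 < t := ht
      refine Eventually.of_forall fun w => ?_
      rw [norm_mul, norm_inv, Real.norm_of_nonneg ht.le, inv_mul_le_iff₀ ht, mul_comm]
      exact abs_timeIntegral_le hC ht.le w
    · filter_upwards [hP.start x] with w hw
      have := tendsto_inv_mul_timeIntegral hh w
      rwa [hw] at this
  simp_rw [integral_const_mul] at h1
  simpa using h1

/-- The probability of leaving a neighbourhood of the starting point within time `t` is `o(t)`: a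
cutoff function `κ` which is constant near this point satisfies `L κ = 0` there. -/
theorem IsDiffusion.tendsto_inv_mul_measure_exit (hP : IsDiffusion a b P)
    (ha : ∀ i j, Continuous fun x => a x i j) (hb : Continuous b) {U : Set (Space d)}
    (hU : IsOpen U) {x : Space d} (hx : x ∈ U) :
    Tendsto (fun t : ℝ => t⁻¹ * (P x).real {w | ∃ s ≤ t.toNNReal, coord s w ∉ U}) (𝓝[>] 0)
      (𝓝 0) := by
  have := hP.isMarkovKernel
  obtain ⟨κ, hκ, hκc, hκU, hκ1, hκ01⟩ := exists_cutoff (isCompact_singleton (x := x)) hU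
    (singleton_subset_iff.mpr hx)
  have hκ2 : ContDiff ℝ 2 κ := contDiff_infty.mp hκ 2
  obtain ⟨C, hC0, hC⟩ := exists_abs_generator_le ha hb hκ2 hκc
  rw [nhdsSet_singleton] at hκ1
  have hκx : κ x = 1 := hκ1.self_of_nhds
  have h0 : ∀ x ∉ U, κ x = 0 := fun x hx => image_eq_zero_of_notMem_tsupport fun h => hx (hκU h)
  have hgen : generator a b κ x = 0 := by
    have : κ =ᶠ[𝓝 x] fun _ => 1 := hκ1
    rw [generator_congr this, generator_const]
  have hlim := (hP.tendsto_inv_mul_integral_timeIntegral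
    (continuous_generator ha hb hκ2).abs (C := C)
    (fun y => by rw [abs_abs]; exact hC y) x).const_mul 8
  rw [hgen, abs_zero, mul_zero] at hlim
  refine squeeze_zero' ?_ ?_ hlim
  · filter_upwards [self_mem_nhdsWithin] with t ht
    have ht : 0 < t := ht
    positivity
  · have hsmall : ∀ᶠ t : ℝ in 𝓝[>] 0, C * t < 1 / 2 := by
      have hc : Continuous fun t : ℝ => C * t := by fun_prop
      have := hc.tendsto 0
      rw [mul_zero] at this
      exact (this.eventually (Iio_mem_nhds (by norm_num))).filter_mono nhdsWithin_le_nhds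
    filter_upwards [self_mem_nhdsWithin, hsmall] with t ht htC
    have ht : 0 < t := ht
    have h1 := hP.measure_exists_le ha hb hκ2 hκc hκ01 (Or.inr hκx) hC (t := t.toNNReal)
      (by rw [Real.coe_toNNReal _ ht.le]; exact htC.le)
    rw [Real.coe_toNNReal _ ht.le] at h1
    have h2 : (P x).real {w | ∃ s ≤ t.toNNReal, coord s w ∉ U} ≤
        (P x).real {w | ∃ s ≤ t.toNNReal, |κ (coord s w) - κ x| = 1} := by
      refine measureReal_mono ?_
      rintro w ⟨s, hs, hw⟩
      exact ⟨s, hs, by rw [h0 _ hw, hκx]; norm_num⟩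
    calc t⁻¹ * (P x).real {w | ∃ s ≤ t.toNNReal, coord s w ∉ U} ≤ t⁻¹ * _ :=
          mul_le_mul_of_nonneg_left (h2.trans h1) (inv_pos.mpr ht).le
      _ = _ := by ring

/-- The difference of the expected values of two functions of `X_t` is controlled by the
probability that `X_t` lies where they differ. -/
theorem IsDiffusion.abs_integral_sub_integral_le (hP : IsDiffusion a b P) {f g : Space d → ℝ}
    (hf : Measurable f) (hg : Measurable g) {Cf Cg : ℝ} (hCf : ∀ x, |f x| ≤ Cf)
    (hCg : ∀ x, |g x| ≤ Cg) {E : Set (Space d)} (hE : MeasurableSet E)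
    (hfg : ∀ x ∉ E, f x = g x) (x : Space d) (t : ℝ≥0) :
    |∫ w, f (coord t w) ∂(P x) - ∫ w, g (coord t w) ∂(P x)| ≤
      (Cf + Cg) * (P x).real {w | ∃ s ≤ t, coord s w ∈ E} := by
  have := hP.isMarkovKernel
  have hif := integrable_comp_coord (μ := P x) hf hCf t
  have hig := integrable_comp_coord (μ := P x) hg hCg t
  have hC : 0 ≤ Cf + Cg := add_nonneg ((abs_nonneg _).trans (hCf 0)) ((abs_nonneg _).trans (hCg 0))
  have hEm : MeasurableSet (coord t ⁻¹' E) := measurable_coord t hE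
  rw [← integral_sub hif hig]
  refine abs_integral_le_integral_abs.trans ?_
  have h1 : ∫ w, |f (coord t w) - g (coord t w)| ∂(P x) ≤
      ∫ w, (coord t ⁻¹' E).indicator (fun _ => Cf + Cg) w ∂(P x) := by
    refine integral_mono (hif.sub hig).abs ((integrable_const _).indicator hEm) fun w => ?_
    by_cases hw : coord t w ∈ E
    · rw [indicator_of_mem (by exact hw)]
      exact (abs_sub _ _).trans (add_le_add (hCf _) (hCg _))
    · rw [indicator_of_notMem (by exact hw)]
      simp only [hfg _ hw, sub_self, abs_zero, le_refl]
  refine h1.trans ?_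
  rw [integral_indicator hEm, setIntegral_const, smul_eq_mul, mul_comm]
  refine mul_le_mul_of_nonneg_left (measureReal_mono ?_) hC
  exact fun w hw => ⟨t, le_rfl, hw⟩

/-- The generator as the derivative at time zero of the semigroup, for bounded functions which are
regular near the starting point only. -/
theorem IsDiffusion.tendsto_generator (hP : IsDiffusion a b P)
    (ha : ∀ i j, Continuous fun x => a x i j) (hb : Continuous b) {u : Space d → ℝ}
    (hu : Measurable u) {Cu : ℝ} (hCu : ∀ x, |u x| ≤ Cu) {U : Set (Space d)} (hU : IsOpen U)
    (hu2 : ContDiffOn ℝ 2 u U) {x : Space d} (hx : x ∈ U) :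
    Tendsto (fun t : ℝ => t⁻¹ * (∫ w, u (coord t.toNNReal w) ∂(P x) - u x)) (𝓝[>] 0)
      (𝓝 (generator a b u x)) := by
  have := hP.isMarkovKernel
  obtain ⟨κ, hκ, hκc, hκU, hκ1, hκ01⟩ := exists_cutoff (isCompact_singleton (x := x)) hU
    (singleton_subset_iff.mpr hx)
  rw [nhdsSet_singleton] at hκ1
  obtain ⟨V, hV1, hVo, hxV⟩ := _root_.eventually_nhds_iff.mp hκ1
  set g : Space d → ℝ := fun y => κ y * u y with hgdef
  have hgc : HasCompactSupport g := hκc.mul_right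
  have hg : ContDiff ℝ 2 g := by
    rw [contDiff_iff_contDiffAt]
    intro y
    by_cases hy : y ∈ U
    · exact ((contDiff_infty.mp hκ 2).contDiffAt).mul
        (hu2.contDiffAt (hU.mem_nhds hy))
    · have : g =ᶠ[𝓝 y] fun _ => 0 := by
        filter_upwards [(isClosed_tsupport κ).isOpen_compl.mem_nhds (fun h => hy (hκU h))] with z hz
        simp [hgdef, image_eq_zero_of_notMem_tsupport hz]
      exact contDiffAt_const.congr_of_eventuallyEq this
  have hgV : ∀ y ∈ V, u y = g y := fun y hy => by simp [hgdef, hV1 y hy]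
  obtain ⟨Cg, hCg⟩ := hgc.exists_bound_of_continuous hg.continuous
  obtain ⟨C, -, hC⟩ := exists_abs_generator_le ha hb hg hgc
  have hgen : generator a b u x = generator a b g x :=
    generator_congr (by filter_upwards [hVo.mem_nhds hxV] with y hy using hgV y hy)
  have h1 := hP.tendsto_inv_mul_integral_timeIntegral (continuous_generator ha hb hg) hC x
  have h2 := (hP.tendsto_inv_mul_measure_exit ha hb hVo hxV).const_mul (Cu + Cg)
  rw [mul_zero] at h2
  have h3 : Tendsto (fun t : ℝ => t⁻¹ * (∫ w, u (coord t.toNNReal w) ∂(P x) -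
      ∫ w, g (coord t.toNNReal w) ∂(P x))) (𝓝[>] 0) (𝓝 0) := by
    refine squeeze_zero_norm' ?_ h2
    filter_upwards [self_mem_nhdsWithin] with t ht
    have ht : 0 < t := ht
    have := hP.abs_integral_sub_integral_le hu hg.continuous.measurable hCu hCg
      hVo.isClosed_compl.measurableSet (fun y hy => hgV y (not_not.mp hy)) x t.toNNReal
    rw [norm_mul, norm_inv, Real.norm_of_nonneg ht.le]
    calc t⁻¹ * _ ≤ t⁻¹ * _ := mul_le_mul_of_nonneg_left this (inv_pos.mpr ht).le
      _ = _ := by simp only [mem_compl_iff]; ring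
  rw [hgen]
  have h4 := h1.add h3
  rw [add_zero] at h4
  refine h4.congr' ?_
  filter_upwards [self_mem_nhdsWithin] with t ht
  have ht : 0 < t := ht
  have hd := hP.integral_comp_coord_sub ha hb hg hgc x t.toNNReal
  rw [Real.coe_toNNReal _ ht.le] at hd
  rw [← hd, hgV x hxV]
  ring

end Diffusion

/-! ### Hitting times and the committor function -/

section Hitting

variable {d : ℕ}

/-- Hitting a closed set before time `r` is a measurable event: by compactness, it means that the
distance from the set comes arbitrarily close to zero along a countable set of times. -/
theorem measurableSet_exists_coord_mem {C : Set (Space d)} (hC : IsClosed C) (r : ℝ≥0) :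
    MeasurableSet {w : Path d | ∃ t ≤ r, coord t w ∈ C} := by
  set f : ℝ≥0 → Path d → ℝ≥0∞ := fun t w => infEDist (coord (min t r) w) C with hf
  have hfc : ∀ w, Continuous fun t => f t w := fun w =>
    continuous_infEDist.comp ((continuous_coord w).comp (continuous_id.min continuous_const))
  have hset : {w : Path d | ∃ t ≤ r, coord t w ∈ C} =
      {w | ⨅ n, f (TopologicalSpace.denseSeq ℝ≥0 n) w = 0} := by
    ext w
    simp only [mem_ofPred_eq]
    constructor
    · rintro ⟨t, htr, ht⟩
      refine le_antisymm (le_of_forall_gt fun ε hε => ?_) zero_le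
      have h0 : f t w = 0 := by
        simp only [hf, min_eq_left htr]
        exact infEDist_zero_of_mem ht
      have hopen : IsOpen {s | f s w < ε} := isOpen_lt (hfc w) continuous_const
      obtain ⟨_, hs, ⟨n, rfl⟩⟩ := (TopologicalSpace.denseRange_denseSeq ℝ≥0).inter_open_nonempty _
        hopen ⟨t, by simpa [h0] using hε⟩
      exact (iInf_le _ n).trans_lt hs
    · intro h
      obtain ⟨t, ht, hmin⟩ := (isCompact_Icc (a := (0 : ℝ≥0)) (b := r)).exists_isMinOn
        ⟨0, by simp⟩ (continuous_infEDist.comp (continuous_coord w)).continuousOn (s := Icc 0 r)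
        (f := fun t => infEDist (coord t w) C)
      refine ⟨t, ht.2, ?_⟩
      have h1 : infEDist (coord t w) C ≤ 0 := by
        rw [← h]
        refine le_iInf fun n => ?_
        exact hmin (show min _ r ∈ Icc 0 r from ⟨zero_le, min_le_right _ _⟩)
      rw [← hC.closure_eq, mem_closure_iff_infEDist_zero]
      exact le_antisymm h1 zero_le
  rw [hset]
  refine measurableSet_eq_fun (Measurable.iInf fun n => ?_) measurable_const
  exact continuous_infEDist.measurable.comp (measurable_coord _)

theorem measurable_hittingTime (D : Set (Space d)) :
    Measurable (hittingTime (d := d) D) := by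
  refine measurable_of_Iio fun c => ?_
  have : hittingTime (d := d) D ⁻¹' Iio c =
      ⋃ r : ℚ, {w | ((r : ℝ).toNNReal : ℝ≥0∞) < c ∧ ∃ t ≤ (r : ℝ).toNNReal, coord t w ∈ closure D} := by
    ext w
    simp only [mem_preimage, mem_Iio, hittingTime, iInf_lt_iff, mem_iUnion, mem_ofPred_eq]
    constructor
    · rintro ⟨t, ht, htc⟩
      obtain ⟨r, -, htr, hrc⟩ := ENNReal.lt_iff_exists_rat_btwn.mp htc
      exact ⟨r, hrc, t, (ENNReal.coe_lt_coe.mp htr).le, ht⟩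
    · rintro ⟨r, hrc, t, htr, ht⟩
      exact ⟨t, ht, lt_of_le_of_lt (by exact_mod_cast htr) hrc⟩
  rw [this]
  refine MeasurableSet.iUnion fun r => ?_
  by_cases h : ((r : ℝ).toNNReal : ℝ≥0∞) < c
  · simpa [h] using measurableSet_exists_coord_mem isClosed_closure (r : ℝ).toNNReal
  · simp [h]

theorem measurableSet_hittingTime_lt (A B : Set (Space d)) :
    MeasurableSet {w : Path d | hittingTime B w < hittingTime A w} :=
  measurableSet_lt (measurable_hittingTime B) (measurable_hittingTime A)

/-- A set which is not hit up to time `t` is hit by the shifted path `t` units of time earlier. -/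
theorem hittingTime_eq_add_shift {D : Set (Space d)} {w : Path d} {t : ℝ≥0}
    (h : ¬ ∃ s ≤ t, coord s w ∈ closure D) :
    hittingTime D w = t + hittingTime D (shift t w) := by
  refine le_antisymm ?_ ?_
  · rw [← tsub_le_iff_left]
    refine le_iInf₂ fun s hs => ?_
    rw [tsub_le_iff_left]
    have := iInf₂_le (f := fun (u : ℝ≥0) (_ : coord u w ∈ closure D) => (u : ℝ≥0∞)) (t + s) hs
    exact_mod_cast this
  · refine le_iInf₂ fun s hs => ?_
    have hts : t ≤ s := by
      by_contra hlt
      exact h ⟨s, (not_le.mp hlt).le, hs⟩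
    have h1 : coord (s - t) (shift t w) ∈ closure D := by
      change w.1 (t + (s - t)) ∈ closure D
      rw [add_tsub_cancel_of_le hts]
      exact hs
    have := iInf₂_le (f := fun (u : ℝ≥0) (_ : coord u (shift t w) ∈ closure D) => (u : ℝ≥0∞))
      (s - t) h1
    calc (t : ℝ≥0∞) + hittingTime D (shift t w) ≤ t + ((s - t : ℝ≥0) : ℝ≥0∞) := by
          gcongr
          exact this
      _ = s := by
          rw [← ENNReal.coe_add, add_tsub_cancel_of_le hts]

theorem measurable_shift (t : ℝ≥0) : Measurable (shift (d := d) t) :=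
  (measurable_pi_lambda _ fun s => measurable_coord (t + s)).subtype_mk

variable {a : Space d → Matrix (Fin d) (Fin d) ℝ} {b : Space d → Space d}
  {P : Kernel (Space d) (Path d)}

theorem measurable_committor (A B : Set (Space d)) : Measurable (committor P A B) :=
  (P.measurable_coe (measurableSet_hittingTime_lt A B)).ennreal_toReal

theorem committor_mem_Icc (hP : IsDiffusion a b P) (A B : Set (Space d)) (x : Space d) :
    committor P A B x ∈ Icc (0 : ℝ) 1 := by
  have := hP.isMarkovKernel
  exact ⟨measureReal_nonneg, measureReal_le_one⟩

theorem committor_eq_zero (hP : IsDiffusion a b P) {A B : Set (Space d)} {x : Space d}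
    (hx : x ∈ closure A) : committor P A B x = 0 := by
  have hnull : P x {w | hittingTime B w < hittingTime A w} = 0 := by
    refine measure_eq_zero_iff_ae_notMem.mpr ?_
    filter_upwards [hP.start x] with w hw hlt
    have h0 : hittingTime A w ≤ 0 := by
      have := iInf₂_le (f := fun (u : ℝ≥0) (_ : coord u w ∈ closure A) => (u : ℝ≥0∞)) 0
        (by rw [hw]; exact hx)
      rwa [ENNReal.coe_zero] at this
    exact absurd (hlt.trans_le h0) not_lt_zero
  simp [committor, measureReal_def, hnull]

theorem committor_eq_one (hP : IsDiffusion a b P) {A B : Set (Space d)}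
    (hAB : Disjoint (closure A) (closure B)) {x : Space d} (hx : x ∈ closure B) :
    committor P A B x = 1 := by
  have := hP.isMarkovKernel
  have hfull : ∀ᵐ w ∂(P x), w ∈ {w | hittingTime B w < hittingTime A w} := by
    filter_upwards [hP.start x] with w hw
    have h0 : hittingTime B w = 0 := by
      have := iInf₂_le (f := fun (u : ℝ≥0) (_ : coord u w ∈ closure B) => (u : ℝ≥0∞)) 0
        (by rw [hw]; exact hx)
      rw [ENNReal.coe_zero] at this
      exact le_antisymm this zero_le
    have hxA : coord 0 w ∈ (closure A)ᶜ := by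
      rw [hw]; exact fun h => (hAB.le_bot ⟨h, hx⟩).elim
    -- by continuity, it takes a positive time to reach `A`
    have hev : ∀ᶠ t in 𝓝 (0 : ℝ≥0), coord t w ∈ (closure A)ᶜ :=
      (continuous_coord w).continuousAt.eventually (isClosed_closure.isOpen_compl.mem_nhds hxA)
    obtain ⟨δ, hδ, hball⟩ := Metric.eventually_nhds_iff.mp hev
    lift δ to ℝ≥0 using hδ.le
    have hle : (δ : ℝ≥0∞) ≤ hittingTime A w := by
      refine le_iInf₂ fun s hs => ?_
      by_contra hlt
      refine hball (y := s) ?_ hs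
      rw [NNReal.dist_eq, NNReal.coe_zero, sub_zero, abs_of_nonneg (NNReal.coe_nonneg s)]
      have h1 : s < δ := by exact_mod_cast not_le.mp hlt
      exact h1
    have hlt : hittingTime B w < hittingTime A w := by
      rw [h0]
      refine lt_of_lt_of_le ?_ hle
      have h1 : (0 : ℝ) < δ := hδ
      exact_mod_cast h1
    exact hlt
  rw [committor, measureReal_def, prob_compl_eq_zero_iff (measurableSet_hittingTime_lt A B) |>.mp
    (mem_ae_iff.mp hfull)]
  simp

/-- By the Markov property, the expected value of the committor function changes by at most the
probability of hitting one of the two sets. -/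
theorem IsDiffusion.abs_integral_committor_sub_le (hP : IsDiffusion a b P) (A B : Set (Space d))
    (x : Space d) (t : ℝ≥0) :
    |∫ w, committor P A B (coord t w) ∂(P x) - committor P A B x| ≤
      (P x).real {w | ∃ s ≤ t, coord s w ∈ closure A ∪ closure B} := by
  have := hP.isMarkovKernel
  set S : Set (Path d) := {w | hittingTime B w < hittingTime A w} with hS
  have hSm : MeasurableSet S := measurableSet_hittingTime_lt A B
  have hpre : MeasurableSet (shift t ⁻¹' S) := measurable_shift t hSm
  have h1 : ∫ w, committor P A B (coord t w) ∂(P x) = (P x).real (shift t ⁻¹' S) := by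
    have hM := hP.markov x t univ MeasurableSet.univ S hSm
    rw [univ_inter, Measure.restrict_univ] at hM
    rw [measureReal_def, hM]
    exact integral_toReal ((P.measurable_coe hSm).comp (measurable_coord t)).aemeasurable
      (Eventually.of_forall fun w => measure_lt_top _ _)
  set H : Set (Path d) := {w | ∃ s ≤ t, coord s w ∈ closure A ∪ closure B} with hH
  have hiff : ∀ w ∉ H, w ∈ shift t ⁻¹' S ↔ w ∈ S := fun w hw => by
    have hA : ¬ ∃ s ≤ t, coord s w ∈ closure A := fun ⟨s, hs, h⟩ => hw ⟨s, hs, Or.inl h⟩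
    have hB : ¬ ∃ s ≤ t, coord s w ∈ closure B := fun ⟨s, hs, h⟩ => hw ⟨s, hs, Or.inr h⟩
    simp only [hS, mem_preimage, mem_ofPred_eq]
    rw [hittingTime_eq_add_shift hA, hittingTime_eq_add_shift hB]
    exact (ENNReal.add_lt_add_iff_left ENNReal.coe_ne_top).symm
  rw [h1, committor, abs_le]
  have e1 : (P x).real S ≤ (P x).real (shift t ⁻¹' S) + (P x).real H := by
    refine (measureReal_mono ?_).trans (measureReal_union_le _ _)
    intro w hw
    by_cases h : w ∈ H
    · exact Or.inr h
    · exact Or.inl ((hiff w h).mpr hw)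
  have e2 : (P x).real (shift t ⁻¹' S) ≤ (P x).real S + (P x).real H := by
    refine (measureReal_mono ?_).trans (measureReal_union_le _ _)
    intro w hw
    by_cases h : w ∈ H
    · exact Or.inr h
    · exact Or.inl ((hiff w h).mp hw)
  constructor <;> linarith

theorem region_eq (A B : Set (Space d)) : region A B = (closure A ∪ closure B)ᶜ := by
  rw [region, closure_union]

theorem isOpen_region (A B : Set (Space d)) : IsOpen (region A B) :=
  isClosed_closure.isOpen_compl

/-- The committor equation. By the Markov property `E_x q(X_t) - q(x)` is `o(t)`, and `L q(x)` is the
limit of the difference quotient. -/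
theorem IsDiffusion.generator_committor_eq_zero (hP : IsDiffusion a b P)
    (ha : ∀ i j, Continuous fun x => a x i j) (hb : Continuous b) {A B : Set (Space d)}
    (hq : ContDiffOn ℝ 2 (committor P A B) (region A B)) {x : Space d} (hx : x ∈ region A B) :
    generator a b (committor P A B) x = 0 := by
  have hlim := hP.tendsto_generator ha hb (measurable_committor A B) (Cu := 1)
    (fun y => by
      have := committor_mem_Icc hP A B y
      rw [abs_of_nonneg this.1]; exact this.2) (isOpen_region A B) hq hx
  refine tendsto_nhds_unique hlim ?_
  refine squeeze_zero_norm' ?_ (hP.tendsto_inv_mul_measure_exit ha hb (isOpen_region A B) hx)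
  filter_upwards [self_mem_nhdsWithin] with t ht
  have ht : 0 < t := ht
  rw [norm_mul, norm_inv, Real.norm_of_nonneg ht.le]
  refine mul_le_mul_of_nonneg_left ?_ (inv_pos.mpr ht).le
  refine (hP.abs_integral_committor_sub_le A B x t.toNNReal).trans (le_of_eq ?_)
  simp only [region_eq, notMem_compl_iff]

/-! ### Stationarity -/

theorem integral_integral_comp_coord {ρ : Space d → ℝ} (hP : IsDiffusion a b P)
    (hρ : IsInvariantDensity P ρ) {f : Space d → ℝ} (hf : Measurable f) {C : ℝ}
    (hC : ∀ x, |f x| ≤ C) (t : ℝ≥0) :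
    ∫ x, ∫ w, f (coord t w) ∂(P x) ∂(densityMeasure ρ) = ∫ x, f x ∂(densityMeasure ρ) := by
  have := hP.isMarkovKernel
  have := hρ.1
  have hinv := (hρ.2 t).def
  have hκ : ((P.map (coord t)) ∘ₖ (Kernel.const Unit (densityMeasure ρ))) () = densityMeasure ρ := by
    rw [Kernel.comp_apply, Kernel.const_apply]
    exact hinv
  have hi : Integrable f (densityMeasure ρ) :=
    Integrable.of_bound hf.aestronglyMeasurable C (Eventually.of_forall hC)
  have h := Kernel.integral_comp (κ := Kernel.const Unit (densityMeasure ρ))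
    (η := P.map (coord t)) (a := ()) (f := f) (by rw [hκ]; exact hi)
  rw [hκ, Kernel.const_apply] at h
  rw [h]
  refine integral_congr_ae (Eventually.of_forall fun x => ?_)
  simp only
  rw [Kernel.map_apply _ (measurable_coord t), integral_map (measurable_coord t).aemeasurable
    hf.aestronglyMeasurable]

/-- Stationarity in infinitesimal form, `∫ ρ L u = 0`, for bounded functions `u` of class `C²` which
agree with the committor function away from a compact set. Such a function need not be in the
domain covered by the martingale problem; the point is that `P_t u - u = O(t)` uniformly: near the
compact set because `u` may be cut off, and away from it because `P_t q - q` is controlled by the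
probability of hitting the two sets. -/
theorem IsDiffusion.integral_generator_eq_zero {ρ : Space d → ℝ} (hP : IsDiffusion a b P)
    (ha : ∀ i j, Continuous fun x => a x i j) (hb : Continuous b)
    (hρm : Measurable ρ) (hρ0 : ∀ x, 0 ≤ ρ x) (hρ : IsInvariantDensity P ρ)
    {A B : Set (Space d)} {R : ℝ} (hAR : closure A ⊆ closedBall 0 R)
    (hBR : closure B ⊆ closedBall 0 R) {u : Space d → ℝ} (hu : ContDiff ℝ 2 u) {Cu : ℝ}
    (hCu : ∀ x, |u x| ≤ Cu) (huq : ∀ x ∉ closedBall (0 : Space d) R, u x = committor P A B x) :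
    ∫ x, ρ x * generator a b u x = 0 := by
  have := hP.isMarkovKernel
  have := hρ.1
  set q := committor P A B with hq
  have hq1 : ∀ x, |q x| ≤ 1 := fun y => by
    have := committor_mem_Icc hP A B y
    rw [abs_of_nonneg this.1]; exact this.2
  have hum := hu.continuous.measurable
  have hqm : Measurable q := measurable_committor A B
  have hbb : ∀ r s : ℝ, r < s → closedBall (0 : Space d) r ⊆ ball 0 s := fun r s h =>
    closedBall_subset_ball h
  have hCu0 : 0 ≤ Cu := (abs_nonneg _).trans (hCu 0)
  obtain ⟨C₁, hC₁0, hC₁⟩ := hP.exists_measure_cross_le ha hb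
    (isCompact_closedBall (0 : Space d) R) (isOpen_ball (x := (0 : Space d)) (ε := R + 1))
    (hbb _ _ (by linarith))
  obtain ⟨C₂, hC₂0, hC₂⟩ := hP.exists_measure_cross_le ha hb
    (isCompact_closedBall (0 : Space d) (R + 1)) (isOpen_ball (x := (0 : Space d)) (ε := R + 2))
    (hbb _ _ (by linarith))
  obtain ⟨κ, hκ, hκc, -, hκ1, hκ01⟩ := exists_cutoff (isCompact_closedBall (0 : Space d) (R + 2))
    isOpen_univ (subset_univ _)
  set g : Space d → ℝ := fun x => κ x * u x with hg
  have hg2 : ContDiff ℝ 2 g := (contDiff_infty.mp hκ 2).mul hu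
  have hgc : HasCompactSupport g := hκc.mul_right
  have hgu : ∀ x ∈ closedBall (0 : Space d) (R + 2), g x = u x := fun x hx => by
    simp [hg, hκ1.self_of_nhdsSet x hx]
  obtain ⟨Cg, hCg⟩ := hgc.exists_bound_of_continuous hg2.continuous
  obtain ⟨C₃, hC₃0, hC₃⟩ := exists_abs_generator_le ha hb hg2 hgc
  have hCg0 : 0 ≤ Cg := (norm_nonneg _).trans (hCg 0)
  set C := (1 + (Cu + 1)) * C₁ + (C₃ + (Cu + Cg) * C₂) with hC
  -- near the compact set compare `u` with its truncation `g`, elsewhere with `q`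
  have hbound : ∀ (t : ℝ≥0) (x : Space d),
      |∫ w, u (coord t w) ∂(P x) - u x| ≤ C * t := by
    intro t x
    have ht0 : (0 : ℝ) ≤ t := t.2
    by_cases hx : x ∈ closedBall (0 : Space d) (R + 1)
    · have h1 := hP.abs_integral_sub_integral_le hum hg2.continuous.measurable hCu hCg
        (isOpen_ball (x := (0 : Space d)) (ε := R + 2)).isClosed_compl.measurableSet
        (fun y hy => (hgu y (ball_subset_closedBall (not_not.mp hy))).symm) x t
      have h2 := (hC₂ t).1 x hx
      have h3 := hP.integral_comp_coord_sub ha hb hg2 hgc x t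
      have h4 : |∫ w, timeIntegral (generator a b g) t w ∂(P x)| ≤ C₃ * t := by
        have := norm_integral_le_of_norm_le_const (μ := P x) (f := timeIntegral (generator a b g) t)
          (C := C₃ * t) (Eventually.of_forall fun w => abs_timeIntegral_le hC₃ t.2 w)
        simpa using this
      rw [← h3, hgu x (closedBall_subset_closedBall (by linarith) hx)] at h4
      simp only [mem_compl_iff] at h1
      have h5 : |∫ w, u (coord t w) ∂(P x) - u x| ≤ (Cu + Cg) * (C₂ * t) + C₃ * t := by
        have h6 := mul_le_mul_of_nonneg_left h2 (add_nonneg hCu0 hCg0)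
        calc |∫ w, u (coord t w) ∂(P x) - u x|
            = |(∫ w, u (coord t w) ∂(P x) - ∫ w, g (coord t w) ∂(P x)) +
              (∫ w, g (coord t w) ∂(P x) - u x)| := by ring_nf
          _ ≤ _ := (abs_add_le _ _).trans (add_le_add (h1.trans h6) h4)
      refine h5.trans ?_
      have h7 : 0 ≤ (1 + (Cu + 1)) * C₁ * t := by positivity
      calc (Cu + Cg) * (C₂ * t) + C₃ * t ≤
          (1 + (Cu + 1)) * C₁ * t + ((Cu + Cg) * (C₂ * t) + C₃ * t) := by linarith
        _ = C * t := by rw [hC]; ring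
    · have hxb : x ∉ ball (0 : Space d) (R + 1) := fun h => hx (ball_subset_closedBall h)
      have hxR : x ∉ closedBall (0 : Space d) R := fun h =>
        hx (closedBall_subset_closedBall (by linarith) h)
      have h1 := hP.abs_integral_sub_integral_le hum hqm hCu hq1
        (isClosed_closedBall (x := (0 : Space d)) (ε := R)).measurableSet huq x t
      have h2 := (hC₁ t).2 x hxb
      have h3 := hP.abs_integral_committor_sub_le A B x t
      have h4 : (P x).real {w | ∃ s ≤ t, coord s w ∈ closure A ∪ closure B} ≤ C₁ * t := by
        refine (measureReal_mono ?_).trans h2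
        rintro w ⟨s, hs, hw⟩
        exact ⟨s, hs, hw.elim (fun h => hAR h) fun h => hBR h⟩
      rw [huq x hxR]
      have h6 := mul_le_mul_of_nonneg_left h2 (show 0 ≤ Cu + 1 by positivity)
      have h5 : |∫ w, u (coord t w) ∂(P x) - q x| ≤ (Cu + 1) * (C₁ * t) + C₁ * t := by
        calc |∫ w, u (coord t w) ∂(P x) - q x|
            = |(∫ w, u (coord t w) ∂(P x) - ∫ w, q (coord t w) ∂(P x)) +
              (∫ w, q (coord t w) ∂(P x) - q x)| := by ring_nf
          _ ≤ _ := (abs_add_le _ _).trans (add_le_add (h1.trans h6) (h3.trans h4))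
      refine h5.trans ?_
      have h7 : 0 ≤ (C₃ + (Cu + Cg) * C₂) * t := by positivity
      calc (Cu + 1) * (C₁ * t) + C₁ * t ≤
          (Cu + 1) * (C₁ * t) + C₁ * t + (C₃ + (Cu + Cg) * C₂) * t := by linarith
        _ = C * t := by rw [hC]; ring
  have hTm : ∀ t : ℝ≥0, StronglyMeasurable fun x => ∫ w, u (coord t w) ∂(P x) := fun t =>
    StronglyMeasurable.integral_kernel
      (hum.comp (measurable_coord t)).stronglyMeasurable
  have hzero : ∀ t : ℝ≥0, ∫ x, (∫ w, u (coord t w) ∂(P x) - u x) ∂(densityMeasure ρ) = 0 := by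
    intro t
    have hi1 : Integrable (fun x => ∫ w, u (coord t w) ∂(P x)) (densityMeasure ρ) := by
      refine Integrable.of_bound (hTm t).aestronglyMeasurable Cu (Eventually.of_forall fun x => ?_)
      have := norm_integral_le_of_norm_le_const (μ := P x) (f := fun w => u (coord t w))
        (C := Cu) (Eventually.of_forall fun w => hCu _)
      simpa using this
    have hi2 : Integrable u (densityMeasure ρ) :=
      Integrable.of_bound hum.aestronglyMeasurable Cu (Eventually.of_forall hCu)
    rw [integral_sub hi1 hi2, integral_integral_comp_coord hP hρ hum hCu, sub_self]
  have hlim : Tendsto (fun t : ℝ => ∫ x, t⁻¹ * (∫ w, u (coord t.toNNReal w) ∂(P x) - u x)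
      ∂(densityMeasure ρ)) (𝓝[>] 0) (𝓝 (∫ x, generator a b u x ∂(densityMeasure ρ))) := by
    refine tendsto_integral_filter_of_dominated_convergence (fun _ => C) ?_ ?_
      (integrable_const _) ?_
    · exact Eventually.of_forall fun t =>
        (((hTm t.toNNReal).sub hum.stronglyMeasurable).const_mul _).aestronglyMeasurable
    · filter_upwards [self_mem_nhdsWithin] with t ht
      have ht : 0 < t := ht
      refine Eventually.of_forall fun x => ?_
      rw [norm_mul, norm_inv, Real.norm_of_nonneg ht.le, inv_mul_le_iff₀ ht, mul_comm]
      have := hbound t.toNNReal x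
      rwa [Real.coe_toNNReal _ ht.le] at this
    · exact Eventually.of_forall fun x =>
        hP.tendsto_generator ha hb hum hCu isOpen_univ hu.contDiffOn (mem_univ x)
  simp_rw [integral_const_mul, hzero, mul_zero] at hlim
  have h0 := tendsto_nhds_unique hlim tendsto_const_nhds
  rw [densityMeasure, integral_withDensity_eq_integral_toReal_smul
    hρm.ennreal_ofReal (Eventually.of_forall fun x => ENNReal.ofReal_lt_top)] at h0
  simp_rw [ENNReal.toReal_ofReal (hρ0 _), smul_eq_mul] at h0
  exact h0

end Hitting

/-! ### The boundary of the region between `A` and `B` -/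

section Boundary

variable {d : ℕ}

theorem IsDefiningFunction.fderiv_ne_zero {D : Set (Space d)} {x : Space d} {φ : Space d → ℝ}
    (h : IsDefiningFunction D x φ) : ∀ᶠ y in 𝓝 x, fderiv ℝ φ y ≠ 0 := by
  have h0 : fderiv ℝ φ x ≠ 0 := fun h0 => h.2.1 (by simp [gradient, h0])
  exact (h.1.continuous_fderiv (by simp)).continuousAt.eventually_ne h0

/-- Near a boundary point, the closure of `D` is the sublevel set `{φ ≤ 0}`: a point with `φ = 0`
outside the closure would be a local minimum of `φ`, hence a critical point. -/
theorem IsDefiningFunction.mem_closure_iff {D : Set (Space d)} {x : Space d} {φ : Space d → ℝ}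
    (h : IsDefiningFunction D x φ) : ∀ᶠ y in 𝓝 x, y ∈ closure D ↔ φ y ≤ 0 := by
  have hne := h.fderiv_ne_zero
  obtain ⟨hφ, -, U, hU, hxU, hDU⟩ := h
  have hc := hφ.continuous
  filter_upwards [hne, hU.mem_nhds hxU] with y hy hyU
  constructor
  · intro hcl
    by_contra hpos
    obtain ⟨z, ⟨hzφ, hzU⟩, hzD⟩ := _root_.mem_closure_iff.mp hcl ({z | 0 < φ z} ∩ U)
      ((isOpen_lt continuous_const hc).inter hU) ⟨not_le.mp hpos, hyU⟩
    have h1 : φ z < 0 := (hDU.subset ⟨hzD, hzU⟩).1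
    have h2 : 0 < φ z := hzφ
    linarith
  · intro hle
    by_contra hcl
    have hD : y ∉ D := fun h => hcl (subset_closure h)
    have h0 : φ y = 0 := le_antisymm hle (not_lt.mp fun hlt => hD (hDU.superset ⟨hlt, hyU⟩).1)
    refine hy (IsLocalMin.fderiv_eq_zero ?_)
    filter_upwards [hU.mem_nhds hyU, isClosed_closure.isOpen_compl.mem_nhds hcl] with z hzU hz
    rw [h0]
    exact not_lt.mp fun hlt => hz (subset_closure (hDU.superset ⟨hlt, hzU⟩).1)

theorem IsDefiningFunction.eq_zero {D : Set (Space d)} {x : Space d} {φ : Space d → ℝ}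
    (h : IsDefiningFunction D x φ) (hD : IsOpen D) (hx : x ∈ frontier D) : φ x = 0 := by
  rw [hD.frontier_eq] at hx
  refine le_antisymm (h.mem_closure_iff.self_of_nhds.mp hx.1) (not_lt.mp fun hlt => hx.2 ?_)
  obtain ⟨-, -, U, -, hxU, hDU⟩ := h
  exact (hDU.superset ⟨hlt, hxU⟩).1

theorem HasSmoothBoundary.frontier_compl_closure {D : Set (Space d)} (hD : IsOpen D)
    (hDs : HasSmoothBoundary D) : frontier (closure D)ᶜ = frontier D := by
  rw [frontier_compl]
  refine Subset.antisymm frontier_closure_subset fun x hx => ?_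
  obtain ⟨φ, hφ⟩ := hDs x hx
  rw [isClosed_closure.frontier_eq]
  refine ⟨frontier_subset_closure hx, fun hint => hφ.fderiv_ne_zero.self_of_nhds ?_⟩
  refine IsLocalMax.fderiv_eq_zero ?_
  filter_upwards [hφ.mem_closure_iff, mem_interior_iff_mem_nhds.mp hint] with y hy hyD
  rw [hφ.eq_zero hD hx]
  exact hy.mp hyD

theorem HasSmoothBoundary.compl_closure {D : Set (Space d)} (hD : IsOpen D)
    (hDs : HasSmoothBoundary D) : HasSmoothBoundary (closure D)ᶜ := by
  intro x hx
  rw [hDs.frontier_compl_closure hD] at hx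
  obtain ⟨φ, hφ⟩ := hDs x hx
  obtain ⟨V, hV, hVo, hxV⟩ := _root_.eventually_nhds_iff.mp hφ.mem_closure_iff
  refine ⟨fun y => -φ y, hφ.1.neg, ?_, V, hVo, hxV, ?_⟩
  · have h : gradient (fun y => -φ y) x = -gradient φ x := by
      simp only [gradient, fderiv_fun_neg, map_neg]
    rw [h]
    exact neg_ne_zero.mpr hφ.2.1
  · ext y
    simp only [mem_inter_iff, mem_compl_iff, mem_ofPred_eq]
    refine and_congr_left fun hy => ?_
    rw [hV y hy, neg_lt_zero, not_le]

theorem frontier_union_of_disjoint {A B : Set (Space d)} (hA : IsOpen A) (hB : IsOpen B)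
    (hAB : Disjoint (closure A) (closure B)) : frontier (A ∪ B) = frontier A ∪ frontier B := by
  rw [(hA.union hB).frontier_eq, hA.frontier_eq, hB.frontier_eq, closure_union]
  ext x
  have h1 : x ∈ closure A → x ∉ B := fun h hB => hAB.notMem_of_mem_left h (subset_closure hB)
  have h2 : x ∈ closure B → x ∉ A := fun h hA => hAB.notMem_of_mem_right h (subset_closure hA)
  simp only [Set.mem_sdiff, mem_union]
  tauto

theorem HasSmoothBoundary.union {A B : Set (Space d)} (hA : IsOpen A) (hB : IsOpen B)
    (hAB : Disjoint (closure A) (closure B)) (hAs : HasSmoothBoundary A)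
    (hBs : HasSmoothBoundary B) : HasSmoothBoundary (A ∪ B) := by
  have key : ∀ {S T : Set (Space d)} {x : Space d}, Disjoint (closure S) (closure T) →
      HasSmoothBoundary S → x ∈ frontier S → ∃ φ, IsDefiningFunction (S ∪ T) x φ := by
    intro S T x hST hS hx
    obtain ⟨φ, hφ, hg, U, hU, hxU, hSU⟩ := hS x hx
    refine ⟨φ, hφ, hg, U ∩ (closure T)ᶜ, hU.inter isClosed_closure.isOpen_compl,
      ⟨hxU, hST.notMem_of_mem_left (frontier_subset_closure hx)⟩, ?_⟩
    rw [← inter_assoc, ← inter_assoc, ← hSU, union_inter_distrib_right, union_inter_distrib_right]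
    refine union_eq_left.mpr ?_
    rintro y ⟨⟨hyT, -⟩, hy⟩
    exact absurd (subset_closure hyT) hy
  intro x hx
  rw [frontier_union_of_disjoint hA hB hAB] at hx
  rcases hx with hx | hx
  · exact key hAB hAs hx
  · rw [union_comm]; exact key hAB.symm hBs hx

end Boundary

/-! ### Green's formula for the generator -/

section Green

variable {d : ℕ} {a : Space d → Matrix (Fin d) (Fin d) ℝ} {b : Space d → Space d}

theorem pderiv_mul {f g : Space d → ℝ} {x : Space d} (i : Fin d) (hf : DifferentiableAt ℝ f x)
    (hg : DifferentiableAt ℝ g x) :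
    pderiv i (fun y => f y * g y) x = f x * pderiv i g x + pderiv i f x * g x := by
  simp only [pderiv, fderiv_fun_mul hf hg, add_apply,
    smul_apply, smul_eq_mul]
  ring

theorem pderiv_sub {f g : Space d → ℝ} {x : Space d} (i : Fin d) (hf : DifferentiableAt ℝ f x)
    (hg : DifferentiableAt ℝ g x) :
    pderiv i (fun y => f y - g y) x = pderiv i f x - pderiv i g x := by
  simp only [pderiv, fderiv_fun_sub hf hg, sub_apply]

theorem pderiv_sum {f : Fin d → Space d → ℝ} {x : Space d} (i : Fin d)
    (hf : ∀ j, DifferentiableAt ℝ (f j) x) :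
    pderiv i (fun y => ∑ j, f j y) x = ∑ j, pderiv i (f j) x := by
  simp only [pderiv, fderiv_fun_sum fun j _ => hf j, sum_apply]

/-- The current `∑_j ∂_j (a_ij ρ) - b_i ρ`, whose divergence is `L* ρ`. -/
noncomputable def adjointCurrent (a : Space d → Matrix (Fin d) (Fin d) ℝ) (b : Space d → Space d)
    (ρ : Space d → ℝ) (x : Space d) : Space d :=
  WithLp.toLp 2 fun i => (∑ j, pderiv j (fun y => a y i j * ρ y) x) - b x i * ρ x

theorem toEuclideanLin_apply_apply (M : Matrix (Fin d) (Fin d) ℝ) (v : Space d) (i : Fin d) :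
    Matrix.toEuclideanLin M v i = ∑ j, M i j * v j := by
  simp [Matrix.toLpLin_apply, Matrix.mulVec, dotProduct]

theorem gradient_apply (w : Space d → ℝ) (x : Space d) (i : Fin d) :
    gradient w x i = pderiv i w x := by
  have h : inner ℝ (gradient w x) (EuclideanSpace.single i (1 : ℝ)) = pderiv i w x := by
    simp [gradient, pderiv, InnerProductSpace.toDual_symm_apply]
  rw [← h, EuclideanSpace.inner_single_right]
  simp

variable {ρ : Space d → ℝ}

theorem contDiff_adjointCurrent (ha : ∀ i j, ContDiff ℝ 2 fun x => a x i j)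
    (hb : ContDiff ℝ 1 b) (hρ : ContDiff ℝ 2 ρ) : ContDiff ℝ 1 (adjointCurrent a b ρ) := by
  rw [contDiff_euclidean]
  intro i
  simp only [adjointCurrent]
  refine ContDiff.sub (ContDiff.sum fun j _ => contDiff_pderiv ((ha i j).mul hρ) (by norm_num) j) ?_
  exact (contDiff_euclidean.mp hb i).mul (hρ.of_le (by norm_num))

/-- The pointwise form of Green's formula. Symmetry of `a` makes the two families of products of
first derivatives cancel. -/
theorem divergence_green (ha : ∀ i j, ContDiff ℝ 2 fun x => a x i j)
    (hsymm : ∀ x i j, a x i j = a x j i) (hb : ContDiff ℝ 1 b) (hρ : ContDiff ℝ 2 ρ)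
    {w : Space d → ℝ} {x : Space d} (hw : ContDiffAt ℝ 2 w x) :
    divergence (fun y => ρ y • Matrix.toEuclideanLin (a y) (gradient w y) -
        w y • adjointCurrent a b ρ y) x =
      ρ x * generator a b w x - w x * adjointGenerator a b ρ x := by
  have hw1 : DifferentiableAt ℝ w x := hw.differentiableAt (by norm_num)
  have hdw : ∀ j, DifferentiableAt ℝ (pderiv j w) x := fun j => by
    have h : ContDiffAt ℝ 1 (fderiv ℝ w) x := hw.fderiv_right (by norm_num)
    exact (h.differentiableAt (by norm_num)).clm_apply (differentiableAt_const _)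
  have hc : ∀ i j, ContDiff ℝ 2 fun y => a y i j * ρ y := fun i j => (ha i j).mul hρ
  have hcd : ∀ i j, DifferentiableAt ℝ (fun y => a y i j * ρ y) x := fun i j =>
    (hc i j).differentiable (by norm_num) x
  have hpc : ∀ i j, DifferentiableAt ℝ (pderiv j fun y => a y i j * ρ y) x := fun i j =>
    (contDiff_pderiv (k := 1) (hc i j) (by norm_num) j).differentiable (by norm_num) x
  have hbd : ∀ i, DifferentiableAt ℝ (fun y => b y i * ρ y) x := fun i =>
    (((contDiff_euclidean.mp hb i).mul (hρ.of_le (by norm_num))).differentiable (by norm_num)) x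
  have hcoord : ∀ i, (fun y => (ρ y • Matrix.toEuclideanLin (a y) (gradient w y) -
      w y • adjointCurrent a b ρ y) i) = fun y => (∑ j, a y i j * ρ y * pderiv j w y) -
        w y * ((∑ j, pderiv j (fun y => a y i j * ρ y) y) - b y i * ρ y) := by
    intro i
    funext y
    simp only [PiLp.sub_apply, PiLp.smul_apply, smul_eq_mul, toEuclideanLin_apply_apply,
      gradient_apply, adjointCurrent, Finset.mul_sum]
    congr 1
    exact Finset.sum_congr rfl fun j _ => by ring
  have hi : ∀ i, pderiv i (fun y => (ρ y • Matrix.toEuclideanLin (a y) (gradient w y) -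
      w y • adjointCurrent a b ρ y) i) x =
      (∑ j, (a x i j * ρ x * pderiv i (pderiv j w) x +
        pderiv i (fun y => a y i j * ρ y) x * pderiv j w x)) -
      (w x * ((∑ j, pderiv i (pderiv j fun y => a y i j * ρ y) x) -
          pderiv i (fun y => b y i * ρ y) x) +
        pderiv i w x * ((∑ j, pderiv j (fun y => a y i j * ρ y) x) - b x i * ρ x)) := by
    intro i
    have hs : DifferentiableAt ℝ (fun y => ∑ j, pderiv j (fun y => a y i j * ρ y) y) x :=
      DifferentiableAt.fun_sum fun j _ => hpc i j
    have hs' : ∀ j, DifferentiableAt ℝ (fun y => a y i j * ρ y * pderiv j w y) x := fun j =>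
      (hcd i j).mul (hdw j)
    rw [hcoord, pderiv_sub i (DifferentiableAt.fun_sum fun j _ => hs' j)
      (hw1.fun_mul (hs.fun_sub (hbd i))), pderiv_sum i hs', pderiv_mul i hw1 (hs.fun_sub (hbd i)),
      pderiv_sub i hs (hbd i), pderiv_sum i (hpc i)]
    congr 1
    exact Finset.sum_congr rfl fun j _ => pderiv_mul i (hcd i j) (hdw j)
  have hswap : ∑ i, ∑ j, pderiv i (fun y => a y i j * ρ y) x * pderiv j w x =
      ∑ i, ∑ j, pderiv i w x * pderiv j (fun y => a y i j * ρ y) x := by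
    rw [Finset.sum_comm]
    refine Finset.sum_congr rfl fun i _ => Finset.sum_congr rfl fun j _ => ?_
    simp only [hsymm _ j i]
    ring
  simp only [divergence, hi, Finset.sum_sub_distrib, Finset.sum_add_distrib, hswap, mul_sub,
    Finset.mul_sum, generator, adjointGenerator, mul_add]
  have e1 : ∀ i j, a x i j * ρ x * pderiv i (pderiv j w) x =
      ρ x * (a x i j * pderiv i (pderiv j w) x) := fun i j => by ring
  have e2 : ∀ i, pderiv i w x * (b x i * ρ x) = ρ x * (b x i * pderiv i w x) := fun i => by ring
  simp only [e1, e2]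
  ring

theorem gradientWithin_eq_of_mem_isOpen {Θ : Set (Space d)} (hΘ : IsOpen Θ) {w : Space d → ℝ}
    {x : Space d} (hx : x ∈ Θ) : gradientWithin w (closure Θ) x = gradient w x := by
  rw [gradientWithin, gradient,
    fderivWithin_of_mem_nhds (mem_of_superset (hΘ.mem_nhds hx) subset_closure)]

theorem continuousOn_toEuclideanLin {C : Set (Space d)} {v : Space d → Space d}
    (ha : ∀ i j, Continuous fun x => a x i j) (hv : ContinuousOn v C) :
    ContinuousOn (fun x => Matrix.toEuclideanLin (a x) (v x)) C := by
  have h : ContinuousOn (fun x => WithLp.ofLp (Matrix.toEuclideanLin (a x) (v x))) C := by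
    refine continuousOn_pi.mpr fun i => ?_
    simp only [toEuclideanLin_apply_apply]
    refine continuousOn_finsetSum _ fun j _ => (ha i j).continuousOn.mul ?_
    exact (EuclideanSpace.proj (𝕜 := ℝ) j).continuous.comp_continuousOn hv
  exact (PiLp.continuous_toLp 2 _).comp_continuousOn h

theorem continuousOn_gradientWithin {C : Set (Space d)} (hC : UniqueDiffOn ℝ C) {w : Space d → ℝ}
    (hw : ContDiffOn ℝ 1 w C) : ContinuousOn (gradientWithin w C) C :=
  (InnerProductSpace.toDual ℝ (Space d)).symm.continuous.comp_continuousOn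
    (hw.continuousOn_fderivWithin hC (by norm_num))

theorem continuousOn_flux {Θ : Set (Space d)} (hΘ : IsOpen Θ) (hΘs : HasSmoothBoundary Θ)
    (ha : ∀ i j, Continuous fun x => a x i j) (hρ : Continuous ρ) {q : Space d → ℝ}
    (hq : ContDiffOn ℝ 1 q (closure Θ)) : ContinuousOn (flux a ρ q Θ) (frontier Θ) :=
  hρ.continuousOn.mul ((continuousOn_unitNormal hΘ hΘs).inner ((continuousOn_toEuclideanLin ha
    (continuousOn_gradientWithin (uniqueDiffOn_closure hΘ hΘs) hq)).mono frontier_subset_closure))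

end Green

/-- Green's formula: if `L* ρ = 0`, then for a compactly supported `w` that vanishes on the
boundary, `∫_Θ ρ L w` is the flux of `ρ a ∇w` through the boundary. -/
theorem integral_generator_eq_integral_flux {n : ℕ}
    {a : Space (n + 1) → Matrix (Fin (n + 1)) (Fin (n + 1)) ℝ}
    {b : Space (n + 1) → Space (n + 1)} {ρ : Space (n + 1) → ℝ}
    (ha : ∀ i j, ContDiff ℝ 2 fun x => a x i j) (hsymm : ∀ x i j, a x i j = a x j i)
    (hb : ContDiff ℝ 1 b) (hρ : ContDiff ℝ 2 ρ) (hadj : ∀ x, adjointGenerator a b ρ x = 0)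
    {Θ : Set (Space (n + 1))} (hΘ : IsOpen Θ) (hΘs : HasSmoothBoundary Θ)
    {w : Space (n + 1) → ℝ} (hwc : HasCompactSupport w) (hw2 : ContDiffOn ℝ 2 w Θ)
    (hw1 : ContDiffOn ℝ 1 w (closure Θ)) (hw0 : ∀ x ∈ frontier Θ, w x = 0)
    (hint : IntegrableOn (fun x => ρ x * generator a b w x) Θ) :
    ∫ x in Θ, ρ x * generator a b w x = ∫ x in frontier Θ, flux a ρ w Θ x ∂μHE[n] := by
  set F : Space (n + 1) → Space (n + 1) := fun x =>
    ρ x • Matrix.toEuclideanLin (a x) (gradientWithin w (closure Θ) x) -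
      w x • adjointCurrent a b ρ x with hF
  set G : Space (n + 1) → Space (n + 1) := fun x =>
    ρ x • Matrix.toEuclideanLin (a x) (gradient w x) - w x • adjointCurrent a b ρ x with hG
  have hFG : ∀ x ∈ Θ, F x = G x := fun x hx => by
    simp only [hF, hG, gradientWithin_eq_of_mem_isOpen hΘ hx]
  have hcur := contDiff_adjointCurrent ha hb hρ
  have hac : ∀ i j, Continuous fun x => a x i j := fun i j => (ha i j).continuous
  have hFc : HasCompactSupport F := by
    refine HasCompactSupport.intro hwc fun x hx => ?_
    have h0 : w =ᶠ[𝓝 x] fun _ => (0 : ℝ) := notMem_tsupport_iff_eventuallyEq.mp hx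
    have h1 : gradientWithin w (closure Θ) x = 0 := by
      rw [gradientWithin, (h0.filter_mono nhdsWithin_le_nhds).fderivWithin_eq h0.self_of_nhds]
      simp
    simp only [hF, h1, h0.self_of_nhds, map_zero, smul_zero, zero_smul, sub_zero]
  have hFcont : ContinuousOn F (closure Θ) :=
    (hρ.continuous.continuousOn.smul (continuousOn_toEuclideanLin hac
      (continuousOn_gradientWithin (uniqueDiffOn_closure hΘ hΘs) hw1))).sub
      (hw1.continuousOn.smul hcur.continuous.continuousOn)
  have hFd : ContDiffOn ℝ 1 F Θ := by
    refine ContDiffOn.congr ?_ hFG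
    refine ContDiffOn.sub ((hρ.of_le (by norm_num)).contDiffOn.smul ?_)
      ((hw2.of_le (by norm_num)).smul hcur.contDiffOn)
    refine contDiffOn_euclidean.mpr fun i => ?_
    simp only [toEuclideanLin_apply_apply, gradient_apply]
    refine ContDiffOn.sum fun j _ => ((ha i j).of_le (by norm_num)).contDiffOn.mul ?_
    exact (hw2.fderiv_of_isOpen hΘ (by norm_num)).clm_apply contDiffOn_const
  have hdiv : ∀ x ∈ Θ, divergence F x = ρ x * generator a b w x := fun x hx => by
    have h1 : divergence F x = divergence G x := by
      refine Finset.sum_congr rfl fun i _ => (pderiv_congr ?_ i).self_of_nhds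
      filter_upwards [hΘ.mem_nhds hx] with y hy
      rw [hFG y hy]
    rw [h1, divergence_green ha hsymm hb hρ (hw2.contDiffAt (hΘ.mem_nhds hx)), hadj, mul_zero,
      sub_zero]
  rw [← setIntegral_congr_fun hΘ.measurableSet hdiv,
    integral_divergence_eq hΘ hΘs hFc hFcont hFd
      (hint.congr_fun (fun x hx => (hdiv x hx).symm) hΘ.measurableSet)]
  refine setIntegral_congr_fun isClosed_frontier.measurableSet fun x hx => ?_
  simp only [hF, flux, hw0 x hx, zero_smul, sub_zero, inner_smul_right]

/-! ### The flux of the committor function -/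

section CommittorFlux

variable {d : ℕ} {a : Space d → Matrix (Fin d) (Fin d) ℝ} {b : Space d → Space d}
  {P : Kernel (Space d) (Path d)} {ρ : Space d → ℝ} {A B : Set (Space d)}

theorem frontier_region (hA : IsOpen A) (hB : IsOpen B) (hAs : HasSmoothBoundary A)
    (hBs : HasSmoothBoundary B) (hAB : Disjoint (closure A) (closure B)) :
    frontier (region A B) = frontier A ∪ frontier B := by
  rw [region, (hAs.union hA hB hAB hBs).frontier_compl_closure (hA.union hB),
    frontier_union_of_disjoint hA hB hAB]

theorem hasSmoothBoundary_region (hA : IsOpen A) (hB : IsOpen B) (hAs : HasSmoothBoundary A)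
    (hBs : HasSmoothBoundary B) (hAB : Disjoint (closure A) (closure B)) :
    HasSmoothBoundary (region A B) :=
  (hAs.union hA hB hAB hBs).compl_closure (hA.union hB)

/-- The committor function is the sum of a compactly supported function `w` that vanishes on the
closures of `A` and `B` and of a bounded function of class `C²` on the whole space that is locally
constant near these closures. -/
theorem exists_decomposition_committor (hP : IsDiffusion a b P)
    (hA_bdd : Bornology.IsBounded A) (hB_bdd : Bornology.IsBounded B)
    (hAB : Disjoint (closure A) (closure B))
    (hq : ContDiffOn ℝ 2 (committor P A B) (region A B)) :
    ∃ u : Space d → ℝ, ContDiff ℝ 2 u ∧ (∀ x, |u x| ≤ 2) ∧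
      HasCompactSupport (fun x => committor P A B x - u x) ∧
      ∀ x ∈ closure A ∪ closure B, u =ᶠ[𝓝 x] fun _ => committor P A B x := by
  set q := committor P A B with hqdef
  have hKA : IsCompact (closure A) := hA_bdd.isCompact_closure
  have hKB : IsCompact (closure B) := hB_bdd.isCompact_closure
  obtain ⟨χ, hχ, hχc, -, hχ1, hχI⟩ := exists_cutoff (hKA.union hKB) isOpen_univ (subset_univ _)
  obtain ⟨κ, hκ, hκc, hκA, hκ1, hκI⟩ := exists_cutoff hKB isClosed_closure.isOpen_compl
    (disjoint_left.mp hAB.symm)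
  rw [eventually_nhdsSet_iff_forall] at hχ1 hκ1
  set u : Space d → ℝ := fun x => (1 - χ x) * q x + κ x with hu
  have hloc : ∀ x ∈ closure A ∪ closure B, u =ᶠ[𝓝 x] fun _ => q x := by
    intro x hx
    have h1 := hχ1 x hx
    rcases hx with hx | hx
    · have hκ0 : κ =ᶠ[𝓝 x] 0 :=
        notMem_tsupport_iff_eventuallyEq.mp fun h => hκA h hx
      filter_upwards [h1, hκ0] with y hy hy0
      rw [hu, hqdef, committor_eq_zero hP hx]
      simp [hy, hy0]
    · filter_upwards [h1, hκ1 x hx] with y hy hy1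
      rw [hu, hqdef, committor_eq_one hP hAB hx]
      simp [hy, hy1]
  refine ⟨u, ?_, fun x => ?_, ?_, hloc⟩
  · refine contDiff_iff_contDiffAt.mpr fun x => ?_
    by_cases hx : x ∈ region A B
    · have h1 := hq.contDiffAt ((isOpen_region A B).mem_nhds hx)
      exact ((contDiff_const.sub (contDiff_infty.mp hχ 2)).contDiffAt.mul h1).add
        (contDiff_infty.mp hκ 2).contDiffAt
    · rw [region_eq, mem_compl_iff, not_not] at hx
      exact contDiffAt_const.congr_of_eventuallyEq (hloc x hx)
  · have h1 := committor_mem_Icc hP A B x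
    have h2 := hχI x
    have h3 := hκI x
    have h4 : 0 ≤ (1 - χ x) * q x := mul_nonneg (by linarith [h2.2]) h1.1
    have h5 : (1 - χ x) * q x ≤ 1 := mul_le_one₀ (by linarith [h2.1]) h1.1 h1.2
    rw [abs_of_nonneg (add_nonneg h4 h3.1)]
    linarith [h3.2]
  · have h : (fun x => q x - u x) = fun x => χ x * q x - κ x := by
      funext x; simp only [hu]; ring
    rw [h]
    exact hχc.mul_right.sub hκc

end CommittorFlux

section TotalFlux

variable {n : ℕ} {a : Space (n + 1) → Matrix (Fin (n + 1)) (Fin (n + 1)) ℝ}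
  {b : Space (n + 1) → Space (n + 1)} {P : Kernel (Space (n + 1)) (Path (n + 1))}
  {ρ : Space (n + 1) → ℝ} {A B : Set (Space (n + 1))}

/-- The total flux of the committor function through the boundary vanishes: by Green's formula it
is `∫_Θ ρ L w` for the compactly supported part `w = q - u`, where `L w = - L u` in `Θ` and
`L u = 0` elsewhere, so that it is `- ∫ ρ L u = 0` by invariance. -/
theorem integral_flux_committor_eq_zero (hP : IsDiffusion a b P)
    (ha : ∀ i j, ContDiff ℝ 2 fun x => a x i j) (hsymm : ∀ x i j, a x i j = a x j i)
    (hb : ContDiff ℝ 1 b) (hρ : ContDiff ℝ 2 ρ) (hρ0 : ∀ x, 0 ≤ ρ x)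
    (hρi : IsInvariantDensity P ρ) (hadj : ∀ x, adjointGenerator a b ρ x = 0)
    (hA : IsOpen A) (hB : IsOpen B)
    (hA_bdd : Bornology.IsBounded A) (hB_bdd : Bornology.IsBounded B)
    (hAs : HasSmoothBoundary A) (hBs : HasSmoothBoundary B)
    (hAB : Disjoint (closure A) (closure B))
    (hq : ContDiffOn ℝ 2 (committor P A B) (region A B))
    (hq1 : ContDiffOn ℝ 1 (committor P A B) (closure (region A B))) :
    ∫ x in frontier (region A B), flux a ρ (committor P A B) (region A B) x ∂μHE[n] = 0 := by
  set q := committor P A B with hqdef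
  set Θ := region A B with hΘdef
  have hΘ : IsOpen Θ := isOpen_region A B
  have hΘs : HasSmoothBoundary Θ := hasSmoothBoundary_region hA hB hAs hBs hAB
  have hac : ∀ i j, Continuous fun x => a x i j := fun i j => (ha i j).continuous
  obtain ⟨u, hu, huC, hwc, hloc⟩ := exists_decomposition_committor hP hA_bdd hB_bdd hAB hq
  set w : Space (n + 1) → ℝ := fun x => q x - u x with hw
  have hcompl : ∀ x, x ∉ Θ → x ∈ closure A ∪ closure B := fun x hx => by
    rwa [hΘdef, region_eq, mem_compl_iff, not_not] at hx
  have hfr : ∀ x ∈ frontier Θ, x ∈ closure A ∪ closure B := fun x hx =>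
    hcompl x (hΘ.frontier_eq ▸ hx).2
  have hLu : ∀ x, x ∉ Θ → generator a b u x = 0 := fun x hx => by
    rw [generator_congr (hloc x (hcompl x hx)), generator_const]
  have hLw : ∀ x ∈ Θ, generator a b w x = -generator a b u x := by
    intro x hx
    have hLq := hP.generator_committor_eq_zero hac hb.continuous hq hx
    have hqx : ContDiffAt ℝ 2 q x := hq.contDiffAt (hΘ.mem_nhds hx)
    have h1 : ∀ i, pderiv i w =ᶠ[𝓝 x] fun y => pderiv i q y - pderiv i u y := fun i => by
      filter_upwards [hΘ.mem_nhds hx] with y hy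
      exact pderiv_sub i ((hq.contDiffAt (hΘ.mem_nhds hy)).differentiableAt (by norm_num))
        (hu.differentiable (by norm_num) y)
    have h2 : ∀ i j, pderiv i (pderiv j w) x =
        pderiv i (pderiv j q) x - pderiv i (pderiv j u) x := fun i j => by
      rw [(pderiv_congr (h1 j) i).self_of_nhds]
      have hd : ContDiffAt ℝ 1 (fderiv ℝ q) x := hqx.fderiv_right (by norm_num)
      exact pderiv_sub i ((hd.differentiableAt (by norm_num)).clm_apply (differentiableAt_const _))
        ((contDiff_pderiv (k := 1) hu (by norm_num) j).differentiable (by norm_num) x)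
    have h3 : generator a b w x = generator a b q x - generator a b u x := by
      simp only [generator, h2, (h1 _).self_of_nhds, mul_sub, Finset.sum_sub_distrib]
      ring
    rw [h3, hLq, zero_sub]
  obtain ⟨R, hR⟩ := ((hwc.isCompact.isBounded.union hA_bdd.closure).union
    hB_bdd.closure).subset_closedBall (0 : Space (n + 1))
  have huq : ∀ x ∉ closedBall (0 : Space (n + 1)) R, u x = q x := fun x hx => by
    have h : w x = 0 := image_eq_zero_of_notMem_tsupport fun h => hx (hR (.inl (.inl h)))
    simp only [hw] at h
    linarith
  have hstat : ∫ x, ρ x * generator a b u x = 0 :=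
    hP.integral_generator_eq_zero hac hb.continuous hρ.continuous.measurable hρ0 hρi
      (fun x hx => hR (.inl (.inr hx))) (fun x hx => hR (.inr hx)) hu huC huq
  have hcs : HasCompactSupport fun x => ρ x * generator a b u x := by
    refine HasCompactSupport.intro (isCompact_closedBall (0 : Space (n + 1)) R) fun x hx => ?_
    have hxΘ : x ∈ Θ := by
      by_contra h
      rcases hcompl x h with h | h
      · exact hx (hR (.inl (.inr h)))
      · exact hx (hR (.inr h))
    have h0 : u =ᶠ[𝓝 x] q := by
      filter_upwards [isClosed_closedBall.isOpen_compl.mem_nhds hx] with y hy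
      exact huq y hy
    rw [generator_congr h0, hP.generator_committor_eq_zero hac hb.continuous hq hxΘ, mul_zero]
  have hLc : Integrable fun x => ρ x * generator a b u x :=
    (hρ.continuous.mul (continuous_generator hac hb.continuous hu)).integrable_of_hasCompactSupport
      hcs
  have hcongr : ∀ x ∈ Θ, ρ x * generator a b w x = -(ρ x * generator a b u x) := fun x hx => by
    rw [hLw x hx, mul_neg]
  have hgreen := integral_generator_eq_integral_flux ha hsymm hb hρ hadj hΘ hΘs hwc
    (hq.sub hu.contDiffOn) (hq1.sub (hu.of_le (by norm_num)).contDiffOn)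
    (fun x hx => by simp only [hw, (hloc x (hfr x hx)).self_of_nhds, hqdef, sub_self])
    ((hLc.neg.integrableOn (s := Θ)).congr_fun (fun x hx => (hcongr x hx).symm) hΘ.measurableSet)
  have hflux : ∀ x ∈ frontier Θ, flux a ρ q Θ x = flux a ρ w Θ x := by
    intro x hx
    have h : w =ᶠ[𝓝[closure Θ] x] fun y => q y - q x := by
      refine EventuallyEq.filter_mono ?_ nhdsWithin_le_nhds
      filter_upwards [hloc x (hfr x hx)] with y hy
      simp only [hw, hy, hqdef]
    have h2 : gradientWithin w (closure Θ) x = gradientWithin q (closure Θ) x := by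
      rw [gradientWithin, gradientWithin, h.fderivWithin_eq_of_mem (frontier_subset_closure hx),
        fderivWithin_sub_const]
    rw [flux, flux, h2]
  rw [setIntegral_congr_fun isClosed_frontier.measurableSet hflux, ← hgreen,
    setIntegral_congr_fun hΘ.measurableSet hcongr, integral_neg,
    setIntegral_eq_integral_of_forall_compl_eq_zero (fun x hx => by rw [hLu x hx, mul_zero]),
    hstat, neg_zero]

end TotalFlux

theorem surfaceMeasure_eq_zero (D : Set (Space 0)) : surfaceMeasure D = 0 := by
  rw [surfaceMeasure, (isClopen_discrete D).frontier_eq, Measure.restrict_empty]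

theorem integrable_surfaceMeasure {n : ℕ} {D : Set (Space (n + 1))} (hD : IsOpen D)
    (hDs : HasSmoothBoundary D) (hDb : Bornology.IsBounded D) {f : Space (n + 1) → ℝ}
    (hf : ContinuousOn f (frontier D)) : Integrable f (surfaceMeasure D) := by
  have hK : IsCompact (frontier D) :=
    hDb.isCompact_closure.of_isClosed_subset isClosed_frontier frontier_subset_closure
  have hfin := measure_frontier_inter_lt_top hD hDs hK
  rw [inter_self] at hfin
  obtain ⟨C, hC⟩ := hK.exists_bound_of_continuousOn hf
  exact IntegrableOn.of_bound hfin (hf.aestronglyMeasurable isClosed_frontier.measurableSet) C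
    ((ae_restrict_iff' isClosed_frontier.measurableSet).mpr (Eventually.of_forall hC))

/-- Integrability is essential here: without it, the signed measures would be zero by convention. -/
theorem etaA_eq_etaB {d : ℕ} {a : Space d → Matrix (Fin d) (Fin d) ℝ} {ρ q : Space d → ℝ}
    {A B : Set (Space d)} (hA : Integrable (flux a ρ q (region A B)) (surfaceMeasure A))
    (hB : Integrable (flux a ρ q (region A B)) (surfaceMeasure B))
    (h0 : (∫ x, flux a ρ q (region A B) x ∂(surfaceMeasure A)) +
      (∫ x, flux a ρ q (region A B) x ∂(surfaceMeasure B)) = 0) :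
    etaA a ρ q A B (frontier A) = etaB a ρ q A B (frontier B) := by
  have hmeas : ∀ D : Set (Space d), MeasurableSet (frontier D) := fun D =>
    isClosed_frontier.measurableSet
  have h1 : Integrable (fun x => -flux a ρ q (region A B) x) (surfaceMeasure A) := hA.neg
  rw [etaA, etaB, withDensityᵥ_apply h1 (hmeas A), withDensityᵥ_apply hB (hmeas B), integral_neg]
  simp only [surfaceMeasure, Measure.restrict_restrict (hmeas _), inter_self] at h0 ⊢
  linarith

end TransitionPath

theorem lemma1p1 {d : ℕ}
    -- the coefficients of the stochastic differential equation
    (σ a : TransitionPath.Space d → Matrix (Fin d) (Fin d) ℝ)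
    (b : TransitionPath.Space d → TransitionPath.Space d)
    (haσ : ∀ x, a x = σ x * (σ x).transpose)
    (ha : ∀ i j, ContDiff ℝ ∞ fun x => a x i j)
    (hell : TransitionPath.UniformlyElliptic a)
    (hb : ContDiff ℝ ∞ b)
    -- the process and its invariant density
    (P : Kernel (TransitionPath.Space d) (TransitionPath.Path d))
    (hP : TransitionPath.IsDiffusion a b P)
    (ρ : TransitionPath.Space d → ℝ)
    (hρ : ContDiff ℝ 2 ρ) (hρ_pos : ∀ x, 0 < ρ x)
    (hρ_inv : TransitionPath.IsInvariantDensity P ρ)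
    (hρ_adj : ∀ x, TransitionPath.adjointGenerator a b ρ x = 0)
    -- the sets
    (A B : Set (TransitionPath.Space d))
    (hA : IsOpen A) (hB : IsOpen B)
    (hA_bdd : Bornology.IsBounded A) (hB_bdd : Bornology.IsBounded B)
    (hA_smooth : TransitionPath.HasSmoothBoundary A)
    (hB_smooth : TransitionPath.HasSmoothBoundary B)
    (hAB : Disjoint (closure A) (closure B))
    -- the committor function, in its usual regularity class
    (q : TransitionPath.Space d → ℝ) (hq : q = TransitionPath.committor P A B)
    (hq_int : ContDiffOn ℝ 2 q (TransitionPath.region A B))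
    (hq_bdry : ContDiffOn ℝ 1 q (closure (TransitionPath.region A B))) :
    -- the flux density is integrable over both boundaries
    Integrable (TransitionPath.flux a ρ q (TransitionPath.region A B))
        (TransitionPath.surfaceMeasure A) ∧
      Integrable (TransitionPath.flux a ρ q (TransitionPath.region A B))
        (TransitionPath.surfaceMeasure B) ∧
      -- equality of the masses
      TransitionPath.etaA a ρ q A B (frontier A) = TransitionPath.etaB a ρ q A B (frontier B) ∧
      -- the total flux vanishes
      (∫ x, TransitionPath.flux a ρ q (TransitionPath.region A B) x
            ∂(TransitionPath.surfaceMeasure A)) +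
          (∫ x, TransitionPath.flux a ρ q (TransitionPath.region A B) x
            ∂(TransitionPath.surfaceMeasure B)) = 0 ∧
      ∫ x, TransitionPath.flux a ρ q (TransitionPath.region A B) x
          ∂(TransitionPath.surfaceMeasure (TransitionPath.region A B)) = 0 := by
  subst hq
  obtain _ | n := d
  · -- in dimension zero all boundaries are empty
    have hz := TransitionPath.surfaceMeasure_eq_zero
    refine ⟨?_, ?_, TransitionPath.etaA_eq_etaB ?_ ?_ ?_, ?_, ?_⟩ <;> simp [hz]
  have hfr := TransitionPath.frontier_region hA hB hA_smooth hB_smooth hAB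
  have hfc := TransitionPath.continuousOn_flux (TransitionPath.isOpen_region A B)
    (TransitionPath.hasSmoothBoundary_region hA hB hA_smooth hB_smooth hAB)
    (fun i j => (ha i j).continuous) hρ.continuous hq_bdry
  rw [hfr] at hfc
  have hIA := TransitionPath.integrable_surfaceMeasure hA hA_smooth hA_bdd
    (hfc.mono Set.subset_union_left)
  have hIB := TransitionPath.integrable_surfaceMeasure hB hB_smooth hB_bdd
    (hfc.mono Set.subset_union_right)
  have hsymm : ∀ x i j, a x i j = a x j i := fun x i j => by
    simp only [haσ, Matrix.mul_apply, Matrix.transpose_apply, mul_comm]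
  have h0 := TransitionPath.integral_flux_committor_eq_zero hP
    (fun i j => contDiff_infty.mp (ha i j) 2) hsymm (contDiff_infty.mp hb 1) hρ
    (fun x => (hρ_pos x).le) hρ_inv hρ_adj hA hB hA_bdd hB_bdd hA_smooth hB_smooth hAB hq_int
    hq_bdry
  have hsum := h0
  rw [hfr, setIntegral_union (μ := μHE[n]) (hAB.mono frontier_subset_closure frontier_subset_closure)
    isClosed_frontier.measurableSet hIA hIB] at hsum
  exact ⟨hIA, hIB, TransitionPath.etaA_eq_etaB hIA hIB hsum, hsum, h0⟩
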